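/- Let $G$ be a countable discrete group and let $\rtimes_\mu G$ be an exact crossed product functor, i.e. a functor $A\mapsto A\rtimes_\mu G$ from $G$-$C^*$-algebras to $C^*$-algebras completing $C_c(G,A)$ in a $C^*$-norm between the reduced and the maximal one, and preserving short exact sequences. A $\sigma$-$G$-metric space $\mathcal Y$ is an increasing sequence $Y_0\subset Y_1\subset\dots$ of proper metric spaces of continuously bounded geometry with proper isometric $G$-actions, such that the inclusions are $G$-equivariant continuous coarse embeddings with closed image; we also write $\mathcal Y$ for $\bigcup_m Y_m$ with the final topology. It is $\sigma$-$G$-compact if every $Y_m$ is $G$-compact. Here continuously bounded geometry of $Y$ means: there are constants $K_{r,R}>0$ and subsets $\hat Y_r\subset Y$ ($r,R>0$) such that the $r$-balls with centers in $\hat Y_r$ cover $Y$, every closed $R$-ball contains at most $K_{r,R}$ points of $\hat Y_r$, and $\limsup_{r\to0}K_{r,\alpha r}<\infty$ for all $\alpha>0$. A subspace $\mathcal B\subset\mathcal Y$ is a $\sigma$-$G$-metric space $B_0\subset B_1\subset\dots$ with $B_m=\mathcal B\cap Y_m$, carrying the restricted metrics and actions. Write $\mathcal K=\mathcal K(\ell^2(\mathbb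 N))$. For a proper metric space $Y$ let $\bar{\mathfrak c}^{\mathrm{red}}(Y)$ be the $C^*$-algebra of bounded continuous $f\colon Y\to\mathcal B(\ell^2(\mathbb N))$ with $f(x)-f(y)\in\mathcal K$ for all $x,y$ and of vanishing variation, i.e. $x\mapsto\sup\{\|f(x)-f(y)\| : d(x,y)<r\}$ tends to $0$ at infinity for every $r>0$; let $\mathfrak c^{\mathrm{red}}(Y)=\bar{\mathfrak c}^{\mathrm{red}}(Y)/C_0(Y,\mathcal K)$, and for closed $B\subset Y$ let $\bar{\mathfrak c}^{\mathrm{red}}(Y,B)$ be the kernel of the restriction $\bar{\mathfrak c}^{\mathrm{red}}(Y)\to\bar{\mathfrak c}^{\mathrm{red}}(B)$. For a $\sigma$-$G$-metric space $\mathcal Y$ with subspace $\mathcal B$, all of $C_0(\mathcal Y\setminus\mathcal B)$, $C_0(\mathcal Y\setminus\mathcal B,\mathcal K)$, $\bar{\mathfrak c}^{\mathrm{red}}(\mathcal Y,\mathcal B)$, $\mathfrak c^{\mathrm{red}}(\mathcal Y)$ and their crossed products are the inverse limits over $m$ of the corresponding $C^*$-algebras for $(Y_m,B_m)$; they are $\sigma$-$C^*$-algebras,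 and $K_*$ denotes the K-theory of $\sigma$-$C^*$-algebras. Put $K_G^{m}(\mathcal Y,\mathcal B)=K_{-m}(C_0(\mathcal Y\setminus\mathcal B)\rtimes_\mu G)$ and $K_G^m(\mathcal Y)=K_G^m(\mathcal Y,\emptyset)$. Let $\mathcal X$ be a nonempty $\sigma$-$G$-compact $\sigma$-$G$-metric space which is a subspace of a $\sigma$-$G$-compact $\sigma$-$G$-metric space $\underline{\mathrm E}G$ that is a model of the classifying space for proper $G$-actions, i.e. which is $G$-homotopy equivalent to a proper $G$-CW-complex with countably many cells all of whose fixed point sets under finite subgroups are contractible. Let $n\in\mathbb Z$. Then the following hold. 1. The canonical map $K_G^{n+1}(\underline{\mathrm E}G,\mathcal X)\to K_{-n-1}(\bar{\mathfrak c}^{\mathrm{red}}(\underline{\mathrm E}G,\mathcal X)\rtimes_\mu G)$ and the stabilisation map $K_G^{n+1}(\underline{\mathrm E}G)\to K_{-n-1}(C_0(\underline{\mathrm E}G,\mathcal K)\rtimes_\mu G)$, both given by a rank one projection in $\mathcal K$, are isomorphisms. Consequently there are a unique homomorphism $$\delta_{\mathcal X}\colon K_{-n}(\bar{\mathfrak c}^{\mathrm{red}}(\mathcal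 X)\rtimes_\mu G)\to K_G^{n+1}(\underline{\mathrm E}G,\mathcal X)$$ whose composition with the first isomorphism is the K-theory boundary map of $0\to\bar{\mathfrak c}^{\mathrm{red}}(\underline{\mathrm E}G,\mathcal X)\rtimes_\mu G\to\bar{\mathfrak c}^{\mathrm{red}}(\underline{\mathrm E}G)\rtimes_\mu G\to\bar{\mathfrak c}^{\mathrm{red}}(\mathcal X)\rtimes_\mu G\to0$, and a unique homomorphism (the equivariant coarse co-assembly map) $$\mu_G^*\colon K_{-n}(\mathfrak c^{\mathrm{red}}(\underline{\mathrm E}G)\rtimes_\mu G)\to K_G^{n+1}(\underline{\mathrm E}G)$$ whose composition with the second isomorphism is the K-theory boundary map of $0\to C_0(\underline{\mathrm E}G,\mathcal K)\rtimes_\mu G\to\bar{\mathfrak c}^{\mathrm{red}}(\underline{\mathrm E}G)\rtimes_\mu G\to\mathfrak c^{\mathrm{red}}(\underline{\mathrm E}G)\rtimes_\mu G\to0$. 2. A class $\theta\in K_G^{n+1}(\underline{\mathrm E}G,\mathcal X)$ lies in the image of $\delta_{\mathcal X}$ if and only if its image under the natural map $K_G^{n+1}(\underline{\mathrm E}G,\mathcal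 X)\to K_G^{n+1}(\underline{\mathrm E}G)$ lies in the image of $\mu_G^*$. -/

import Mathlib

open Filter Topology
open scoped ENNReal BoundedContinuousFunction

set_option linter.unusedSectionVars false

universe u v

noncomputable section

namespace HigsonRoe

/-! ### Quotients of C*-algebras by closed ideals -/

/-- A closed two-sided star-ideal of a C*-algebra. -/
structure ClosedIdeal (A : Type u) [NonUnitalCStarAlgebra A] where
  carrier : Submodule ℂ A
  isClosed : IsClosed (carrier : Set A)
  mul_left : ∀ (a : A) {x : A}, x ∈ carrier → a * x ∈ carrier
  mul_right : ∀ (a : A) {x : A}, x ∈ carrier → x * a ∈ carrier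
  star_mem : ∀ {x : A}, x ∈ carrier → star x ∈ carrier

namespace ClosedIdeal

variable {A : Type u} [NonUnitalCStarAlgebra A] (J : ClosedIdeal A)

/-- The quotient C*-algebra `A / J`, with the quotient norm. -/
def Quo : Type u := A ⧸ J.carrier

instance : NormedAddCommGroup J.Quo :=
  haveI : IsClosed (J.carrier : Set A) := J.isClosed
  inferInstanceAs (NormedAddCommGroup (A ⧸ J.carrier))

instance : NormedSpace ℂ J.Quo :=
  haveI : IsClosed (J.carrier : Set A) := J.isClosed
  inferInstanceAs (NormedSpace ℂ (A ⧸ J.carrier))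

instance : CompleteSpace J.Quo :=
  haveI : IsClosed (J.carrier : Set A) := J.isClosed
  inferInstanceAs (CompleteSpace (A ⧸ J.carrier))

/-- The class of an element in the quotient. -/
def proj (a : A) : J.Quo := Submodule.Quotient.mk a

theorem proj_surjective : Function.Surjective J.proj := Submodule.Quotient.mk_surjective _

theorem proj_eq_iff {a b : A} : J.proj a = J.proj b ↔ a - b ∈ J.carrier := Submodule.Quotient.eq _

theorem norm_proj_le (a : A) : ‖J.proj a‖ ≤ ‖a‖ := Submodule.Quotient.norm_mk_le _ a

theorem exists_norm_lt (x : J.Quo) {ε : ℝ} (hε : 0 < ε) : ∃ a, J.proj a = x ∧ ‖a‖ < ‖x‖ + ε :=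
  Submodule.Quotient.norm_mk_lt x hε

instance : Mul J.Quo where
  mul := Quotient.map₂ (fun a b => a * b) (by
    intro a a' h b b' h'
    rw [← Quotient.eq_iff_equiv] at h h' ⊢
    replace h := (Submodule.Quotient.eq _).1 h
    replace h' := (Submodule.Quotient.eq _).1 h'
    refine (Submodule.Quotient.eq _).2 ?_
    have : a * b - a' * b' = (a - a') * b + a' * (b - b') := by noncomm_ring
    rw [this]
    exact add_mem (J.mul_right _ h) (J.mul_left _ h'))

theorem proj_mul (a b : A) : J.proj (a * b) = J.proj a * J.proj b := rfl
theorem proj_add (a b : A) : J.proj (a + b) = J.proj a + J.proj b := rfl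
theorem proj_smul (c : ℂ) (b : A) : J.proj (c • b) = c • J.proj b := rfl
theorem proj_zero : J.proj 0 = 0 := rfl

instance : NonUnitalNormedRing J.Quo where
  __ := (inferInstance : NormedAddCommGroup J.Quo)
  left_distrib x y z := by
    obtain ⟨a, rfl⟩ := J.proj_surjective x
    obtain ⟨b, rfl⟩ := J.proj_surjective y
    obtain ⟨c, rfl⟩ := J.proj_surjective z
    simp only [← proj_mul, ← proj_add, mul_add]
  right_distrib x y z := by
    obtain ⟨a, rfl⟩ := J.proj_surjective x
    obtain ⟨b, rfl⟩ := J.proj_surjective y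
    obtain ⟨c, rfl⟩ := J.proj_surjective z
    simp only [← proj_mul, ← proj_add, add_mul]
  zero_mul x := by
    obtain ⟨a, rfl⟩ := J.proj_surjective x
    rw [← proj_zero, ← proj_mul, zero_mul]
  mul_zero x := by
    obtain ⟨a, rfl⟩ := J.proj_surjective x
    rw [← proj_zero, ← proj_mul, mul_zero]
  mul_assoc x y z := by
    obtain ⟨a, rfl⟩ := J.proj_surjective x
    obtain ⟨b, rfl⟩ := J.proj_surjective y
    obtain ⟨c, rfl⟩ := J.proj_surjective z
    simp only [← proj_mul, mul_assoc]
  norm_mul_le x y := by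
    have key : ∀ δ > 0, ‖x * y‖ ≤ (‖x‖ + δ) * (‖y‖ + δ) := by
      intro δ hδ
      obtain ⟨a, rfl, ha⟩ := J.exists_norm_lt x hδ
      obtain ⟨b, rfl, hb⟩ := J.exists_norm_lt y hδ
      rw [← proj_mul]
      calc _ ≤ ‖a * b‖ := J.norm_proj_le _
        _ ≤ ‖a‖ * ‖b‖ := norm_mul_le _ _
        _ ≤ _ := by gcongr
    have h : Tendsto (fun δ : ℝ => (‖x‖ + δ) * (‖y‖ + δ)) (𝓝[>] 0)
        (𝓝 ((‖x‖ + 0) * (‖y‖ + 0))) := by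
      apply Tendsto.mono_left _ nhdsWithin_le_nhds
      exact (by fun_prop : Continuous fun δ : ℝ => (‖x‖ + δ) * (‖y‖ + δ)).tendsto 0
    simp only [add_zero] at h
    exact ge_of_tendsto h (by filter_upwards [self_mem_nhdsWithin] with δ hδ using key δ hδ)

instance : StarRing J.Quo where
  star := Quotient.map star (by
    intro a a' h
    rw [← Quotient.eq_iff_equiv] at h ⊢
    replace h := (Submodule.Quotient.eq _).1 h
    refine (Submodule.Quotient.eq _).2 ?_
    rw [← star_sub]
    exact J.star_mem h)
  star_involutive x := by
    obtain ⟨a, rfl⟩ := J.proj_surjective x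
    exact congrArg J.proj (star_star a)
  star_mul x y := by
    obtain ⟨a, rfl⟩ := J.proj_surjective x
    obtain ⟨b, rfl⟩ := J.proj_surjective y
    exact congrArg J.proj (star_mul a b)
  star_add x y := by
    obtain ⟨a, rfl⟩ := J.proj_surjective x
    obtain ⟨b, rfl⟩ := J.proj_surjective y
    exact congrArg J.proj (star_add a b)

theorem proj_star (a : A) : J.proj (star a) = star (J.proj a) := rfl

instance : StarModule ℂ J.Quo where
  star_smul c x := by
    obtain ⟨a, rfl⟩ := J.proj_surjective x
    exact congrArg J.proj (star_smul c a)

instance : IsScalarTower ℂ J.Quo J.Quo where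
  smul_assoc c x y := by
    obtain ⟨a, rfl⟩ := J.proj_surjective x
    obtain ⟨b, rfl⟩ := J.proj_surjective y
    exact congrArg J.proj (smul_mul_assoc c a b)

instance : SMulCommClass ℂ J.Quo J.Quo where
  smul_comm c x y := by
    obtain ⟨a, rfl⟩ := J.proj_surjective x
    obtain ⟨b, rfl⟩ := J.proj_surjective y
    exact congrArg J.proj (mul_smul_comm c a b).symm

theorem norm_compress_le {x z : A}
    (h1 : ‖(1 : Unitization ℂ A) - x‖ ≤ 1) : ‖z - x * z - (z - x * z) * x‖ ≤ ‖z‖ := by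
  rw [← Unitization.norm_inr (𝕜 := ℂ) (z - x * z - (z - x * z) * x),
    ← Unitization.norm_inr (𝕜 := ℂ) z]
  have : ((z - x * z - (z - x * z) * x : A) : Unitization ℂ A) = (1 - (x : Unitization ℂ A)) * z *
      (1 - (x : Unitization ℂ A)) := by
    simp only [Unitization.inr_sub, Unitization.inr_mul]
    noncomm_ring
  rw [this]
  calc _ ≤ ‖(1 : Unitization ℂ A) - x‖ * ‖(z : Unitization ℂ A)‖ * ‖(1 : Unitization ℂ A) - x‖ :=
        (norm_mul_le _ _).trans (by gcongr; exact norm_mul_le _ _)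
    _ ≤ 1 * ‖(z : Unitization ℂ A)‖ * 1 := by gcongr
    _ = _ := by ring

/-- A closed ideal as a star-subalgebra. -/
def toSubalgebra : NonUnitalStarSubalgebra ℂ A where
  carrier := J.carrier
  add_mem' := J.carrier.add_mem
  zero_mem' := J.carrier.zero_mem
  mul_mem' := fun {a _} _ hb => J.mul_left a hb
  smul_mem' := fun c _ hx => J.carrier.smul_mem c hx
  star_mem' := J.star_mem

theorem exists_approx_unit (i : A) (hi : i ∈ J.carrier) {ε : ℝ} (hε : 0 < ε) :
    ∃ e ∈ J.carrier, IsSelfAdjoint e ∧ ‖(1 : Unitization ℂ A) - e‖ ≤ 1 ∧ ‖i - i * e‖ < ε := by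
  have : IsClosed (J.toSubalgebra : Set A) := J.isClosed
  let _ : NonUnitalCStarAlgebra J.toSubalgebra :=
    NonUnitalStarSubalgebra.nonUnitalCStarAlgebra J.toSubalgebra
  let _ := CStarAlgebra.spectralOrder J.toSubalgebra
  have := CStarAlgebra.spectralOrderedRing J.toSubalgebra
  have hl := CStarAlgebra.increasingApproximateUnit J.toSubalgebra
  have h1 := (Metric.tendsto_nhds.1 (hl.tendsto_mul_left ⟨i, hi⟩)) ε hε
  obtain ⟨e, ⟨he0, hen⟩, he1⟩ :=
    ((hl.eventually_nonneg.and hl.eventually_norm).and h1).exists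
  let _ := CStarAlgebra.spectralOrder (Unitization ℂ A)
  have := CStarAlgebra.spectralOrderedRing (Unitization ℂ A)
  let _ := CStarAlgebra.spectralOrder A
  have := CStarAlgebra.spectralOrderedRing A
  have hsa : IsSelfAdjoint (e : A) := congrArg Subtype.val (IsSelfAdjoint.of_nonneg he0)
  refine ⟨e, e.2, hsa, ?_, ?_⟩
  · have hA : (0 : A) ≤ e := by
      have := (StarOrderedRing.nonneg_iff (R := J.toSubalgebra)).1 he0
      rw [StarOrderedRing.nonneg_iff]
      have := AddSubmonoid.mem_map_of_mem
        (NonUnitalStarSubalgebraClass.subtype J.toSubalgebra) this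
      rw [AddMonoidHom.map_mclosure, ← Set.range_comp] at this
      apply AddSubmonoid.closure_mono ?_ this
      rintro _ ⟨s, rfl⟩
      exact ⟨s, rfl⟩
    have hU : (0 : Unitization ℂ A) ≤ (e : A) := Unitization.inr_nonneg_iff.2 hA
    have hU1 : ((e : A) : Unitization ℂ A) ≤ 1 := by
      rw [← CStarAlgebra.norm_le_one_iff_of_nonneg _ hU, Unitization.norm_inr]
      exact hen
    rw [CStarAlgebra.norm_le_one_iff_of_nonneg _ (sub_nonneg.2 hU1)]
    exact sub_le_self _ hU
  · rw [dist_eq_norm, norm_sub_rev] at he1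
    exact he1

instance : CStarRing J.Quo where
  norm_mul_self_le x := by
    have key : ∀ δ > 0, ‖x‖ * ‖x‖ ≤ ‖star x * x‖ + δ := by
      intro δ hδ
      obtain ⟨a, rfl⟩ := J.proj_surjective x
      rw [← proj_star, ← proj_mul]
      obtain ⟨z, hz, hzn⟩ := J.exists_norm_lt (J.proj (star a * a)) (half_pos hδ)
      have hi : star a * a - z ∈ J.carrier := (J.proj_eq_iff).1 hz.symm
      obtain ⟨e, heJ, hsa, h1, he⟩ := J.exists_approx_unit _ hi (half_pos hδ)
      set i := star a * a - z with hidef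
      have hpa : J.proj a = J.proj (a - a * e) := by
        rw [proj_eq_iff]
        simpa using J.mul_left a heJ
      have h2 : ‖a - a * e‖ * ‖a - a * e‖ ≤ ‖z‖ + ‖i - i * e‖ := by
        rw [← CStarRing.norm_star_mul_self]
        have hexp : star (a - a * e) * (a - a * e) =
            (z - e * z - (z - e * z) * e) + ((i - i * e) - e * (i - i * e)) := by
          rw [hidef, star_sub, star_mul, hsa.star_eq]
          noncomm_ring
        rw [hexp]
        refine (norm_add_le _ _).trans (add_le_add (norm_compress_le h1) ?_)
        rw [← Unitization.norm_inr (𝕜 := ℂ) (i - i * e - e * (i - i * e)),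
          ← Unitization.norm_inr (𝕜 := ℂ) (i - i * e)]
        have h3 : ((i - i * e - e * (i - i * e) : A) : Unitization ℂ A) =
            (1 - (e : Unitization ℂ A)) * ((i - i * e : A) : Unitization ℂ A) := by
          simp only [Unitization.inr_sub, Unitization.inr_mul]
          noncomm_ring
        rw [h3]
        calc _ ≤ ‖(1 : Unitization ℂ A) - e‖ * ‖((i - i * e : A) : Unitization ℂ A)‖ :=
              norm_mul_le _ _
          _ ≤ 1 * ‖((i - i * e : A) : Unitization ℂ A)‖ := by gcongr
          _ = _ := one_mul _
      calc ‖J.proj a‖ * ‖J.proj a‖ ≤ ‖a - a * e‖ * ‖a - a * e‖ := by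
            rw [hpa]; gcongr <;> exact J.norm_proj_le _
        _ ≤ _ := by linarith
    exact le_of_forall_pos_le_add key

instance : NonUnitalCStarAlgebra J.Quo where

/-- The quotient map. -/
def projHom : A →⋆ₙₐ[ℂ] J.Quo where
  toFun := J.proj
  map_smul' _ _ := rfl
  map_zero' := rfl
  map_add' _ _ := rfl
  map_mul' _ _ := rfl
  map_star' _ := rfl

/-- The map induced on quotients by a star-homomorphism mapping one ideal into the other. -/
def mapHom {B : Type u} [NonUnitalCStarAlgebra B] (J : ClosedIdeal A) (K : ClosedIdeal B)
    (φ : A →⋆ₙₐ[ℂ] B) (h : ∀ x ∈ J.carrier, φ x ∈ K.carrier) : J.Quo →⋆ₙₐ[ℂ] K.Quo where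
  toFun := Quotient.map φ (by
    intro a a' h'
    rw [← Quotient.eq_iff_equiv] at h' ⊢
    replace h' := (Submodule.Quotient.eq _).1 h'
    refine (Submodule.Quotient.eq _).2 ?_
    rw [← map_sub]
    exact h _ h')
  map_smul' c x := by
    obtain ⟨a, rfl⟩ := J.proj_surjective x
    exact congrArg K.proj (map_smul φ c a)
  map_zero' := congrArg K.proj (map_zero φ)
  map_add' x y := by
    obtain ⟨a, rfl⟩ := J.proj_surjective x
    obtain ⟨b, rfl⟩ := J.proj_surjective y
    exact congrArg K.proj (map_add φ a b)
  map_mul' x y := by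
    obtain ⟨a, rfl⟩ := J.proj_surjective x
    obtain ⟨b, rfl⟩ := J.proj_surjective y
    exact congrArg K.proj (map_mul φ a b)
  map_star' x := by
    obtain ⟨a, rfl⟩ := J.proj_surjective x
    exact congrArg K.proj (map_star φ a)

@[simp] theorem mapHom_proj {B : Type u} [NonUnitalCStarAlgebra B] (J : ClosedIdeal A)
    (K : ClosedIdeal B) (φ : A →⋆ₙₐ[ℂ] B) (h : ∀ x ∈ J.carrier, φ x ∈ K.carrier) (a : A) :
    mapHom J K φ h (J.proj a) = K.proj (φ a) := rfl

end ClosedIdeal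

/-! ### Matrix algebras and the stabilisation `K ⊗ A` -/

/-- The C*-algebra `M_n(A)`. -/
def MatAlg (n : ℕ) (A : Type u) : Type u := CStarMatrix (Fin n) (Fin n) A

namespace MatAlg

variable {A B : Type u} [NonUnitalCStarAlgebra A] [NonUnitalCStarAlgebra B] {n : ℕ}

instance : NonUnitalCStarAlgebra (MatAlg n A) :=
  letI := CStarAlgebra.spectralOrder A
  haveI := CStarAlgebra.spectralOrderedRing A
  inferInstanceAs (NonUnitalCStarAlgebra (CStarMatrix (Fin n) (Fin n) A))

/-- The matrix with given entries. -/
def of (f : Fin n → Fin n → A) : MatAlg n A := f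

/-- The entries of a matrix. -/
def entry (M : MatAlg n A) (p q : Fin n) : A := M p q

@[ext] theorem ext {M N : MatAlg n A} (h : ∀ p q, M.entry p q = N.entry p q) : M = N :=
  funext fun p => funext fun q => h p q

@[simp] theorem entry_of (f : Fin n → Fin n → A) (p q : Fin n) : (of f).entry p q = f p q := rfl
@[simp] theorem entry_add (M N : MatAlg n A) (p q : Fin n) :
    (M + N).entry p q = M.entry p q + N.entry p q := rfl
@[simp] theorem entry_zero (p q : Fin n) : (0 : MatAlg n A).entry p q = 0 := rfl
@[simp] theorem entry_smul (c : ℂ) (M : MatAlg n A) (p q : Fin n) :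
    (c • M).entry p q = c • M.entry p q := rfl
@[simp] theorem entry_star (M : MatAlg n A) (p q : Fin n) :
    (star M).entry p q = star (M.entry q p) := rfl
@[simp] theorem entry_mul (M N : MatAlg n A) (p q : Fin n) :
    (M * N).entry p q = ∑ r, M.entry p r * N.entry r q := rfl

theorem continuous_of {X : Type*} [TopologicalSpace X] {f : X → Fin n → Fin n → A}
    (hf : ∀ p q, Continuous fun x => f x p q) : Continuous fun x => (of (f x) : MatAlg n A) :=
  letI := CStarAlgebra.spectralOrder A
  haveI := CStarAlgebra.spectralOrderedRing A
  (continuous_pi fun p => continuous_pi fun q => hf p q : Continuous f)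

/-- Entrywise application of a star-homomorphism. -/
def map (n : ℕ) (φ : A →⋆ₙₐ[ℂ] B) : MatAlg n A →⋆ₙₐ[ℂ] MatAlg n B where
  toFun M := of fun p q => φ (M.entry p q)
  map_smul' c M := by ext; simp
  map_zero' := by ext; simp
  map_add' M N := by ext; simp
  map_mul' M N := by ext; simp
  map_star' M := by ext; simp [map_star]

@[simp] theorem entry_map (φ : A →⋆ₙₐ[ℂ] B) (M : MatAlg n A) (p q : Fin n) :
    (map n φ M).entry p q = φ (M.entry p q) := rfl

/-- The matrix `a e_{ij}`; it is zero if `i` or `j` is not less than `n`. -/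
def unit (n i j : ℕ) (a : A) : MatAlg n A :=
  of fun p q => if (p : ℕ) = i ∧ (q : ℕ) = j then a else 0

/-- The star-homomorphism `a ↦ a e_{jj}`. -/
def diagHom (n : ℕ) (j : ℕ) : A →⋆ₙₐ[ℂ] MatAlg n A where
  toFun a := unit n j j a
  map_smul' c M := by ext; simp [unit]
  map_zero' := by ext; simp [unit]
  map_add' M N := by ext; simp only [unit, entry_of, entry_add]; split_ifs <;> simp
  map_mul' M N := by
    ext p q
    simp only [unit, entry_of, entry_mul]
    by_cases hp : (p : ℕ) = j
    · rw [Finset.sum_eq_single p]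
      · simp only [hp, true_and, and_self, if_true]
        split_ifs <;> simp
      · intro r _ hr
        have : (r : ℕ) ≠ j := fun h => hr (Fin.ext (h.trans hp.symm))
        simp [this]
      · simp
    · simp [hp]
  map_star' M := by
    ext p q
    simp only [unit, entry_of, entry_star, and_comm]
    split_ifs <;> simp

theorem norm_unit_le (n i j : ℕ) (a : A) : ‖unit n i j a‖ ≤ ‖a‖ := by
  have h : ‖star (unit n i j a) * unit n i j a‖ ≤ ‖star a * a‖ := by
    by_cases hi : i < n
    · have : star (unit n i j a) * unit n i j a = diagHom n j (star a * a) := by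
        ext p q
        simp only [unit, entry_mul, entry_star, entry_of, diagHom,
          NonUnitalAlgHom.coe_mk, NonUnitalStarAlgHom.coe_mk']
        rw [Finset.sum_eq_single ⟨i, hi⟩]
        · by_cases h1 : (p : ℕ) = j <;> by_cases h2 : (q : ℕ) = j <;> simp [h1, h2]
        · intro r _ hr
          have : (r : ℕ) ≠ i := fun h => hr (Fin.ext h)
          simp [this]
        · simp
      rw [this]
      exact NonUnitalStarAlgHom.norm_apply_le _ _
    · have : unit n i j a = 0 := by
        ext p q
        have : (p : ℕ) ≠ i := by have := p.2; omega
        simp [unit, this]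
      simp [this]
  rw [CStarRing.norm_star_mul_self, CStarRing.norm_star_mul_self] at h
  nlinarith [norm_nonneg a, norm_nonneg (unit n i j a)]

@[simp] theorem map_unit (φ : A →⋆ₙₐ[ℂ] B) (n i j : ℕ) (a : A) :
    map n φ (unit n i j a) = unit n i j (φ a) := by
  ext p q
  simp only [unit, entry_map, entry_of]
  split_ifs <;> simp

end MatAlg

section Stabilisation

variable {A B : Type u} [NonUnitalCStarAlgebra A] [NonUnitalCStarAlgebra B]

/-- The C*-algebra `∏ₙ Mₙ(A)` of bounded sequences of matrices. -/
abbrev MatSeq (A : Type u) [NonUnitalCStarAlgebra A] : Type u := lp (fun n : ℕ => MatAlg n A) ∞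

/-- The ideal `⨁ₙ Mₙ(A)` of null sequences in `∏ₙ Mₙ(A)`. -/
def nullSeq (A : Type u) [NonUnitalCStarAlgebra A] : ClosedIdeal (MatSeq A) where
  carrier :=
    { carrier := {T | Tendsto (fun n => ‖T n‖) atTop (𝓝 0)}
      add_mem' := fun {S T} hS hT => by
        refine squeeze_zero (fun _ => norm_nonneg _) (fun n => ?_) (by simpa using hS.add hT)
        exact norm_add_le (S n) (T n)
      zero_mem' := by simp
      smul_mem' := fun c T hT => by
        have h : Tendsto (fun n => ‖c‖ * ‖T n‖) atTop (𝓝 0) := by simpa using hT.const_mul ‖c‖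
        refine h.congr fun n => ?_
        exact (norm_smul c (T n)).symm }
  isClosed := by
    refine isClosed_of_closure_subset fun T hT => ?_
    rw [Metric.mem_closure_iff] at hT
    refine Metric.tendsto_atTop.2 fun ε hε => ?_
    obtain ⟨S, hS, hd⟩ := hT (ε / 2) (half_pos hε)
    obtain ⟨N, hN⟩ := Metric.tendsto_atTop.1 hS (ε / 2) (half_pos hε)
    refine ⟨N, fun n hn => ?_⟩
    have h1 := hN n hn
    have h2 : ‖T n - S n‖ ≤ ‖T - S‖ := lp.norm_apply_le_norm (by simp) (T - S) n
    rw [dist_eq_norm] at hd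
    simp only [Real.dist_eq, sub_zero, abs_norm] at h1 ⊢
    have h3 : ‖T n‖ ≤ ‖T n - S n‖ + ‖S n‖ := by simpa using norm_add_le (T n - S n) (S n)
    linarith
  mul_left S T hT := by
    have h : Tendsto (fun n => ‖S‖ * ‖T n‖) atTop (𝓝 0) := by
      simpa using Tendsto.const_mul ‖S‖ hT
    refine squeeze_zero (fun _ => norm_nonneg _) (fun n => ?_) h
    refine (norm_mul_le (S n) (T n)).trans ?_
    gcongr
    exact lp.norm_apply_le_norm (by simp) S n
  mul_right S T hT := by
    have h : Tendsto (fun n => ‖T n‖ * ‖S‖) atTop (𝓝 0) := by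
      simpa using Tendsto.mul_const ‖S‖ hT
    refine squeeze_zero (fun _ => norm_nonneg _) (fun n => ?_) h
    refine (norm_mul_le (T n) (S n)).trans ?_
    gcongr
    exact lp.norm_apply_le_norm (by simp) S n
  star_mem {T} hT := by
    refine Tendsto.congr (fun n => ?_) hT
    exact (norm_star (T n)).symm

/-- The sequence `n ↦ a e_{ij} ∈ Mₙ(A)`. -/
def unitSeq (i j : ℕ) (a : A) : MatSeq A :=
  ⟨fun n => MatAlg.unit n i j a, memℓp_infty ⟨‖a‖, by
    rintro _ ⟨n, rfl⟩
    exact MatAlg.norm_unit_le n i j a⟩⟩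

/-- The stabilisation `K ⊗ A`, where `K` denotes the compact operators on `ℓ²(ℕ)`. It is the
C*-inductive limit of the matrix algebras `Mₙ(A)` along the upper left corner embeddings, realised
inside `∏ₙ Mₙ(A) / ⨁ₙ Mₙ(A)` as the C*-subalgebra generated by the elements `e_{ij} ⊗ a`, that is,
by the classes of the sequences `n ↦ a e_{ij}`. -/
def stabSubalgebra (A : Type u) [NonUnitalCStarAlgebra A] :
    NonUnitalStarSubalgebra ℂ (nullSeq A).Quo :=
  (NonUnitalStarAlgebra.adjoin ℂ
    {x | ∃ (i j : ℕ) (a : A), x = (nullSeq A).proj (unitSeq i j a)}).topologicalClosure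

/-- The stabilisation `K ⊗ A` as a type. -/
def Stab (A : Type u) [NonUnitalCStarAlgebra A] : Type u := stabSubalgebra A

instance : NonUnitalCStarAlgebra (Stab A) :=
  haveI : IsClosed (stabSubalgebra A : Set (nullSeq A).Quo) :=
    NonUnitalStarSubalgebra.isClosed_topologicalClosure _
  inferInstanceAs (NonUnitalCStarAlgebra (stabSubalgebra A))

/-- The map `∏ₙ Mₙ(A) → ∏ₙ Mₙ(B)` induced by a star-homomorphism `A → B`. -/
def matSeqMap (φ : A →⋆ₙₐ[ℂ] B) : MatSeq A →⋆ₙₐ[ℂ] MatSeq B where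
  toFun T := ⟨fun n => MatAlg.map n φ (T n), memℓp_infty ⟨‖T‖, by
    rintro _ ⟨n, rfl⟩
    exact (NonUnitalStarAlgHom.norm_apply_le _ _).trans (lp.norm_apply_le_norm (by simp) T n)⟩⟩
  map_smul' c T := by ext n : 2; exact map_smul (MatAlg.map n φ) c (T n)
  map_zero' := by ext n : 2; exact map_zero (MatAlg.map n φ)
  map_add' S T := by ext n : 2; exact map_add (MatAlg.map n φ) (S n) (T n)
  map_mul' S T := by ext n : 2; exact map_mul (MatAlg.map n φ) (S n) (T n)
  map_star' T := by ext n : 2; exact map_star (MatAlg.map n φ) (T n)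

/-- The map `∏ₙ Mₙ(A) / ⨁ₙ Mₙ(A) → ∏ₙ Mₙ(B) / ⨁ₙ Mₙ(B)` induced by `A → B`. -/
def matQuoMap (φ : A →⋆ₙₐ[ℂ] B) : (nullSeq A).Quo →⋆ₙₐ[ℂ] (nullSeq B).Quo :=
  ClosedIdeal.mapHom _ _ (matSeqMap φ) fun T hT =>
    squeeze_zero (fun _ => norm_nonneg _) (fun n => NonUnitalStarAlgHom.norm_apply_le
      (MatAlg.map n φ) (T n)) hT

theorem matQuoMap_mem (φ : A →⋆ₙₐ[ℂ] B) {x : (nullSeq A).Quo} (hx : x ∈ stabSubalgebra A) :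
    matQuoMap φ x ∈ stabSubalgebra B := by
  have h : stabSubalgebra A ≤ NonUnitalStarSubalgebra.comap (matQuoMap φ) (stabSubalgebra B) := by
    refine NonUnitalStarSubalgebra.topologicalClosure_minimal _ ?_ ?_
    · refine NonUnitalStarAlgebra.adjoin_le ?_
      rintro _ ⟨i, j, a, rfl⟩
      refine NonUnitalStarSubalgebra.le_topologicalClosure _
        (NonUnitalStarAlgebra.subset_adjoin ℂ _ ⟨i, j, φ a, ?_⟩)
      refine congrArg (nullSeq B).proj ?_
      ext n : 2
      exact MatAlg.map_unit φ n i j a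
    · exact (NonUnitalStarSubalgebra.isClosed_topologicalClosure _).preimage
        (AddMonoidHomClass.continuous_of_bound (matQuoMap φ) 1 fun x => by
          simpa using NonUnitalStarAlgHom.norm_apply_le (matQuoMap φ) x)
  exact h hx

/-- The map `K ⊗ A → K ⊗ B` induced by a star-homomorphism `A → B`. -/
def stabMap (φ : A →⋆ₙₐ[ℂ] B) : Stab A →⋆ₙₐ[ℂ] Stab B where
  toFun x := ⟨matQuoMap φ x.1, matQuoMap_mem φ x.2⟩
  map_smul' c x := Subtype.ext (map_smul (matQuoMap φ) c x.1)
  map_zero' := Subtype.ext (map_zero (matQuoMap φ))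
  map_add' x y := Subtype.ext (map_add (matQuoMap φ) x.1 y.1)
  map_mul' x y := Subtype.ext (map_mul (matQuoMap φ) x.1 y.1)
  map_star' x := Subtype.ext (map_star (matQuoMap φ) x.1)

end Stabilisation

/-! ### Towers of C*-algebras and their K-theory -/

/-- A bundled, not necessarily unital, C*-algebra. -/
structure CStarAlg : Type (u + 1) where
  carrier : Type u
  [inst : NonUnitalCStarAlgebra carrier]

attribute [instance] CStarAlg.inst

/-- An inverse sequence `⋯ → A₂ → A₁ → A₀` of C*-algebras. It stands for the σ-C*-algebra
`lim A_n`. -/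
structure Tower : Type (u + 1) where
  obj : ℕ → CStarAlg.{u}
  map : ∀ n, (obj (n + 1)).carrier →⋆ₙₐ[ℂ] (obj n).carrier

/-- A levelwise morphism of inverse sequences of C*-algebras. -/
structure TowerHom (S T : Tower.{u}) where
  app : ∀ n, (S.obj n).carrier →⋆ₙₐ[ℂ] (T.obj n).carrier
  comm : ∀ n x, app n (S.map n x) = T.map n (app (n + 1) x)

theorem continuous_starHom {A B : Type u} [NonUnitalCStarAlgebra A] [NonUnitalCStarAlgebra B]
    (φ : A →⋆ₙₐ[ℂ] B) : Continuous φ :=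
  AddMonoidHomClass.continuous_of_bound φ 1 fun x => by
    simpa using NonUnitalStarAlgHom.norm_apply_le φ x

theorem Stab.map_comp {A B C D : Type u} [NonUnitalCStarAlgebra A] [NonUnitalCStarAlgebra B]
    [NonUnitalCStarAlgebra C] [NonUnitalCStarAlgebra D] (φ : A →⋆ₙₐ[ℂ] B) (ψ : B →⋆ₙₐ[ℂ] D)
    (φ' : A →⋆ₙₐ[ℂ] C) (ψ' : C →⋆ₙₐ[ℂ] D) (h : ∀ x, ψ (φ x) = ψ' (φ' x)) (x : Stab A) :
    stabMap ψ (stabMap φ x) = stabMap ψ' (stabMap φ' x) := by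
  obtain ⟨y, hy⟩ := x
  obtain ⟨T, rfl⟩ := (nullSeq A).proj_surjective y
  refine Subtype.ext (congrArg (nullSeq D).proj ?_)
  ext n : 2
  exact MatAlg.ext fun p q => h ((T n).entry p q)

/-- The tower `n ↦ K ⊗ A_n`. -/
def Tower.stab (T : Tower.{u}) : Tower.{u} where
  obj n := ⟨Stab (T.obj n).carrier⟩
  map n := stabMap (T.map n)

/-- The tower `n ↦ M₂(A_n)`. -/
def Tower.mat2 (T : Tower.{u}) : Tower.{u} where
  obj n := ⟨MatAlg 2 (T.obj n).carrier⟩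
  map n := MatAlg.map 2 (T.map n)

/-- The tower `n ↦ M_{2^k}(K ⊗ A_n)`. -/
def Tower.stage (T : Tower.{u}) : ℕ → Tower.{u}
  | 0 => T.stab
  | k + 1 => (T.stage k).mat2

def TowerHom.stab {S T : Tower.{u}} (φ : TowerHom S T) : TowerHom S.stab T.stab where
  app n := stabMap (φ.app n)
  comm n x := Stab.map_comp _ _ _ _ (φ.comm n) x

def TowerHom.mat2 {S T : Tower.{u}} (φ : TowerHom S T) : TowerHom S.mat2 T.mat2 where
  app n := MatAlg.map 2 (φ.app n)
  comm n x := MatAlg.ext fun p q => φ.comm n (MatAlg.entry x p q)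

def TowerHom.stage {S T : Tower.{u}} (φ : TowerHom S T) : ∀ k, TowerHom (S.stage k) (T.stage k)
  | 0 => φ.stab
  | k + 1 => (φ.stage k).mat2

/-- `x` is quasi-unitary if `1 + x` is a unitary in the unitization. -/
def IsQuasiUnitary {A : Type*} [NonUnitalNonAssocSemiring A] [Star A] (x : A) : Prop :=
  star x * x + x + star x = 0 ∧ x * star x + x + star x = 0

section QuasiUnitary

variable {A B : Type*} [NonUnitalRing A] [StarRing A] [NonUnitalRing B] [StarRing B]

theorem IsQuasiUnitary.zero : IsQuasiUnitary (0 : A) := by simp [IsQuasiUnitary]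

theorem IsQuasiUnitary.star {x : A} (h : IsQuasiUnitary x) : IsQuasiUnitary (star x) := by
  refine ⟨?_, ?_⟩
  · rw [star_star, add_right_comm]; exact h.2
  · rw [star_star, add_right_comm]; exact h.1

theorem IsQuasiUnitary.circ {x y : A} (hx : IsQuasiUnitary x) (hy : IsQuasiUnitary y) :
    IsQuasiUnitary (x + y + x * y) := by
  obtain ⟨h1, h2⟩ := hx
  obtain ⟨h3, h4⟩ := hy
  refine ⟨?_, ?_⟩
  · have : Star.star (x + y + x * y) * (x + y + x * y) + (x + y + x * y)
        + Star.star (x + y + x * y) =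
        (Star.star x * x + x + Star.star x) + (Star.star y * y + y + Star.star y)
        + Star.star y * (Star.star x * x + x + Star.star x)
        + (Star.star x * x + x + Star.star x) * y
        + Star.star y * (Star.star x * x + x + Star.star x) * y := by
      simp only [star_add, star_mul]
      noncomm_ring
    rw [this, h1, h3]
    simp
  · have : (x + y + x * y) * Star.star (x + y + x * y) + (x + y + x * y)
        + Star.star (x + y + x * y) =
        (x * Star.star x + x + Star.star x) + (y * Star.star y + y + Star.star y)
        + x * (y * Star.star y + y + Star.star y)
        + (y * Star.star y + y + Star.star y) * Star.star x
        + x * (y * Star.star y + y + Star.star y) * Star.star x := by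
      simp only [star_add, star_mul]
      noncomm_ring
    rw [this, h2, h4]
    simp

theorem IsQuasiUnitary.circ_star {x : A} (hx : IsQuasiUnitary x) :
    x + Star.star x + x * Star.star x = 0 := by
  rw [← hx.2]; abel

theorem IsQuasiUnitary.map {F : Type*} [FunLike F A B] [NonUnitalRingHomClass F A B]
    [StarHomClass F A B] (φ : F) {x : A} (hx : IsQuasiUnitary x) : IsQuasiUnitary (φ x) := by
  refine ⟨?_, ?_⟩
  · rw [← map_star, ← map_mul, ← map_add, ← map_add, hx.1, map_zero]
  · rw [← map_star, ← map_mul, ← map_add, ← map_add, hx.2, map_zero]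

end QuasiUnitary

namespace Tower

/-- The group of unitaries of the form `1 + x` with `x ∈ lim A_n`, written in terms of `x`, with the
topology of the inverse limit. -/
abbrev Unitaries (T : Tower.{u}) : Type u :=
  {x : ∀ n, (T.obj n).carrier // (∀ n, T.map n (x (n + 1)) = x n) ∧ ∀ n, IsQuasiUnitary (x n)}

/-- The unit of the group of unitaries. -/
def base (T : Tower.{u}) : T.Unitaries :=
  ⟨fun _ => 0, fun n => map_zero (T.map n), fun _ => IsQuasiUnitary.zero⟩

end Tower

/-- The map on unitaries induced by a morphism of towers. -/
def TowerHom.unitaries {S T : Tower.{u}} (φ : TowerHom S T) : C(S.Unitaries, T.Unitaries) where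
  toFun x := ⟨fun n => φ.app n (x.1 n), fun n => by rw [← φ.comm, x.2.1], fun n =>
    (x.2.2 n).map (φ.app n)⟩
  continuous_toFun := Continuous.subtype_mk (continuous_pi fun n =>
    (continuous_starHom (φ.app n)).comp ((continuous_apply n).comp continuous_subtype_val)) _

theorem TowerHom.unitaries_base {S T : Tower.{u}} (φ : TowerHom S T) :
    φ.unitaries S.base = T.base := Subtype.ext (funext fun n => map_zero (φ.app n))

/-! #### The Bott map -/

/-- The Bott projection in `M₂(ℂ)`. It is the projection onto the line spanned by
`(cos (π s / 2), exp (- 2 π i t) sin (π s / 2))`. -/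
def bottProj (s t : ℝ) : Fin 2 → Fin 2 → ℂ :=
  ![![Complex.cos (Real.pi * s / 2) ^ 2,
      Complex.cos (Real.pi * s / 2) * Complex.sin (Real.pi * s / 2) *
        Complex.exp (2 * Real.pi * Complex.I * t)],
    ![Complex.cos (Real.pi * s / 2) * Complex.sin (Real.pi * s / 2) *
        Complex.exp (-(2 * Real.pi * Complex.I * t)),
      Complex.sin (Real.pi * s / 2) ^ 2]]

theorem bottProj_mul (s t : ℝ) (i j : Fin 2) :
    ∑ k, bottProj s t i k * bottProj s t k j = bottProj s t i j := by
  have h := Complex.sin_sq_add_cos_sq (Real.pi * s / 2)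
  have h2 : Complex.exp (2 * Real.pi * Complex.I * t) *
      Complex.exp (-(2 * Real.pi * Complex.I * t)) = 1 := by
    rw [← Complex.exp_add]; simp
  set c := Complex.cos (Real.pi * s / 2)
  set d := Complex.sin (Real.pi * s / 2)
  set e := Complex.exp (2 * Real.pi * Complex.I * t)
  set f := Complex.exp (-(2 * Real.pi * Complex.I * t))
  fin_cases i <;> fin_cases j <;> simp only [bottProj, Fin.sum_univ_two, Fin.zero_eta, Fin.mk_one,
    Fin.isValue, Matrix.cons_val_zero, Matrix.cons_val_one, Matrix.cons_val_fin_one]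
  · linear_combination c ^ 2 * h + c ^ 2 * d ^ 2 * h2
  · linear_combination c * d * e * h
  · linear_combination c * d * f * h
  · linear_combination d ^ 2 * h + c ^ 2 * d ^ 2 * h2

theorem bottProj_star (s t : ℝ) (i j : Fin 2) : star (bottProj s t j i) = bottProj s t i j := by
  have h1 : (starRingEnd ℂ) (Complex.cos (Real.pi * s / 2)) = Complex.cos (Real.pi * s / 2) := by
    rw [← Complex.cos_conj]; simp [Complex.conj_ofNat]
  have h2 : (starRingEnd ℂ) (Complex.sin (Real.pi * s / 2)) = Complex.sin (Real.pi * s / 2) := by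
    rw [← Complex.sin_conj]; simp [Complex.conj_ofNat]
  fin_cases i <;> fin_cases j <;> simp [bottProj, h1, h2, ← Complex.exp_conj, Complex.conj_ofNat]

theorem continuous_bottProj (i j : Fin 2) : Continuous fun p : ℝ × ℝ => bottProj p.1 p.2 i j := by
  fin_cases i <;> fin_cases j <;> simp only [bottProj, Fin.zero_eta, Fin.mk_one,
    Fin.isValue, Matrix.cons_val_zero, Matrix.cons_val_one, Matrix.cons_val_fin_one] <;> fun_prop

theorem bottProj_edge {s t : ℝ} (h : (s = 0 ∨ s = 1) ∨ (t = 0 ∨ t = 1)) :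
    bottProj s t = bottProj s 0 := by
  rcases h with (rfl | rfl) | (rfl | rfl)
  · simp [bottProj]
  · simp [bottProj, Complex.cos_pi_div_two]
  · rfl
  · simp [bottProj, Complex.exp_two_pi_mul_I, Complex.exp_neg]

section Tens

variable {A B : Type u} [NonUnitalCStarAlgebra A] [NonUnitalCStarAlgebra B]

/-- The elementary tensor `x ⊗ M ∈ A ⊗ M₂(ℂ) = M₂(A)`. -/
def tens (x : A) (M : Fin 2 → Fin 2 → ℂ) : MatAlg 2 A := MatAlg.of fun i j => M i j • x

theorem tens_quasiUnitary {x : A} (hx : IsQuasiUnitary x) (s t : ℝ) :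
    IsQuasiUnitary (tens x (bottProj s t)) := by
  have hstar : star (tens x (bottProj s t)) = tens (star x) (bottProj s t) := by
    refine MatAlg.ext fun i j => ?_
    simp only [tens, MatAlg.entry_star, MatAlg.entry_of, star_smul, bottProj_star]
  have hmul : ∀ y z : A, tens y (bottProj s t) * tens z (bottProj s t) =
      tens (y * z) (bottProj s t) := by
    intro y z
    refine MatAlg.ext fun i j => ?_
    simp only [tens, MatAlg.entry_mul, MatAlg.entry_of, smul_mul_smul_comm, ← Finset.sum_smul,
      bottProj_mul]
  have hadd : ∀ y z : A, tens y (bottProj s t) + tens z (bottProj s t) =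
      tens (y + z) (bottProj s t) := by
    intro y z
    refine MatAlg.ext fun i j => ?_
    simp only [tens, MatAlg.entry_add, MatAlg.entry_of, smul_add]
  have hzero : tens (0 : A) (bottProj s t) = 0 := by
    refine MatAlg.ext fun i j => ?_
    simp [tens]
  refine ⟨?_, ?_⟩
  · rw [hstar, hmul, hadd, hadd, hx.1, hzero]
  · rw [hstar, hmul, hadd, hadd, hx.2, hzero]

/-- The element `w` with `1 + w = (1 + x ⊗ P_{s,t}) (1 + x^* ⊗ P_{s,0})`. -/
def bottElt (x : A) (s t : ℝ) : MatAlg 2 A :=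
  tens x (bottProj s t) + tens (star x) (bottProj s 0) +
    tens x (bottProj s t) * tens (star x) (bottProj s 0)

theorem bottElt_quasiUnitary {x : A} (hx : IsQuasiUnitary x) (s t : ℝ) :
    IsQuasiUnitary (bottElt x s t) :=
  (tens_quasiUnitary hx s t).circ (tens_quasiUnitary hx.star s 0)

theorem bottElt_edge {x : A} (hx : IsQuasiUnitary x) {s t : ℝ}
    (h : (s = 0 ∨ s = 1) ∨ (t = 0 ∨ t = 1)) : bottElt x s t = 0 := by
  have hstar : tens (star x) (bottProj s 0) = star (tens x (bottProj s 0)) := by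
    refine MatAlg.ext fun i j => ?_
    simp only [tens, MatAlg.entry_star, MatAlg.entry_of, star_smul, bottProj_star]
  rw [bottElt, bottProj_edge h, hstar]
  exact (tens_quasiUnitary hx s 0).circ_star

theorem bottElt_zero (s t : ℝ) : bottElt (0 : A) s t = 0 := by
  have hzero : ∀ M, tens (0 : A) M = 0 := fun M => MatAlg.ext fun i j => by simp [tens]
  simp [bottElt, hzero]

theorem map_bottElt (φ : A →⋆ₙₐ[ℂ] B) (x : A) (s t : ℝ) :
    MatAlg.map 2 φ (bottElt x s t) = bottElt (φ x) s t := by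
  have h : ∀ (y : A) M, MatAlg.map 2 φ (tens y M) = tens (φ y) M := fun y M =>
    MatAlg.ext fun i j => by simp [tens]
  simp only [bottElt, map_add, map_mul, h, map_star]

theorem continuous_tens {X : Type*} [TopologicalSpace X] {f : X → A} {s t : X → ℝ}
    (hf : Continuous f) (hs : Continuous s) (ht : Continuous t) :
    Continuous fun x => tens (f x) (bottProj (s x) (t x)) :=
  MatAlg.continuous_of fun p q => ((continuous_bottProj p q).comp (hs.prodMk ht)).smul hf

theorem continuous_bottElt {X : Type*} [TopologicalSpace X] {f : X → A} {s t : X → ℝ}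
    (hf : Continuous f) (hs : Continuous s) (ht : Continuous t) :
    Continuous fun x => bottElt (f x) (s x) (t x) := by
  have h1 := continuous_tens hf hs ht
  have h2 := continuous_tens hf.star hs continuous_const (t := fun _ => 0)
  exact (h1.add h2).add (h1.mul h2)

end Tens

/-- The Bott map, which sends `f` to the map
`(z, s, t) ↦ (1 + f(z) ⊗ P_{s,t}) (1 + f(z)^* ⊗ P_{s,0})`. -/
def bott (T : Tower.{u}) {d : ℕ} (f : GenLoop (Fin d) T.Unitaries T.base) :
    GenLoop (Fin (d + 2)) T.mat2.Unitaries T.mat2.base :=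
  ⟨{ toFun := fun z =>
      ⟨fun n => bottElt ((f fun i => z (i.castAdd 2)).1 n) (z (Fin.natAdd d 0)) (z (Fin.natAdd d 1)),
        fun n => (map_bottElt (T.map n) _ _ _).trans
          (congrArg (fun x => bottElt x _ _) ((f fun i => z (i.castAdd 2)).2.1 n)),
        fun n => bottElt_quasiUnitary ((f fun i => z (i.castAdd 2)).2.2 n) _ _⟩
     continuous_toFun := by
      refine Continuous.subtype_mk (continuous_pi fun n => ?_) _
      refine continuous_bottElt ?_ (by fun_prop) (by fun_prop)
      refine (continuous_apply n).comp (continuous_subtype_val.comp ?_)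
      exact f.1.continuous.comp (by fun_prop) },
   by
    rintro z ⟨i, hi⟩
    refine Subtype.ext (funext fun n => ?_)
    change bottElt ((f fun i => z (i.castAdd 2)).1 n) (z (Fin.natAdd d 0)) (z (Fin.natAdd d 1)) = 0
    induction i using Fin.addCases with
    | left i =>
      rw [GenLoop.boundary f (fun i => z (i.castAdd 2)) ⟨i, hi⟩]
      exact bottElt_zero _ _
    | right i =>
      refine bottElt_edge ((f fun i => z (i.castAdd 2)).2.2 n) ?_
      have hi' : (z (Fin.natAdd d i) : ℝ) = 0 ∨ (z (Fin.natAdd d i) : ℝ) = 1 :=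
        hi.imp (congrArg Subtype.val) (congrArg Subtype.val)
      fin_cases i
      · exact Or.inl hi'
      · exact Or.inr hi'⟩

/-! #### K-theory -/

/-- The pairs `(e, k)` such that the homotopy group `π_{e+2}` of the unitary group of
`M_{2^k}(K ⊗ A)` contributes to the K-theory in degree `m`, namely those with
`e + 2 = m - 1 + 2 k`. -/
def KIndex (m : ℤ) : Type := {p : ℕ × ℕ // (p.1 : ℤ) + 2 = m - 1 + 2 * p.2}

instance (m : ℤ) : DecidableEq (KIndex m) := inferInstanceAs (DecidableEq (Subtype _))

/-- The index following `(e, k)` along the Bott map. -/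
def KIndex.next {m : ℤ} (p : KIndex m) : KIndex m :=
  ⟨(p.1.1 + 2, p.1.2 + 1), by have := p.2; push_cast; linarith⟩

namespace Tower

/-- The group `π_{e+2}(U(M_{2^k}(K ⊗ lim A_n)))`, written additively. -/
abbrev KPiece (T : Tower.{u}) {m : ℤ} (p : KIndex m) : Type u :=
  Additive (HomotopyGroup (Fin (p.1.1 + 2)) (T.stage p.1.2).Unitaries (T.stage p.1.2).base)

/-- Loops representing elements of `KPiece`. -/
abbrev KLoop (T : Tower.{u}) {m : ℤ} (p : KIndex m) : Type u :=
  GenLoop (Fin (p.1.1 + 2)) (T.stage p.1.2).Unitaries (T.stage p.1.2).base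

/-- The class in the direct sum of all homotopy groups of a loop of unitaries. -/
def kGen (T : Tower.{u}) {m : ℤ} (p : KIndex m) (f : T.KLoop p) :
    DirectSum (KIndex m) T.KPiece :=
  DirectSum.of T.KPiece p (Additive.ofMul (Quotient.mk _ f))

/-- The subgroup of relations that identify each loop with its image under the Bott map. -/
def kRel (T : Tower.{u}) (m : ℤ) : AddSubgroup (DirectSum (KIndex m) T.KPiece) :=
  AddSubgroup.closure {x | ∃ (p : KIndex m) (f : T.KLoop p),
    x = T.kGen p f - T.kGen p.next (bott (T.stage p.1.2) f)}

/-- The K-theory group `K_m(lim A_n)`, for `m ∈ ℤ`, of the σ-C*-algebra `lim A_n`: the direct limit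
over `k` of the homotopy groups `π_{m-1+2k}(U(M_{2^k}(K ⊗ lim A_n)))` along the Bott maps. As the
Bott maps are isomorphisms by Bott periodicity, this is `π_{m-1+2k}(U(K ⊗ lim A_n))` for every `k`
with `m - 1 + 2 k ≥ 0`, and in particular it is `K_1(lim A_n) = π_0(U(K ⊗ lim A_n))`
for `m = 1`. -/
def K (m : ℤ) (T : Tower.{u}) : Type u :=
  DirectSum (KIndex m) T.KPiece ⧸ T.kRel m

instance (m : ℤ) (T : Tower.{u}) : AddCommGroup (K m T) :=
  inferInstanceAs (AddCommGroup (_ ⧸ T.kRel m))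

/-- The class in K-theory of a loop of unitaries. -/
def kClass (T : Tower.{u}) {m : ℤ} (p : KIndex m) (f : T.KLoop p) : K m T :=
  QuotientAddGroup.mk (T.kGen p f)

end Tower

/-- Postcomposition of a loop with a pointed map. -/
def loopMap {N X Y : Type*} [TopologicalSpace X] [TopologicalSpace Y] {x : X} {y : Y}
    (φ : C(X, Y)) (h : φ x = y) (f : GenLoop N X x) : GenLoop N Y y :=
  ⟨φ.comp f.1, fun z hz => (congrArg φ (f.2 z hz)).trans h⟩

/-- The map induced on homotopy groups by a pointed map. -/
def piMap {n : ℕ} {X Y : Type*} [TopologicalSpace X] [TopologicalSpace Y] {x : X} {y : Y}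
    (φ : C(X, Y)) (h : φ x = y) :
    HomotopyGroup (Fin (n + 1)) X x →* HomotopyGroup (Fin (n + 1)) Y y :=
  MonoidHom.mk' (Quotient.map (loopMap φ h) fun _ _ H =>
    Nonempty.map (fun H => H.compContinuousMap φ) H) (by
    rintro ⟨f⟩ ⟨g⟩
    refine (congrArg _ (HomotopyGroup.mul_spec (i := 0) (p := f) (q := g))).trans
      (Eq.trans ?_ (HomotopyGroup.mul_spec (i := 0) (p := loopMap φ h f)
        (q := loopMap φ h g)).symm)
    refine congrArg (Quotient.mk _) ?_
    ext t
    change φ (GenLoop.transAt 0 g f t) = GenLoop.transAt 0 (loopMap φ h g) (loopMap φ h f) t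
    simp only [GenLoop.transAt, GenLoop.coe_copy]
    split_ifs <;> rfl)

theorem loopMap_bott {S T : Tower.{u}} (φ : TowerHom S T) {d : ℕ}
    (f : GenLoop (Fin d) S.Unitaries S.base) :
    loopMap φ.mat2.unitaries φ.mat2.unitaries_base (bott S f) =
      bott T (loopMap φ.unitaries φ.unitaries_base f) := by
  refine GenLoop.ext _ _ fun z => Subtype.ext (funext fun n => ?_)
  exact map_bottElt (φ.app n) _ _ _

/-- The homomorphism induced on K-theory by a morphism of towers. -/
def TowerHom.kMap {S T : Tower.{u}} (m : ℤ) (φ : TowerHom S T) : S.K m →+ T.K m :=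
  QuotientAddGroup.map _ _
    (DirectSum.map fun p : KIndex m =>
      (piMap (φ.stage p.1.2).unitaries (φ.stage p.1.2).unitaries_base).toAdditive) (by
    rw [Tower.kRel, AddSubgroup.closure_le]
    rintro _ ⟨p, f, rfl⟩
    refine AddSubgroup.subset_closure ⟨p,
      loopMap (φ.stage p.1.2).unitaries (φ.stage p.1.2).unitaries_base f, ?_⟩
    rw [map_sub]
    simp only [Tower.kGen, DirectSum.map_of]
    refine congrArg _ (congrArg (Tower.kGen T p.next) ?_)
    exact loopMap_bott (φ.stage p.1.2) f)

/-- The graph of the boundary map `K_m(B) → K_{m'}(J)`, where `m' = m - 1`, in K-theory of a short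
exact sequence of towers `0 → J → A → B → 0`. The class of a map `f` from a cube of dimension
`d + 1` to the unitaries over `B` goes to the class of a map `g` from a cube of dimension `d` to the
unitaries over `J` if `f` lifts to a map `F` to the unitaries over `A` which is `g` on the
face `{1} × [0,1]^d` and is trivial on all other faces. -/
def IsBoundary {J A B : Tower.{u}} (ι : TowerHom J A) (π : TowerHom A B) {m m' : ℤ}
    (x : B.K m) (y : J.K m') : Prop :=
  ∃ (e k : ℕ) (hB : ((e + 1 : ℕ) : ℤ) + 2 = m - 1 + 2 * k) (hJ : (e : ℤ) + 2 = m' - 1 + 2 * k)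
    (f : GenLoop (Fin (e + 2 + 1)) (B.stage k).Unitaries (B.stage k).base)
    (g : GenLoop (Fin (e + 2)) (J.stage k).Unitaries (J.stage k).base)
    (F : C(Fin (e + 2 + 1) → unitInterval, (A.stage k).Unitaries)),
    x = B.kClass ⟨(e + 1, k), hB⟩ f ∧ y = J.kClass ⟨(e, k), hJ⟩ g ∧
    (∀ z, (π.stage k).unitaries (F z) = f z) ∧
    (∀ z, (z 0 = 0 ∨ ∃ i : Fin (e + 2), z i.succ = 0 ∨ z i.succ = 1) → F z = (A.stage k).base) ∧
    ∀ z : Fin (e + 2) → unitInterval, F (Fin.cons 1 z) = (ι.stage k).unitaries (g z)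

/-! ### Crossed products by a discrete group -/

/-- A C*-algebra with an action of the discrete group `G` by star-automorphisms. -/
structure GCStarAlg (G : Type v) [Group G] : Type (max (u + 1) v) where
  carrier : Type u
  [inst : NonUnitalCStarAlgebra carrier]
  act : G → (carrier →⋆ₙₐ[ℂ] carrier)
  act_one : ∀ x, act 1 x = x
  act_mul : ∀ g h x, act (g * h) x = act g (act h x)

attribute [instance] GCStarAlg.inst

/-- An equivariant star-homomorphism. -/
structure GHom {G : Type v} [Group G] (A B : GCStarAlg.{u, v} G) where
  hom : A.carrier →⋆ₙₐ[ℂ] B.carrier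
  equivariant : ∀ g x, hom (A.act g x) = B.act g (hom x)

/-- The square of the norm of a finitely supported element of the Hilbert module `ℓ²(G, A)`. -/
def l2NormSq {G : Type v} {A : Type u} [NonUnitalCStarAlgebra A] (ζ : G →₀ A) : ℝ :=
  ‖ζ.sum fun _ a => star a * a‖

/-- The regular representation of the convolution algebra `C_c(G, A)` on `ℓ²(G, A)`, evaluated on
finitely supported elements: `(f ζ)(h) = ∑ g, h⁻¹(f(g)) ζ(g⁻¹ h)`. -/
def regularRep {G : Type v} [Group G] (A : GCStarAlg.{u, v} G) (f ζ : G →₀ A.carrier) :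
    G →₀ A.carrier :=
  f.sum fun g a => ζ.sum fun k b => Finsupp.single (g * k) (A.act (g * k)⁻¹ a * b)

/-- A crossed product functor for the discrete group `G`: a functor that sends each
`G`-C*-algebra `A` to a completion of the convolution algebra `C_c(G, A)` in a C*-norm which is not
smaller than the reduced one (it is automatically not larger than the maximal one). Hence it is
a functor sitting between the maximal and the reduced crossed product. -/
structure CrossedProductFunctor (G : Type v) [Group G] where
  obj : GCStarAlg.{u, v} G → CStarAlg.{u}
  /-- The canonical map from the convolution algebra. -/
  incl : ∀ A : GCStarAlg.{u, v} G, (G →₀ A.carrier) →ₗ[ℂ] (obj A).carrier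
  incl_mul : ∀ A g a h b, incl A (Finsupp.single g a) * incl A (Finsupp.single h b) =
    incl A (Finsupp.single (g * h) (a * A.act g b))
  incl_star : ∀ A g a, star (incl A (Finsupp.single g a)) =
    incl A (Finsupp.single g⁻¹ (A.act g⁻¹ (star a)))
  dense : ∀ A, DenseRange (incl A)
  reduced_le : ∀ A f ζ, l2NormSq (regularRep A f ζ) ≤ ‖incl A f‖ ^ 2 * l2NormSq ζ
  map : ∀ {A B : GCStarAlg.{u, v} G}, GHom A B → (obj A).carrier →⋆ₙₐ[ℂ] (obj B).carrier
  map_incl : ∀ {A B : GCStarAlg.{u, v} G} (φ : GHom A B) f,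
    map φ (incl A f) = incl B (f.mapRange φ.hom (map_zero φ.hom))

/-- A sequence `0 → J → A → B → 0` of star-homomorphisms of C*-algebras is exact. -/
def IsShortExact {J A B : Type*} [NonUnitalCStarAlgebra J] [NonUnitalCStarAlgebra A]
    [NonUnitalCStarAlgebra B] (ι : J →⋆ₙₐ[ℂ] A) (π : A →⋆ₙₐ[ℂ] B) : Prop :=
  Function.Injective ι ∧ Function.Surjective π ∧ ∀ x, π x = 0 ↔ x ∈ Set.range ι

/-- A crossed product functor is exact if it preserves short exact sequences. -/
def CrossedProductFunctor.IsExact {G : Type v} [Group G]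
    (μ : CrossedProductFunctor.{u, v} G) : Prop :=
  ∀ {J A B : GCStarAlg.{u, v} G} (ι : GHom J A) (π : GHom A B),
    IsShortExact ι.hom π.hom → IsShortExact (μ.map ι) (μ.map π)

theorem CrossedProductFunctor.hom_ext {G : Type v} [Group G] (μ : CrossedProductFunctor.{u, v} G)
    (A : GCStarAlg.{u, v} G) {B : CStarAlg.{u}} (φ ψ : (μ.obj A).carrier →⋆ₙₐ[ℂ] B.carrier)
    (h : ∀ f, φ (μ.incl A f) = ψ (μ.incl A f)) (x : (μ.obj A).carrier) : φ x = ψ x :=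
  congrFun ((μ.dense A).equalizer (continuous_starHom φ) (continuous_starHom ψ) (funext h)) x

/-- An inverse sequence of `G`-C*-algebras. It stands for the σ-`G`-C*-algebra `lim A_n`. -/
structure GTower (G : Type v) [Group G] where
  obj : ℕ → GCStarAlg.{u, v} G
  map : ∀ n, GHom (obj (n + 1)) (obj n)

/-- A levelwise equivariant morphism. -/
structure GTowerHom {G : Type v} [Group G] (S T : GTower.{u, v} G) where
  app : ∀ n, GHom (S.obj n) (T.obj n)
  comm : ∀ n x, (app n).hom ((S.map n).hom x) = (T.map n).hom ((app (n + 1)).hom x)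

namespace CrossedProductFunctor

variable {G : Type v} [Group G] (μ : CrossedProductFunctor.{u, v} G)

/-- The crossed product `(lim A_n) ⋊_μ G = lim (A_n ⋊_μ G)`. -/
def tower (T : GTower.{u, v} G) : Tower.{u} where
  obj n := μ.obj (T.obj n)
  map n := μ.map (T.map n)

/-- The morphism induced on crossed products. -/
def towerHom {S T : GTower.{u, v} G} (φ : GTowerHom S T) : TowerHom (μ.tower S) (μ.tower T) where
  app n := μ.map (φ.app n)
  comm n := μ.hom_ext (S.obj (n + 1)) ((μ.map (φ.app n)).comp (μ.map (S.map n)))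
    ((μ.map (T.map n)).comp (μ.map (φ.app (n + 1)))) fun f => by
      simp only [NonUnitalStarAlgHom.comp_apply, μ.map_incl]
      congr 1
      ext g
      simp [φ.comm]

end CrossedProductFunctor

/-! ### Operators on `ℓ²` -/

/-- The Hilbert space `ℓ²(ℕ)`. -/
abbrev L2 : Type := lp (fun _ : ℕ => ℂ) 2

/-- The C*-algebra `B(ℓ²)` of bounded operators. -/
abbrev Bd : Type := L2 →L[ℂ] L2

/-- The operator `T` on `ℓ²` is compact. -/
def Bd.Compact (T : Bd) : Prop := IsCompactOperator (T : L2 → L2)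

theorem Bd.Compact.star {T : Bd} (hT : T.Compact) : (star T).Compact := by
  have h1 : IsCompactOperator (T * Star.star T : Bd) := IsCompactOperator.comp_clm hT (Star.star T)
  refine (isCompactOperator_iff_isCompact_closure_image_closedBall
    (Star.star T : Bd).toLinearMap one_pos).2 ?_
  refine TotallyBounded.isCompact_of_isClosed (TotallyBounded.closure ?_) isClosed_closure
  have h2 := ((h1.isCompact_closure_image_closedBall (f := (T * Star.star T : Bd).toLinearMap)
    1).totallyBounded).subset subset_closure
  refine Metric.totallyBounded_iff.2 fun ε hε => ?_
  obtain ⟨t, hts, htf, ht⟩ := Metric.finite_approx_of_totallyBounded h2 (ε ^ 2 / 2) (by positivity)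
  obtain ⟨t', ht's, ht'f, rfl⟩ := Set.exists_subset_image_finite_and.1 ⟨t, hts, htf, rfl⟩
  refine ⟨_, ht'f.image (Star.star T : Bd), ?_⟩
  rintro _ ⟨x, hx, rfl⟩
  obtain ⟨_, ⟨y, hy, rfl⟩, hxy⟩ := Set.mem_iUnion₂.1 (ht ⟨x, hx, rfl⟩)
  refine Set.mem_iUnion₂.2 ⟨_, ⟨y, hy, rfl⟩, ?_⟩
  rw [Metric.mem_ball, dist_eq_norm] at hxy ⊢
  change ‖(Star.star T : Bd) x - (Star.star T : Bd) y‖ < ε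
  change ‖(T * Star.star T : Bd) x - (T * Star.star T : Bd) y‖ < ε ^ 2 / 2 at hxy
  rw [← map_sub] at hxy ⊢
  have hxy2 : ‖x - y‖ ≤ 2 := by
    have := ht's hy
    rw [mem_closedBall_zero_iff] at hx this
    linarith [norm_sub_le x y]
  have h3 : ‖(Star.star T : Bd) (x - y)‖ ^ 2 ≤ ‖(T * Star.star T : Bd) (x - y)‖ * ‖x - y‖ := by
    rw [ContinuousLinearMap.apply_norm_sq_eq_inner_adjoint_left, ContinuousLinearMap.star_eq_adjoint,
      ContinuousLinearMap.adjoint_adjoint]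
    exact (RCLike.re_le_norm _).trans (norm_inner_le_norm _ _)
  have h4 : ‖(T * Star.star T : Bd) (x - y)‖ * ‖x - y‖ < ε ^ 2 := by
    nlinarith [norm_nonneg ((T * Star.star T : Bd) (x - y)), norm_nonneg (x - y)]
  exact lt_of_pow_lt_pow_left₀ 2 hε.le (h3.trans_lt h4)

theorem Bd.isClosed_compact : IsClosed {T : Bd | T.Compact} := isClosed_setOfPred_isCompactOperator

/-- The rank one projection onto the first basis vector of `ℓ²`. -/
def rankOneProj : Bd := InnerProductSpace.rankOne ℂ (lp.single 2 0 1 : L2) (lp.single 2 0 1 : L2)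

theorem rankOneProj_isStarProjection : IsStarProjection rankOneProj :=
  InnerProductSpace.isStarProjection_rankOne_self (by
    rw [lp.norm_single (by norm_num)]; simp)

theorem rankOneProj_compact : rankOneProj.Compact := by
  unfold rankOneProj Bd.Compact
  rw [InnerProductSpace.rankOne_def']
  exact IsCompactOperator.clm_comp (isCompactOperator_of_locallyCompactSpace_dom
    (innerSL ℂ (lp.single 2 0 1 : L2)))
    (ContinuousLinearMap.toSpanSingleton ℂ (lp.single 2 0 1 : L2))

/-- The star-homomorphism `ℂ → B(ℓ²)` that sends `c` to `c p` where `p` is a rank one projection. -/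
def scalarHom : ℂ →⋆ₙₐ[ℂ] Bd where
  toFun c := c • rankOneProj
  map_smul' c d := by simp [mul_smul]
  map_zero' := zero_smul _ _
  map_add' c d := add_smul _ _ _
  map_mul' c d := by
    rw [smul_mul_smul_comm, rankOneProj_isStarProjection.isIdempotentElem.eq]
  map_star' c := by
    rw [star_smul, rankOneProj_isStarProjection.isSelfAdjoint.star_eq]

/-! ### Algebras of functions -/

section FunAlg

variable {Y : Type u} {Z : Type u} [TopologicalSpace Y] [TopologicalSpace Z]
variable {D E : Type} [NonUnitalCStarAlgebra D] [NonUnitalCStarAlgebra E]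

/-- Pull back of functions along a continuous map. -/
def pullHom (D : Type) [NonUnitalCStarAlgebra D] (h : C(Z, Y)) : (Y →ᵇ D) →⋆ₙₐ[ℂ] (Z →ᵇ D) where
  toFun f := f.compContinuous h
  map_smul' _ _ := rfl
  map_zero' := rfl
  map_add' _ _ := rfl
  map_mul' _ _ := rfl
  map_star' _ := rfl

/-- Composition of functions with a star-homomorphism. -/
def postHom (Y : Type u) [TopologicalSpace Y] (φ : D →⋆ₙₐ[ℂ] E) : (Y →ᵇ D) →⋆ₙₐ[ℂ] (Y →ᵇ E) where
  toFun f := BoundedContinuousFunction.ofNormedAddCommGroup (fun y => φ (f y))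
    ((continuous_starHom φ).comp f.continuous) ‖f‖
    fun y => (NonUnitalStarAlgHom.norm_apply_le φ _).trans (f.norm_coe_le_norm y)
  map_smul' c f := by ext1 y; exact map_smul φ c (f y)
  map_zero' := by ext1 y; exact map_zero φ
  map_add' f g := by ext1 y; exact map_add φ (f y) (g y)
  map_mul' f g := by ext1 y; exact map_mul φ (f y) (g y)
  map_star' f := by ext1 y; exact map_star φ (f y)

end FunAlg

/-- The translation `y ↦ g⁻¹ y`. -/
def translate {G : Type v} [Group G] (Y : Type u) [TopologicalSpace Y] [MulAction G Y]
    [ContinuousConstSMul G Y] (g : G) : C(Y, Y) := ⟨fun y => g⁻¹ • y, continuous_const_smul _⟩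

/-- A `G`-invariant C*-subalgebra of the bounded continuous functions `Y → D`. -/
structure FunAlg (G : Type v) [Group G] (Y : Type u) [TopologicalSpace Y] [MulAction G Y]
    [ContinuousConstSMul G Y] (D : Type) [NonUnitalCStarAlgebra D] where
  sub : NonUnitalStarSubalgebra ℂ (Y →ᵇ D)
  isClosed : IsClosed (sub : Set (Y →ᵇ D))
  invariant : ∀ (g : G) f, f ∈ sub → f.compContinuous (translate Y g) ∈ sub

/-- A star-homomorphism restricted to star-subalgebras. -/
def restrictHom {A B : Type*} [NonUnitalCStarAlgebra A] [NonUnitalCStarAlgebra B]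
    (S : NonUnitalStarSubalgebra ℂ A) (T : NonUnitalStarSubalgebra ℂ B) (φ : A →⋆ₙₐ[ℂ] B)
    (h : ∀ x ∈ S, φ x ∈ T) : S →⋆ₙₐ[ℂ] T where
  toFun x := ⟨φ x.1, h x.1 x.2⟩
  map_smul' c x := Subtype.ext (map_smul φ c x.1)
  map_zero' := Subtype.ext (map_zero φ)
  map_add' x y := Subtype.ext (map_add φ x.1 y.1)
  map_mul' x y := Subtype.ext (map_mul φ x.1 y.1)
  map_star' x := Subtype.ext (map_star φ x.1)

namespace FunAlg

variable {G : Type v} [Group G] {Y Z : Type u} [TopologicalSpace Y] [MulAction G Y]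
  [ContinuousConstSMul G Y] [TopologicalSpace Z] [MulAction G Z] [ContinuousConstSMul G Z]
  {D E : Type} [NonUnitalCStarAlgebra D] [NonUnitalCStarAlgebra E]

instance (S : FunAlg G Y D) : NonUnitalCStarAlgebra S.sub :=
  haveI : IsClosed (S.sub : Set (Y →ᵇ D)) := S.isClosed
  inferInstance

/-- The algebra as a `G`-C*-algebra, with the action `(g f)(y) = f(g⁻¹ y)`. -/
def alg (S : FunAlg G Y D) : GCStarAlg.{u, v} G where
  carrier := S.sub
  act g := restrictHom S.sub S.sub (pullHom D (translate Y g)) (S.invariant g)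
  act_one f := Subtype.ext (by ext y; simp [restrictHom, pullHom, translate])
  act_mul g h f := Subtype.ext (by ext y; simp [restrictHom, pullHom, translate, mul_smul])

/-- The equivariant homomorphism given by restriction along an equivariant continuous map. -/
def pull (S : FunAlg G Y D) (T : FunAlg G Z D) (h : C(Z, Y)) (hG : ∀ (g : G) z, h (g • z) = g • h z)
    (hST : ∀ f ∈ S.sub, f.compContinuous h ∈ T.sub) : GHom S.alg T.alg where
  hom := restrictHom S.sub T.sub (pullHom D h) hST
  equivariant g f := Subtype.ext (by
    ext y
    change f.1 (g⁻¹ • h y) = f.1 (h (g⁻¹ • y))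
    rw [hG])

/-- The equivariant homomorphism given by composition with a homomorphism of coefficients. -/
def post (S : FunAlg G Y D) (T : FunAlg G Y E) (φ : D →⋆ₙₐ[ℂ] E)
    (hST : ∀ f ∈ S.sub, postHom Y φ f ∈ T.sub) : GHom S.alg T.alg where
  hom := restrictHom S.sub T.sub (postHom Y φ) hST
  equivariant _ _ := rfl

end FunAlg

/-! ### Metric spaces, vanishing variation, and the stable Higson compactification -/

/-- A coarse embedding of metric spaces. -/
def IsCoarseEmbedding {Y Z : Type*} [MetricSpace Y] [MetricSpace Z] (f : Y → Z) : Prop :=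
  (∀ R : ℝ, ∃ S : ℝ, ∀ x y, dist x y ≤ R → dist (f x) (f y) ≤ S) ∧
    ∀ R : ℝ, ∃ S : ℝ, ∀ x y, dist (f x) (f y) ≤ R → dist x y ≤ S

theorem _root_.Isometry.isCoarseEmbedding {Y Z : Type*} [MetricSpace Y] [MetricSpace Z] {f : Y → Z}
    (h : Isometry f) : IsCoarseEmbedding f :=
  ⟨fun R => ⟨R, fun x y => by rw [h.dist_eq]; exact id⟩,
    fun R => ⟨R, fun x y => by rw [h.dist_eq]; exact id⟩⟩

theorem IsCoarseEmbedding.tendsto_cocompact {Y Z : Type*} [MetricSpace Y] [MetricSpace Z]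
    [ProperSpace Y] {f : Y → Z} (h : IsCoarseEmbedding f) (hc : Continuous f) :
    Tendsto f (cocompact Y) (cocompact Z) := by
  refine (hasBasis_cocompact.tendsto_iff hasBasis_cocompact).2 fun K hK => ?_
  refine ⟨f ⁻¹' K, Metric.isCompact_of_isClosed_isBounded (hK.isClosed.preimage hc) ?_,
    fun x hx => hx⟩
  obtain ⟨R, hR⟩ := Metric.isBounded_iff.1 hK.isBounded
  obtain ⟨S, hS⟩ := h.2 R
  exact Metric.isBounded_iff.2 ⟨S, fun x hx y hy => hS x y (hR hx hy)⟩

/-- The variation `Var_r f (x) = sup {d(f(x), f(y)) | y ∈ B_r(x)}`. -/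
def variation {Y D : Type*} [MetricSpace Y] [PseudoEMetricSpace D] (f : Y → D) (r : ℝ) (x : Y) :
    ℝ≥0∞ :=
  ⨆ y ∈ Metric.ball x r, edist (f x) (f y)

/-- The function `f` has vanishing variation: `Var_r f` converges to zero at infinity for all
`r > 0`. -/
def VanishingVariation {Y D : Type*} [MetricSpace Y] [PseudoEMetricSpace D] (f : Y → D) : Prop :=
  ∀ r : ℝ, 0 < r → Tendsto (variation f r) (cocompact Y) (𝓝 0)

theorem vanishingVariation_iff {Y D : Type*} [MetricSpace Y] [PseudoMetricSpace D] {f : Y → D} :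
    VanishingVariation f ↔ ∀ r : ℝ, 0 < r → ∀ ε : ℝ, 0 < ε →
      ∀ᶠ x in cocompact Y, ∀ y ∈ Metric.ball x r, dist (f x) (f y) ≤ ε := by
  refine forall₂_congr fun r _ => ?_
  rw [ENNReal.tendsto_nhds_zero]
  constructor
  · intro h ε hε
    filter_upwards [h (ENNReal.ofReal ε) (by simpa using hε)] with x hx y hy
    rw [variation, iSup₂_le_iff] at hx
    have := hx y hy
    rwa [edist_dist, ENNReal.ofReal_le_ofReal_iff hε.le] at this
  · intro h ε hε
    by_cases ht : ε = ⊤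
    · simp [ht]
    have hε' : 0 < ε.toReal := ENNReal.toReal_pos hε.ne' ht
    filter_upwards [h ε.toReal hε'] with x hx
    rw [variation, iSup₂_le_iff]
    intro y hy
    rw [edist_dist, ← ENNReal.ofReal_toReal ht]
    exact ENNReal.ofReal_le_ofReal (hx y hy)

theorem VanishingVariation.comp {Y Z D : Type*} [MetricSpace Y] [MetricSpace Z] [ProperSpace Z]
    [PseudoMetricSpace D] {f : Y → D} (hf : VanishingVariation f) {h : Z → Y}
    (hh : IsCoarseEmbedding h) (hc : Continuous h) : VanishingVariation (f ∘ h) := by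
  rw [vanishingVariation_iff] at hf ⊢
  intro r _ ε hε
  obtain ⟨S, hS⟩ := hh.1 r
  filter_upwards [(hh.tendsto_cocompact hc).eventually (hf (|S| + 1) (by positivity) ε hε)]
    with x hx y hy
  refine hx (h y) ?_
  rw [Metric.mem_ball] at hy ⊢
  exact (hS y x hy.le).trans_lt ((le_abs_self S).trans_lt (lt_add_one _))

theorem vanishingVariation_of_tendsto_zero {Y D : Type*} [MetricSpace Y] [ProperSpace Y]
    [SeminormedAddCommGroup D] {f : Y → D} (hf : Tendsto f (cocompact Y) (𝓝 0)) :
    VanishingVariation f := by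
  rw [vanishingVariation_iff]
  intro r hr ε hε
  have h1 := (Metric.tendsto_nhds.1 hf) (ε / 2) (half_pos hε)
  obtain ⟨K, hK, hKs⟩ := hasBasis_cocompact.mem_iff.1 h1
  have hK' : IsCompact (Metric.cthickening r K) := hK.cthickening
  filter_upwards [hK'.compl_mem_cocompact] with x hx y hy
  have hxK : x ∉ K := fun h => hx (Metric.self_subset_cthickening _ h)
  have hyK : y ∉ K := fun h => hx (Metric.mem_cthickening_of_dist_le x y r K h (by
    rw [dist_comm]; exact (Metric.mem_ball.1 hy).le))
  have h2 := hKs hxK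
  have h3 := hKs hyK
  simp only [Set.mem_ofPred_eq, dist_zero_right] at h2 h3
  rw [dist_eq_norm]
  linarith [norm_sub_le (f x) (f y)]

theorem tendsto_of_eq {Y D : Type*} [TopologicalSpace D] {l : Filter Y} {f g : Y → D} {x y : D}
    (h : Tendsto f l (𝓝 x)) (hxy : x = y) (hfg : f = g := by rfl) : Tendsto g l (𝓝 y) :=
  hfg ▸ hxy ▸ h

section Algebras

variable (G : Type v) [Group G] (Y : Type u) [MetricSpace Y] [ProperSpace Y] [MulAction G Y]
  [IsIsometricSMul G Y]

theorem isClosed_vanish (D : Type) [NonUnitalCStarAlgebra D] (B : Set Y) :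
    IsClosed {f : Y →ᵇ D | ∀ y ∈ B, f y = 0} := by
  simp only [Set.ofPred_forall]
  exact isClosed_iInter fun y => isClosed_iInter fun _ =>
    isClosed_eq (continuous_eval_const y) continuous_const

theorem isClosed_tendsto (D : Type) [NonUnitalCStarAlgebra D] :
    IsClosed {f : Y →ᵇ D | Tendsto f (cocompact Y) (𝓝 0)} := by
  refine isClosed_of_closure_subset fun f hf => ?_
  rw [Metric.mem_closure_iff] at hf
  refine Metric.tendsto_nhds.2 fun ε hε => ?_
  obtain ⟨g, hg, hd⟩ := hf (ε / 2) (half_pos hε)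
  filter_upwards [Metric.tendsto_nhds.1 hg (ε / 2) (half_pos hε)] with y hy
  have := BoundedContinuousFunction.dist_coe_le_dist (f := f) (g := g) y
  linarith [dist_triangle (f y) (g y) 0]

theorem tendsto_translate (g : G) :
    Tendsto (translate Y g) (cocompact Y) (cocompact Y) :=
  (isometry_smul Y g⁻¹).isCoarseEmbedding.tendsto_cocompact (translate Y g).continuous

variable (B : Set Y) (hB : ∀ (g : G), ∀ y ∈ B, g • y ∈ B)

theorem isClosed_compactValues : IsClosed {f : Y →ᵇ Bd | ∀ y, (f y).Compact} := by
  simp only [Set.ofPred_forall]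
  exact isClosed_iInter fun y => Bd.isClosed_compact.preimage (continuous_eval_const y)

theorem isClosed_compactDiff : IsClosed {f : Y →ᵇ Bd | ∀ x y, (f x - f y).Compact} := by
  simp only [Set.ofPred_forall]
  exact isClosed_iInter fun x => isClosed_iInter fun y =>
    Bd.isClosed_compact.preimage ((continuous_eval_const x).sub (continuous_eval_const y))

theorem isClosed_vanishingVariation : IsClosed {f : Y →ᵇ Bd | VanishingVariation f} := by
  refine isClosed_of_closure_subset fun f hf => ?_
  rw [Metric.mem_closure_iff] at hf
  refine vanishingVariation_iff.2 fun r hr ε hε => ?_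
  obtain ⟨g, hg, hd⟩ := hf (ε / 3) (by positivity)
  filter_upwards [vanishingVariation_iff.1 hg r hr (ε / 3) (by positivity)] with x hx y hy
  have h1 := BoundedContinuousFunction.dist_coe_le_dist (f := f) (g := g) x
  have h2 := BoundedContinuousFunction.dist_coe_le_dist (f := f) (g := g) y
  have h3 := hx y hy
  have h4 := dist_triangle4 (f x) (g x) (g y) (f y)
  rw [dist_comm (g y)] at h4
  linarith

/-- The `G`-C*-algebra `C_0(Y ∖ B)` for a closed invariant subset `B ⊆ Y`, realised as the algebra
of those scalar functions on `Y` that vanish at infinity and on `B`. -/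
def c0Alg : FunAlg G Y ℂ where
  sub :=
    { carrier := {f | Tendsto f (cocompact Y) (𝓝 0) ∧ ∀ y ∈ B, f y = 0}
      add_mem' := fun {f g} hf hg => ⟨tendsto_of_eq (hf.1.add hg.1) (by simp), fun y hy => by
        simp [hf.2 y hy, hg.2 y hy]⟩
      zero_mem' := ⟨tendsto_const_nhds, fun _ _ => rfl⟩
      mul_mem' := fun {f g} hf hg => ⟨tendsto_of_eq (hf.1.mul hg.1) (by simp), fun y hy => by
        simp [hf.2 y hy]⟩
      smul_mem' := fun c f hf => ⟨by simpa using hf.1.const_smul c, fun y hy => by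
        simp [hf.2 y hy]⟩
      star_mem' := fun {f} hf => ⟨tendsto_of_eq (hf.1.star) (by simp), fun y hy => by
        simp [hf.2 y hy]⟩ }
  isClosed := (isClosed_tendsto Y ℂ).inter (isClosed_vanish Y ℂ B)
  invariant g f hf := ⟨hf.1.comp (tendsto_translate G Y g), fun y hy => hf.2 _ (hB g⁻¹ y hy)⟩

/-- The `G`-C*-algebra `C_0(Y ∖ B, K)` of functions with values in the compact operators. -/
def c0KAlg : FunAlg G Y Bd where
  sub :=
    { carrier := {f | (∀ y, (f y).Compact) ∧ Tendsto f (cocompact Y) (𝓝 0) ∧ ∀ y ∈ B, f y = 0}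
      add_mem' := fun {f g} hf hg => ⟨fun y => (hf.1 y).add (hg.1 y),
        tendsto_of_eq (hf.2.1.add hg.2.1) (by simp), fun y hy => by
        simp [hf.2.2 y hy, hg.2.2 y hy]⟩
      zero_mem' := ⟨fun _ => isCompactOperator_zero, tendsto_const_nhds, fun _ _ => rfl⟩
      mul_mem' := fun {f g} hf hg => ⟨fun y => IsCompactOperator.comp_clm (hf.1 y) (g y),
        tendsto_of_eq (hf.2.1.mul hg.2.1) (by simp), fun y hy => by
        simp [hf.2.2 y hy]⟩
      smul_mem' := fun c f hf => ⟨fun y => (hf.1 y).smul c,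
        by simpa using hf.2.1.const_smul c, fun y hy => by
        simp [hf.2.2 y hy]⟩
      star_mem' := fun {f} hf => ⟨fun y => (hf.1 y).star, tendsto_of_eq (hf.2.1.star) (by simp), fun y hy => by
        simp [hf.2.2 y hy]⟩ }
  isClosed := (isClosed_compactValues Y).inter ((isClosed_tendsto Y Bd).inter (isClosed_vanish Y Bd B))
  invariant g f hf := ⟨fun y => hf.1 _, hf.2.1.comp (tendsto_translate G Y g),
    fun y hy => hf.2.2 _ (hB g⁻¹ y hy)⟩

theorem variation_mul {f g : Y →ᵇ Bd} (hf : VanishingVariation f) (hg : VanishingVariation g) :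
    VanishingVariation (f * g : Y →ᵇ Bd) := by
  rw [vanishingVariation_iff] at hf hg ⊢
  intro r hr ε hε
  have hp : 0 < ‖f‖ + ‖g‖ + 1 := by positivity
  filter_upwards [hf r hr (ε / (‖f‖ + ‖g‖ + 1)) (by positivity),
    hg r hr (ε / (‖f‖ + ‖g‖ + 1)) (by positivity)] with x hfx hgx y hy
  have h1 := hfx y hy
  have h2 := hgx y hy
  rw [dist_eq_norm] at h1 h2 ⊢
  have h3 : (f * g) x - (f * g) y = f x * (g x - g y) + (f x - f y) * g y := by
    simp only [BoundedContinuousFunction.mul_apply]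
    noncomm_ring
  rw [h3]
  calc _ ≤ ‖f x‖ * ‖g x - g y‖ + ‖f x - f y‖ * ‖g y‖ :=
        (norm_add_le _ _).trans (add_le_add (norm_mul_le _ _) (norm_mul_le _ _))
    _ ≤ ‖f‖ * (ε / (‖f‖ + ‖g‖ + 1)) + (ε / (‖f‖ + ‖g‖ + 1)) * ‖g‖ := by
        gcongr
        · exact f.norm_coe_le_norm x
        · exact g.norm_coe_le_norm y
    _ = ε * ((‖f‖ + ‖g‖) / (‖f‖ + ‖g‖ + 1)) := by ring
    _ ≤ ε * 1 := by
        gcongr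
        rw [div_le_one hp]
        linarith
    _ = ε := mul_one _

/-- The reduced stable Higson compactification of the pair `(Y, B)`. For empty `B` it is the
algebra of all bounded continuous functions `f : Y → B(ℓ²)` of vanishing variation such that
`f(x) - f(y)` is compact for all `x, y ∈ Y`, and in general it is the kernel of the restriction to
`B`. -/
def higsonAlg : FunAlg G Y Bd where
  sub :=
    { carrier := {f | VanishingVariation f ∧ (∀ x y, (f x - f y).Compact) ∧ ∀ y ∈ B, f y = 0}
      add_mem' := fun {f g} hf hg => ⟨by
          have h1 := vanishingVariation_iff.1 hf.1
          have h2 := vanishingVariation_iff.1 hg.1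
          refine vanishingVariation_iff.2 fun r hr ε hε => ?_
          filter_upwards [h1 r hr (ε / 2) (half_pos hε), h2 r hr (ε / 2) (half_pos hε)]
            with x hfx hgx y hy
          have := dist_add_add_le (f x) (g x) (f y) (g y)
          exact this.trans (by linarith [hfx y hy, hgx y hy]),
        fun x y => by
          have : (f + g) x - (f + g) y = (f x - f y) + (g x - g y) := by
            simp only [BoundedContinuousFunction.add_apply]; abel
          rw [this]
          exact (hf.2.1 x y).add (hg.2.1 x y),
        fun y hy => by simp [hf.2.2 y hy, hg.2.2 y hy]⟩
      zero_mem' := ⟨vanishingVariation_iff.2 fun r hr ε hε => by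
          filter_upwards with x y hy
          simpa using hε.le,
        fun x y => by simpa [Bd.Compact] using isCompactOperator_zero, fun _ _ => rfl⟩
      mul_mem' := fun {f g} hf hg => ⟨variation_mul Y hf.1 hg.1, fun x y => by
          have : (f * g) x - (f * g) y = f x * (g x - g y) + (f x - f y) * g y := by
            simp only [BoundedContinuousFunction.mul_apply]
            noncomm_ring
          rw [this]
          exact IsCompactOperator.add (IsCompactOperator.clm_comp (hg.2.1 x y) (f x))
            (IsCompactOperator.comp_clm (hf.2.1 x y) (g y)),
        fun y hy => by simp [hf.2.2 y hy]⟩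
      smul_mem' := fun c f hf => ⟨by
          have h1 := vanishingVariation_iff.1 hf.1
          refine vanishingVariation_iff.2 fun r hr ε hε => ?_
          filter_upwards [h1 r hr (ε / (‖c‖ + 1)) (by positivity)] with x hfx y hy
          have h2 := hfx y hy
          rw [dist_eq_norm] at h2 ⊢
          simp only [BoundedContinuousFunction.coe_smul]
          rw [← smul_sub, norm_smul]
          calc _ ≤ (‖c‖ + 1) * (ε / (‖c‖ + 1)) := by gcongr; linarith
            _ = ε := by field_simp,
        fun x y => by
          simp only [BoundedContinuousFunction.coe_smul]
          rw [← smul_sub]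
          exact (hf.2.1 x y).smul c,
        fun y hy => by simp [hf.2.2 y hy]⟩
      star_mem' := fun {f} hf => ⟨by
          have h1 := vanishingVariation_iff.1 hf.1
          refine vanishingVariation_iff.2 fun r hr ε hε => ?_
          filter_upwards [h1 r hr ε hε] with x hfx y hy
          have h2 := hfx y hy
          rw [dist_eq_norm] at h2 ⊢
          simp only [BoundedContinuousFunction.star_apply]
          rwa [← star_sub, norm_star],
        fun x y => by
          simp only [BoundedContinuousFunction.star_apply]
          rw [← star_sub]
          exact (hf.2.1 x y).star,
        fun y hy => by simp [hf.2.2 y hy]⟩ }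
  isClosed := (isClosed_vanishingVariation Y).inter
    ((isClosed_compactDiff Y).inter (isClosed_vanish Y Bd B))
  invariant g f hf := ⟨hf.1.comp (isometry_smul Y g⁻¹).isCoarseEmbedding (translate Y g).continuous,
    fun x y => hf.2.1 _ _, fun y hy => hf.2.2 _ (hB g⁻¹ y hy)⟩

theorem c0KAlg_le_higsonAlg : (c0KAlg G Y B hB).sub ≤ (higsonAlg G Y B hB).sub := fun _ hf =>
  ⟨vanishingVariation_of_tendsto_zero hf.2.1, fun x y => (hf.1 x).sub (hf.1 y), hf.2.2⟩

theorem post_scalarHom_mem {f : Y →ᵇ ℂ} (hf : f ∈ (c0Alg G Y B hB).sub) :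
    postHom Y scalarHom f ∈ (c0KAlg G Y B hB).sub := by
  refine ⟨fun y => rankOneProj_compact.smul (f y), ?_, fun y hy => ?_⟩
  · have h := (continuous_starHom (A := ℂ) (B := Bd) scalarHom).tendsto 0
    rw [map_zero] at h
    exact h.comp hf.1
  · exact (congrArg scalarHom (hf.2 y hy)).trans (map_zero scalarHom)

/-- The ideal `C_0(Y ∖ B, K)` of the reduced stable Higson compactification. -/
def c0Ideal : ClosedIdeal (higsonAlg G Y B hB).alg.carrier where
  carrier :=
    { carrier := {f : (higsonAlg G Y B hB).sub | f.1 ∈ (c0KAlg G Y B hB).sub}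
      add_mem' := fun hf hg => (c0KAlg G Y B hB).sub.add_mem' hf hg
      zero_mem' := (c0KAlg G Y B hB).sub.zero_mem'
      smul_mem' := fun c _ hf => (c0KAlg G Y B hB).sub.smul_mem' c hf }
  isClosed := (c0KAlg G Y B hB).isClosed.preimage continuous_subtype_val
  mul_left := by
    rintro a x ⟨h1, h2, h3⟩
    refine ⟨fun y => IsCompactOperator.clm_comp (h1 y) (a.1 y), ?_, fun y hy => ?_⟩
    · refine squeeze_zero_norm (a := fun y => ‖a.1‖ * ‖x.1 y‖) (fun y => ?_) ?_
      · exact (norm_mul_le (a.1 y) (x.1 y)).trans (by gcongr; exact a.1.norm_coe_le_norm y)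
      · simpa using h2.norm.const_mul ‖a.1‖
    · exact (congrArg (a.1 y * ·) (h3 y hy)).trans (mul_zero _)
  mul_right := by
    rintro a x ⟨h1, h2, h3⟩
    refine ⟨fun y => IsCompactOperator.comp_clm (h1 y) (a.1 y), ?_, fun y hy => ?_⟩
    · refine squeeze_zero_norm (a := fun y => ‖x.1 y‖ * ‖a.1‖) (fun y => ?_) ?_
      · exact (norm_mul_le (x.1 y) (a.1 y)).trans (by gcongr; exact a.1.norm_coe_le_norm y)
      · simpa using h2.norm.mul_const ‖a.1‖
    · exact (congrArg (· * a.1 y) (h3 y hy)).trans (zero_mul _)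
  star_mem := fun h => (c0KAlg G Y B hB).sub.star_mem' h

/-- The reduced stable Higson corona: the quotient of the reduced stable Higson compactification
by `C_0(Y ∖ B, K)`. -/
def coronaAlg : GCStarAlg.{u, v} G where
  carrier := (c0Ideal G Y B hB).Quo
  act g := ClosedIdeal.mapHom _ _ ((higsonAlg G Y B hB).alg.act g) fun f hf =>
    (c0KAlg G Y B hB).invariant g f.1 hf
  act_one x := by
    obtain ⟨f, rfl⟩ := ClosedIdeal.proj_surjective _ x
    exact congrArg (c0Ideal G Y B hB).proj ((higsonAlg G Y B hB).alg.act_one f)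
  act_mul g h x := by
    obtain ⟨f, rfl⟩ := ClosedIdeal.proj_surjective _ x
    exact congrArg (c0Ideal G Y B hB).proj ((higsonAlg G Y B hB).alg.act_mul g h f)

/-- The quotient map from the compactification to the corona. -/
def coronaProj : GHom (higsonAlg G Y B hB).alg (coronaAlg G Y B hB) where
  hom := (c0Ideal G Y B hB).projHom
  equivariant _ _ := rfl

end Algebras

/-! ### σ-`G`-metric spaces -/

/-- Continuously bounded geometry of a metric space. -/
def ContinuouslyBoundedGeometry (Y : Type*) [MetricSpace Y] : Prop :=
  ∃ (K : ℝ → ℝ → ℝ) (P : ℝ → Set Y),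
    (∀ r R, 0 < r → 0 < R → 0 < K r R) ∧
    (∀ r, 0 < r → ⋃ p ∈ P r, Metric.ball p r = Set.univ) ∧
    (∀ r R, 0 < r → 0 < R → ∀ y, (P r ∩ Metric.closedBall y R).Finite ∧
      ((P r ∩ Metric.closedBall y R).ncard : ℝ) ≤ K r R) ∧
    ∀ α, 0 < α → ∃ C, ∀ᶠ r in 𝓝[>] (0 : ℝ), K r (α * r) ≤ C

/-- A σ-`G`-metric space: an increasing sequence `X 0 ⊆ X 1 ⊆ X 2 ⊆ ⋯` of proper metric spaces of
continuously bounded geometry with proper isometric actions of the discrete group `G`, whose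
inclusions are equivariant continuous coarse embeddings with closed image. -/
structure SigmaGMetricSpace (G : Type v) [Group G] where
  X : ℕ → Type u
  [metric : ∀ n, MetricSpace (X n)]
  [proper : ∀ n, ProperSpace (X n)]
  [action : ∀ n, MulAction G (X n)]
  [isometric : ∀ n, IsIsometricSMul G (X n)]
  [properAction : ∀ n, ProperlyDiscontinuousSMul G (X n)]
  boundedGeometry : ∀ n, ContinuouslyBoundedGeometry (X n)
  incl : ∀ n, X n → X (n + 1)
  incl_injective : ∀ n, Function.Injective (incl n)
  incl_continuous : ∀ n, Continuous (incl n)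
  incl_coarse : ∀ n, IsCoarseEmbedding (incl n)
  incl_closed : ∀ n, IsClosed (Set.range (incl n))
  incl_smul : ∀ n (g : G) x, incl n (g • x) = g • incl n x

attribute [instance] SigmaGMetricSpace.metric SigmaGMetricSpace.proper SigmaGMetricSpace.action
  SigmaGMetricSpace.isometric SigmaGMetricSpace.properAction

namespace SigmaGMetricSpace

variable {G : Type v} [Group G]

/-- Each `X n` is `G`-compact. -/
def IsGCompact (E : SigmaGMetricSpace.{u, v} G) : Prop :=
  ∀ n, ∃ K : Set (E.X n), IsCompact K ∧ ⋃ g : G, (fun x => g • x) '' K = Set.univ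

/-- The set `⋃ n, X n`. -/
def Total (E : SigmaGMetricSpace.{u, v} G) : Type u :=
  Quot fun a b : Σ n, E.X n => b = ⟨a.1 + 1, E.incl a.1 a.2⟩

/-- The final topology on `⋃ n, X n`. -/
instance (E : SigmaGMetricSpace.{u, v} G) : TopologicalSpace E.Total :=
  inferInstanceAs (TopologicalSpace (Quot _))

/-- The action of `G` on `⋃ n, X n`. -/
instance (E : SigmaGMetricSpace.{u, v} G) : SMul G E.Total where
  smul g := Quot.map (fun a => ⟨a.1, g • a.2⟩) fun a b h => by
    subst h
    simp only [E.incl_smul]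

/-- An embedding of `X` as a subspace of `E`: it identifies `X n`, with its metric and action, with
the intersection of `E n` and `⋃ m, X m`. -/
structure Embedding (X E : SigmaGMetricSpace.{u, v} G) where
  emb : ∀ n, X.X n → E.X n
  isometry : ∀ n, Isometry (emb n)
  emb_smul : ∀ n (g : G) x, emb n (g • x) = g • emb n x
  emb_incl : ∀ n x, emb (n + 1) (X.incl n x) = E.incl n (emb n x)
  inter : ∀ n y, E.incl n y ∈ Set.range (emb (n + 1)) → y ∈ Set.range (emb n)

/-- A compatible family of invariant subsets `B n ⊆ E n`. -/
structure SubFamily (E : SigmaGMetricSpace.{u, v} G) where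
  set : ∀ n, Set (E.X n)
  smul_mem : ∀ n (g : G), ∀ y ∈ set n, g • y ∈ set n
  incl_mem : ∀ n, ∀ y ∈ set n, E.incl n y ∈ set (n + 1)

/-- The empty subspace. -/
def noSub (E : SigmaGMetricSpace.{u, v} G) : E.SubFamily where
  set _ := ∅
  smul_mem _ _ _ h := h.elim
  incl_mem _ _ h := h.elim

/-- The subspace given by an embedding. -/
def Embedding.image {X E : SigmaGMetricSpace.{u, v} G} (j : Embedding X E) : E.SubFamily where
  set n := Set.range (j.emb n)
  smul_mem := by
    rintro n g _ ⟨x, rfl⟩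
    exact ⟨g • x, j.emb_smul n g x⟩
  incl_mem := by
    rintro n _ ⟨x, rfl⟩
    exact ⟨X.incl n x, j.emb_incl n x⟩

/-! ### The classifying space for proper actions -/

/-- The `G`-space `W` is a `G`-CW model with countably many cells of the classifying space for
proper actions: it has a CW structure whose open cells are permuted by `G`, such that every element
that maps an open cell to itself fixes it pointwise, the stabilizers of points are finite, and
the fixed point sets of finite subgroups are contractible. -/
def IsProperClassifyingCW (G : Type v) [Group G] (W : Type u) [TopologicalSpace W]
    [MulAction G W] : Prop :=
  T2Space W ∧ ContinuousConstSMul G W ∧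
  (∃ _ : CWComplex (Set.univ : Set W),
    (∀ n, Countable (RelCWComplex.cell (Set.univ : Set W) n)) ∧
    (∀ (g : G) n (c : RelCWComplex.cell (Set.univ : Set W) n),
      ∃ c' : RelCWComplex.cell (Set.univ : Set W) n,
        (fun x => g • x) '' RelCWComplex.openCell n c = RelCWComplex.openCell n c') ∧
    ∀ (g : G) n (c : RelCWComplex.cell (Set.univ : Set W) n),
      (fun x => g • x) '' RelCWComplex.openCell n c = RelCWComplex.openCell n c →
        ∀ x ∈ RelCWComplex.openCell n c, g • x = x) ∧
  (∀ x : W, (MulAction.stabilizer G x : Set G).Finite) ∧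
  ∀ H : Subgroup G, Finite H → ContractibleSpace (MulAction.fixedPoints H W)

/-- A `G`-homotopy equivalence. -/
def GHomotopyEquivalent (G : Type v) (V W : Type*) [TopologicalSpace V] [TopologicalSpace W]
    [SMul G V] [SMul G W] : Prop :=
  ∃ (f : C(V, W)) (f' : C(W, V)) (H : C(unitInterval × V, V)) (H' : C(unitInterval × W, W)),
    (∀ (g : G) x, f (g • x) = g • f x) ∧ (∀ (g : G) y, f' (g • y) = g • f' y) ∧
    (∀ (g : G) t x, H (t, g • x) = g • H (t, x)) ∧
    (∀ (g : G) t y, H' (t, g • y) = g • H' (t, y)) ∧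
    (∀ x, H (0, x) = f' (f x)) ∧ (∀ x, H (1, x) = x) ∧
    (∀ y, H' (0, y) = f (f' y)) ∧ ∀ y, H' (1, y) = y

/-- The σ-`G`-metric space `E` is a `σ`-`G`-compact model of the classifying space for
proper actions of `G`. -/
def IsProperClassifyingSpace (E : SigmaGMetricSpace.{u, v} G) : Prop :=
  E.IsGCompact ∧ ∃ (W : Type u) (_ : TopologicalSpace W) (_ : MulAction G W),
    IsProperClassifyingCW G W ∧ GHomotopyEquivalent G E.Total W

/-! ### The σ-C*-algebras of a σ-`G`-metric space -/

section Towers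

variable (E : SigmaGMetricSpace.{u, v} G) (B : E.SubFamily)

/-- The inclusion `X n → X (n + 1)` as a continuous map. -/
def inclMap (n : ℕ) : C(E.X n, E.X (n + 1)) := ⟨E.incl n, E.incl_continuous n⟩

/-- The σ-`G`-C*-algebra `C_0(E ∖ B) = lim C_0(E_n ∖ B_n)`. -/
def c0 : GTower.{u, v} G where
  obj n := (c0Alg G (E.X n) (B.set n) (B.smul_mem n)).alg
  map n := FunAlg.pull _ _ (E.inclMap n) (E.incl_smul n) fun _ hf =>
    ⟨hf.1.comp ((E.incl_coarse n).tendsto_cocompact (E.incl_continuous n)),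
      fun y hy => hf.2 _ (B.incl_mem n y hy)⟩

/-- The σ-`G`-C*-algebra `C_0(E ∖ B, K) = lim C_0(E_n ∖ B_n, K)`. -/
def c0K : GTower.{u, v} G where
  obj n := (c0KAlg G (E.X n) (B.set n) (B.smul_mem n)).alg
  map n := FunAlg.pull _ _ (E.inclMap n) (E.incl_smul n) fun _ hf =>
    ⟨fun _ => hf.1 _, hf.2.1.comp ((E.incl_coarse n).tendsto_cocompact (E.incl_continuous n)),
      fun y hy => hf.2.2 _ (B.incl_mem n y hy)⟩

/-- The reduced stable Higson compactification of the pair `(E, B)`. -/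
def higson : GTower.{u, v} G where
  obj n := (higsonAlg G (E.X n) (B.set n) (B.smul_mem n)).alg
  map n := FunAlg.pull _ _ (E.inclMap n) (E.incl_smul n) fun _ hf =>
    ⟨hf.1.comp (E.incl_coarse n) (E.incl_continuous n), fun _ _ => hf.2.1 _ _,
      fun y hy => hf.2.2 _ (B.incl_mem n y hy)⟩

/-- The reduced stable Higson corona of the pair `(E, B)`. -/
def corona : GTower.{u, v} G where
  obj n := coronaAlg G (E.X n) (B.set n) (B.smul_mem n)
  map n :=
    { hom := ClosedIdeal.mapHom _ _ ((E.higson B).map n).hom fun f hf =>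
        (((E.c0K B).map n).hom ⟨f.1, hf⟩).2
      equivariant := fun g x => by
        obtain ⟨f, rfl⟩ := ClosedIdeal.proj_surjective _ x
        exact congrArg (ClosedIdeal.proj _) (((E.higson B).map n).equivariant g f) }

/-- The inclusion `C_0(E ∖ B) → C_0(E ∖ B, K)` given by a rank one projection. -/
def c0Stab : GTowerHom (E.c0 B) (E.c0K B) where
  app n := FunAlg.post _ _ scalarHom fun _ hf =>
    post_scalarHom_mem G (E.X n) (B.set n) (B.smul_mem n) hf
  comm _ _ := rfl

/-- The inclusion of `C_0(E ∖ B, K)` into the reduced stable Higson compactification. -/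
def c0KToHigson : GTowerHom (E.c0K B) (E.higson B) where
  app n := FunAlg.pull _ _ (ContinuousMap.id _) (fun _ _ => rfl) fun _ hf =>
    c0KAlg_le_higsonAlg G (E.X n) (B.set n) (B.smul_mem n) hf
  comm _ _ := rfl

/-- The quotient map from the reduced stable Higson compactification to the corona. -/
def higsonToCorona : GTowerHom (E.higson B) (E.corona B) where
  app n := coronaProj G (E.X n) (B.set n) (B.smul_mem n)
  comm _ _ := rfl

/-- The natural map `C_0(E ∖ B) → C_0(E)`. -/
def c0Forget : GTowerHom (E.c0 B) (E.c0 E.noSub) where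
  app _ := FunAlg.pull _ _ (ContinuousMap.id _) (fun _ _ => rfl) fun _ hf =>
    ⟨hf.1, fun _ hy => hy.elim⟩
  comm _ _ := rfl

/-- The inclusion of the reduced stable Higson compactification of the pair `(E, B)` into the one
of `E`. -/
def higsonForget : GTowerHom (E.higson B) (E.higson E.noSub) where
  app _ := FunAlg.pull _ _ (ContinuousMap.id _) (fun _ _ => rfl) fun _ hf =>
    ⟨hf.1, hf.2.1, fun _ hy => hy.elim⟩
  comm _ _ := rfl

end Towers

/-- The restriction map on reduced stable Higson compactifications from `E` to a subspace `X`. -/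
def higsonRestrict {X E : SigmaGMetricSpace.{u, v} G} (j : Embedding X E) :
    GTowerHom (E.higson E.noSub) (X.higson X.noSub) where
  app n := FunAlg.pull _ _ ⟨j.emb n, (j.isometry n).continuous⟩ (j.emb_smul n) fun _ hf =>
    ⟨hf.1.comp (j.isometry n).isCoarseEmbedding (j.isometry n).continuous, fun _ _ => hf.2.1 _ _,
      fun _ hy => hy.elim⟩
  comm n f := Subtype.ext (by
    ext1 x
    exact congrArg f.1 (j.emb_incl n x).symm)

/-! ### Equivariant K-theory, co-assembly and the boundary map -/

variable (μ : CrossedProductFunctor.{u, v} G)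

/-- The equivariant K-theory `K_G^m(E, B) = K_{-m}(C_0(E ∖ B) ⋊_μ G)`. -/
abbrev EquivariantK (E : SigmaGMetricSpace.{u, v} G) (B : E.SubFamily) (m : ℤ) : Type u :=
  (μ.tower (E.c0 B)).K (-m)

/-- The group `K_m` of the crossed product of the reduced stable Higson compactification. -/
abbrev HigsonK (E : SigmaGMetricSpace.{u, v} G) (B : E.SubFamily) (m : ℤ) : Type u :=
  (μ.tower (E.higson B)).K m

/-- The group `K_m` of the crossed product of the reduced stable Higson corona. -/
abbrev CoronaK (E : SigmaGMetricSpace.{u, v} G) (B : E.SubFamily) (m : ℤ) : Type u :=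
  (μ.tower (E.corona B)).K m

/-- The stabilisation map `K_G^m(E, B) → K_{-m}(C_0(E ∖ B, K) ⋊_μ G)`. -/
def stabilisationMap (E : SigmaGMetricSpace.{u, v} G) (B : E.SubFamily) (m : ℤ) :
    E.EquivariantK μ B m →+ (μ.tower (E.c0K B)).K (-m) :=
  (μ.towerHom (E.c0Stab B)).kMap (-m)

/-- The canonical map from the equivariant K-theory of the pair `(E, B)` to the K-theory of the
crossed product of its reduced stable Higson compactification. -/
def canonicalMap (E : SigmaGMetricSpace.{u, v} G) (B : E.SubFamily) (m : ℤ) :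
    E.EquivariantK μ B m →+ E.HigsonK μ B (-m) :=
  ((μ.towerHom (E.c0KToHigson B)).kMap (-m)).comp (E.stabilisationMap μ B m)

/-- The natural map `K_G^m(E, B) → K_G^m(E)`. -/
def forgetMap (E : SigmaGMetricSpace.{u, v} G) (B : E.SubFamily) (m : ℤ) :
    E.EquivariantK μ B m →+ E.EquivariantK μ E.noSub m :=
  (μ.towerHom (E.c0Forget B)).kMap (-m)

/-- The map `α : K_{-n}(c^red(E) ⋊_μ G) → K_G^{n+1}(E)` is the equivariant coarse co-assembly map:
followed by the stabilisation map `K_G^{n+1}(E) → K_{-(n+1)}(C_0(E, K) ⋊_μ G)`, it is the boundary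
map of the extension of the stable Higson corona. -/
def IsCoassembly (E : SigmaGMetricSpace.{u, v} G) (n : ℤ)
    (α : E.CoronaK μ E.noSub (-n) →+ E.EquivariantK μ E.noSub (n + 1)) : Prop :=
  ∀ ξ η, IsBoundary (μ.towerHom (E.c0KToHigson E.noSub)) (μ.towerHom (E.higsonToCorona E.noSub)) ξ η
    ↔ E.stabilisationMap μ E.noSub (n + 1) (α ξ) = η

/-- The map `δ : K_{-n}(c̄^red(X) ⋊_μ G) → K_G^{n+1}(E, X)` is the comparison map of the pair:
followed by the canonical map `K_G^{n+1}(E, X) → K_{-(n+1)}(c̄^red(E, X) ⋊_μ G)`, it is the boundary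
map of the extension `c̄^red(E, X) → c̄^red(E) → c̄^red(X)`. -/
def IsDelta {X E : SigmaGMetricSpace.{u, v} G} (j : Embedding X E) (n : ℤ)
    (δ : X.HigsonK μ X.noSub (-n) →+ E.EquivariantK μ j.image (n + 1)) : Prop :=
  ∀ ξ η, IsBoundary (μ.towerHom (E.higsonForget j.image)) (μ.towerHom (higsonRestrict j)) ξ η
    ↔ E.canonicalMap μ j.image (n + 1) (δ ξ) = η

end SigmaGMetricSpace

end HigsonRoe

end

/-! Two extensions share the compactification algebra of `E` in the middle. One has the
compactification of the pair `(E, X)` as its ideal and that of `X` as its quotient; the other has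
`C_0(E, K)` and the corona. In both, exactness of the K-theory sequence at the ideal says that the
image of the boundary map is the kernel of the map induced by the inclusion of the ideal
(`IsExactSeq.mem_range_iff`). The inclusions of `C_0(E ∖ X, K)` into the compactification of `E`
through either ideal agree, so a relative class and its image in the absolute group have the same
image in the K-theory of the middle algebra (`kMap_canonicalMap`). Both sides of the criterion say
that this common image is zero.

The geometric input is coarse density. As `E_m` is `G`-compact, every point lies within bounded
distance of `X_m` as soon as `X_m` is nonempty. Vanishing variation together with vanishing on `X_m`
then forces a function to tend to zero at infinity with compact values, so the compactification of
the pair equals `C_0(E_m ∖ X_m, K)` (`c0KToHigson_bijective`). Density also yields surjectivity of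
restriction to `X_m`, by averaging nearby values (`exists_approx_higson`). Thus the canonical map is
the stabilisation map up to an isomorphism of towers from some index on.

The stabilisation map is bijective for two reasons. First, `K ⊗ A` and `C_0(E ∖ B, K) ⋊ G` are
generated by faithful systems of matrix units with the same coefficients `A = C_0(E ∖ B) ⋊ G`, hence
isomorphic (`MatrixSystem.lift_bijective`). Faithfulness is where properness of the action enters:
cut down by compactly supported functions, an element of the crossed product has only finitely many
coefficients, and there every C*-norm is controlled by them (`map_injective_of_proper`). Second, the
corner embedding `A → K ⊗ A` becomes, after one more stabilisation, homotopic to an isomorphism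
through a path of isometries (`Tower.stableCorner`).

The boundary map is constructed on loops. A map of a cube into the unitaries of the quotient lifts,
with prescribed values on a subset onto which the cube contracts: at one level by logarithms and
connectedness of a path, across the tower by a Mittag-Leffler correction
(`Contraction.exists_lift_tower`). K-theory is a direct limit along Bott maps, and all lifting
constructions commute with these, so bijectivity of the Bott maps is never needed. -/

open Filter Topology
open scoped ENNReal BoundedContinuousFunction

noncomputable section

namespace HigsonRoe

/-! ### Images of star-homomorphisms -/

section Images

variable {A B : Type u} [NonUnitalCStarAlgebra A] [NonUnitalCStarAlgebra B]

/-- The kernel of a star-homomorphism. -/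
def kerIdeal (φ : A →⋆ₙₐ[ℂ] B) : ClosedIdeal A where
  carrier :=
    { carrier := {x | φ x = 0}
      add_mem' := fun {x y} hx hy => by
        change φ (x + y) = 0
        rw [map_add, show φ x = 0 from hx, show φ y = 0 from hy, add_zero]
      zero_mem' := map_zero φ
      smul_mem' := fun c x hx => by
        change φ (c • x) = 0
        rw [map_smul, show φ x = 0 from hx, smul_zero] }
  isClosed := isClosed_eq (continuous_starHom φ) continuous_const
  mul_left a x hx := by
    change φ (a * x) = 0
    rw [map_mul, show φ x = 0 from hx, mul_zero]
  mul_right a x hx := by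
    change φ (x * a) = 0
    rw [map_mul, show φ x = 0 from hx, zero_mul]
  star_mem {x} hx := by
    change φ (star x) = 0
    rw [map_star, show φ x = 0 from hx, star_zero]

theorem mem_kerIdeal {φ : A →⋆ₙₐ[ℂ] B} {x : A} : x ∈ (kerIdeal φ).carrier ↔ φ x = 0 := Iff.rfl

/-- The injective star-homomorphism induced on the quotient by the kernel. -/
def kerLift (φ : A →⋆ₙₐ[ℂ] B) : (kerIdeal φ).Quo →⋆ₙₐ[ℂ] B where
  toFun := Quotient.lift φ (by
    intro a a' h
    rw [← Quotient.eq_iff_equiv] at h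
    replace h := (Submodule.Quotient.eq _).1 h
    rw [← sub_eq_zero, ← map_sub]
    exact h)
  map_smul' c x := by
    obtain ⟨a, rfl⟩ := (kerIdeal φ).proj_surjective x
    exact map_smul φ c a
  map_zero' := map_zero φ
  map_add' x y := by
    obtain ⟨a, rfl⟩ := (kerIdeal φ).proj_surjective x
    obtain ⟨b, rfl⟩ := (kerIdeal φ).proj_surjective y
    exact map_add φ a b
  map_mul' x y := by
    obtain ⟨a, rfl⟩ := (kerIdeal φ).proj_surjective x
    obtain ⟨b, rfl⟩ := (kerIdeal φ).proj_surjective y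
    exact map_mul φ a b
  map_star' x := by
    obtain ⟨a, rfl⟩ := (kerIdeal φ).proj_surjective x
    exact map_star φ a

theorem kerLift_proj (φ : A →⋆ₙₐ[ℂ] B) (a : A) : kerLift φ ((kerIdeal φ).proj a) = φ a := rfl

theorem kerLift_injective (φ : A →⋆ₙₐ[ℂ] B) : Function.Injective (kerLift φ) := by
  intro x y h
  obtain ⟨a, rfl⟩ := (kerIdeal φ).proj_surjective x
  obtain ⟨b, rfl⟩ := (kerIdeal φ).proj_surjective y
  rw [kerLift_proj, kerLift_proj] at h
  rw [ClosedIdeal.proj_eq_iff, mem_kerIdeal, map_sub, h, sub_self]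

/-- The map induced on the quotient by the kernel is injective, hence isometric on a complete space,
and has the same range. -/
theorem isClosed_range_starHom (φ : A →⋆ₙₐ[ℂ] B) : IsClosed (Set.range φ) := by
  have h := (NonUnitalStarAlgHom.isometry (kerLift φ) (kerLift_injective φ)).isClosedEmbedding
  convert h.isClosed_range using 1
  ext b
  constructor
  · rintro ⟨a, rfl⟩
    exact ⟨(kerIdeal φ).proj a, rfl⟩
  · rintro ⟨x, rfl⟩
    obtain ⟨a, rfl⟩ := (kerIdeal φ).proj_surjective x
    exact ⟨a, rfl⟩

/-- As the range is closed, approximate preimages suffice. All surjectivity statements for function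
algebras and stabilisations below go through this. -/
theorem surjective_of_approx (φ : A →⋆ₙₐ[ℂ] B)
    (h : ∀ b, ∀ ε : ℝ, 0 < ε → ∃ a, ‖φ a - b‖ ≤ ε) : Function.Surjective φ := by
  intro b
  change b ∈ Set.range φ
  rw [← (isClosed_range_starHom φ).closure_eq, Metric.mem_closure_iff]
  intro ε hε
  obtain ⟨a, ha⟩ := h b (ε / 2) (half_pos hε)
  refine ⟨_, ⟨a, rfl⟩, ?_⟩
  rw [dist_comm, dist_eq_norm]
  linarith

/-- The norm of `b` is the quotient norm modulo the kernel, because `kerLift` is isometric. -/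
theorem exists_lift_norm_lt {φ : A →⋆ₙₐ[ℂ] B} (hφ : Function.Surjective φ) (b : B) {ε : ℝ}
    (hε : 0 < ε) : ∃ a, φ a = b ∧ ‖a‖ < ‖b‖ + ε := by
  obtain ⟨a, rfl⟩ := hφ b
  obtain ⟨a', h1, h2⟩ := (kerIdeal φ).exists_norm_lt ((kerIdeal φ).proj a) hε
  refine ⟨a', ?_, ?_⟩
  · rw [← kerLift_proj, h1, kerLift_proj]
  · rwa [← NonUnitalStarAlgHom.norm_map (kerLift φ) (kerLift_injective φ), kerLift_proj] at h2

end Images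

/-! ### Lifting quasi-unitaries -/

section Circ

variable {A B : Type*} [NonUnitalRing A] [StarRing A] [NonUnitalRing B] [StarRing B]

/-- The product of quasi-unitaries: `1 + qmul x y = (1 + x) (1 + y)`. -/
def qmul (x y : A) : A := x + y + x * y

theorem qmul_assoc (x y z : A) : qmul (qmul x y) z = qmul x (qmul y z) := by
  simp only [qmul]; noncomm_ring

@[simp] theorem qmul_zero (x : A) : qmul x 0 = x := by simp [qmul]
@[simp] theorem zero_qmul (x : A) : qmul 0 x = x := by simp [qmul]

theorem IsQuasiUnitary.qmul_star_self {x : A} (h : IsQuasiUnitary x) : qmul x (Star.star x) = 0 := by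
  rw [qmul, ← h.2]; abel

theorem IsQuasiUnitary.star_qmul_self {x : A} (h : IsQuasiUnitary x) : qmul (Star.star x) x = 0 := by
  rw [qmul, ← h.1]; abel

theorem map_qmul {F : Type*} [FunLike F A B] [NonUnitalRingHomClass F A B] (φ : F) (x y : A) :
    φ (qmul x y) = qmul (φ x) (φ y) := by simp [qmul]

theorem IsQuasiUnitary.of_map {F : Type*} [FunLike F A B] [NonUnitalRingHomClass F A B]
    [StarHomClass F A B] (φ : F) (hφ : Function.Injective φ) {x : A} (hx : IsQuasiUnitary (φ x)) :
    IsQuasiUnitary x := by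
  refine ⟨hφ ?_, hφ ?_⟩
  · simpa [map_star] using hx.1
  · simpa [map_star] using hx.2

end Circ

section Lifting

variable {A B : Type u} [NonUnitalCStarAlgebra A] [NonUnitalCStarAlgebra B]

theorem isStarNormal_of_isQuasiUnitary {x : A} (h : IsQuasiUnitary x) : IsStarNormal x :=
  ⟨by
    have h3 : star x * x + x + star x = x * star x + x + star x := by rw [h.1, h.2]
    exact add_right_cancel (add_right_cancel h3)⟩

/-- The logarithm is `h = arg (1 + z)`. The bound on `z` keeps the spectrum of `1 + z` off the
branch cut, and unitarity puts it on the unit circle, where `exp (i arg)` is the identity. The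
non-unital calculus applies because `arg 1 = 0`. -/
theorem exists_log_of_isQuasiUnitary {z : B} (hz : IsQuasiUnitary z) (hn : ‖z‖ < 1) :
    ∃ h : B, IsSelfAdjoint h ∧ cfcₙ (fun w : ℂ => Complex.exp (Complex.I * w) - 1) h = z := by
  have hnorm := isStarNormal_of_isQuasiUnitary hz
  have hslit : ∀ w ∈ quasispectrum ℂ z, 1 + w ∈ Complex.slitPlane := by
    intro w hw
    have : ‖w‖ ≤ ‖z‖ := by
      rw [Unitization.quasispectrum_eq_spectrum_inr' ℂ ℂ z] at hw
      simpa [Unitization.norm_inr] using spectrum.norm_le_norm_of_mem hw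
    exact Complex.mem_slitPlane_of_norm_lt_one (this.trans_lt hn)
  have hcont : ContinuousOn (fun w : ℂ => (Complex.arg (1 + w) : ℂ)) (quasispectrum ℂ z) := by
    intro w hw
    refine ContinuousAt.continuousWithinAt ?_
    refine Complex.continuous_ofReal.continuousAt.comp ?_
    exact (Complex.continuousAt_arg (hslit w hw)).comp (by fun_prop : ContinuousAt (fun w : ℂ => 1 + w) w)
  -- The algebraic identity satisfied by `z` holds at every point of the quasispectrum, and there it
  -- reads `|1 + w|² = 1`.
  have habs : ∀ w ∈ quasispectrum ℂ z, ‖1 + w‖ = 1 := by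
    intro w hw
    have h1 : cfcₙ (fun w : ℂ => star w * w + w + star w) z = cfcₙ (fun _ : ℂ => (0 : ℂ)) z := by
      rw [cfcₙ_const_zero, cfcₙ_add (fun w : ℂ => star w * w + w) (fun w => star w) z,
        cfcₙ_add (fun w : ℂ => star w * w) (fun w => w) z, cfcₙ_mul (fun w : ℂ => star w) (fun w => w) z,
        cfcₙ_star_id z, cfcₙ_id' ℂ z, hz.1]
    have h2' := eqOn_of_cfcₙ_eq_cfcₙ h1
    have h2 : star w * w + w + star w = 0 := h2' hw
    have h3 : ((‖1 + w‖ ^ 2 : ℝ) : ℂ) = 1 := by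
      rw [← Complex.normSq_eq_norm_sq, ← Complex.mul_conj, map_add, map_one]
      rw [Complex.star_def] at h2
      linear_combination h2
    have h4 : ‖1 + w‖ ^ 2 = 1 := by exact_mod_cast h3
    nlinarith [norm_nonneg (1 + w)]
  refine ⟨cfcₙ (fun w : ℂ => (Complex.arg (1 + w) : ℂ)) z, ?_, ?_⟩
  · rw [IsSelfAdjoint, ← cfcₙ_star]
    simp
  · rw [← cfcₙ_comp' (fun w : ℂ => Complex.exp (Complex.I * w) - 1)
      (fun w : ℂ => (Complex.arg (1 + w) : ℂ)) z]
    conv_rhs => rw [← cfcₙ_id' ℂ z]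
    refine cfcₙ_congr fun w hw => ?_
    have := Complex.norm_mul_exp_arg_mul_I (1 + w)
    rw [habs w hw, Complex.ofReal_one, one_mul, mul_comm] at this
    simp only [this]
    ring

theorem isQuasiUnitary_cfc_exp {a : A} (ha : IsSelfAdjoint a) :
    IsQuasiUnitary (cfcₙ (fun w : ℂ => Complex.exp (Complex.I * w) - 1) a) := by
  have hN : IsStarNormal a := ha.isStarNormal
  set f : ℂ → ℂ := fun w => Complex.exp (Complex.I * w) - 1 with hf
  have hreal : ∀ w ∈ quasispectrum ℂ a, (starRingEnd ℂ) w = w := by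
    intro w hw
    have h1 : cfcₙ (fun w : ℂ => star w) a = cfcₙ (fun w : ℂ => w) a := by
      rw [cfcₙ_star_id a, cfcₙ_id' ℂ a, ha.star_eq]
    have h2 := eqOn_of_cfcₙ_eq_cfcₙ h1
    exact h2 hw
  have key : ∀ w ∈ quasispectrum ℂ a, star (f w) * f w + f w + star (f w) = 0 := by
    intro w hw
    simp only [hf, Complex.star_def, map_sub, ← Complex.exp_conj, map_mul, Complex.conj_I,
      hreal w hw, map_one]
    have : Complex.exp (-Complex.I * w) * Complex.exp (Complex.I * w) = 1 := by
      rw [← Complex.exp_add]; simp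
    linear_combination this
  have hz : cfcₙ (fun w : ℂ => star (f w) * f w + f w + star (f w)) a = 0 := by
    rw [cfcₙ_congr (g := fun _ => 0) key, cfcₙ_const_zero]
  have hcf : ContinuousOn f (quasispectrum ℂ a) := by fun_prop
  have hf0 : f 0 = 0 := by simp [hf]
  rw [cfcₙ_add (fun w => star (f w) * f w + f w) (fun w => star (f w)) a,
    cfcₙ_add (fun w => star (f w) * f w) f a, cfcₙ_mul (fun w => star (f w)) f a, cfcₙ_star] at hz
  refine ⟨hz, ?_⟩
  rw [← hz, ← cfcₙ_star, (cfcₙ_commute_cfcₙ f (fun w => star (f w)) a).eq]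

/-- Self-adjoint elements lift: average any preimage with its adjoint. So take the logarithm of `z`,
lift it and exponentiate; star-homomorphisms commute with the functional calculus. -/
theorem exists_quasiUnitary_lift_of_norm_lt {p : A →⋆ₙₐ[ℂ] B} (hp : Function.Surjective p)
    {z : B} (hz : IsQuasiUnitary z) (hn : ‖z‖ < 1) : ∃ y, IsQuasiUnitary y ∧ p y = z := by
  obtain ⟨h, hsa, rfl⟩ := exists_log_of_isQuasiUnitary hz hn
  obtain ⟨b, rfl⟩ := hp h
  set a : A := (2⁻¹ : ℂ) • (b + star b) with ha
  have hasa : IsSelfAdjoint a := by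
    rw [IsSelfAdjoint, ha, star_smul, star_add, star_star, add_comm]
    simp
  have hpa : p a = p b := by
    rw [ha, map_smul, map_add, map_star, hsa.star_eq, ← two_smul ℂ, smul_smul]
    norm_num
  refine ⟨_, isQuasiUnitary_cfc_exp hasa, ?_⟩
  have hN : IsStarNormal a := hasa.isStarNormal
  have hN' : IsStarNormal (p a) := hasa.isStarNormal.map p
  rw [NonUnitalStarAlgHom.map_cfcₙ p _ a (hφ := continuous_starHom p), hpa]

/-- A unitary in the path component of the identity lifts: the set of liftable times is open and
closed and contains the endpoint where the path is trivial. -/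
theorem exists_quasiUnitary_lift_of_path {p : A →⋆ₙₐ[ℂ] B} (hp : Function.Surjective p)
    (x : C(unitInterval, B)) (hx : ∀ t, IsQuasiUnitary (x t)) (h1 : x 1 = 0) :
    ∃ y, IsQuasiUnitary y ∧ p y = x 0 := by
  set S : Set unitInterval := {t | ∃ y, IsQuasiUnitary y ∧ p y = x t} with hS
  -- For `t` near `s` the quotient of the unitaries at `s` and `t` is within distance one of the
  -- identity, so it lifts; multiplying by this lift or its inverse transfers a lift between the two
  -- times.
  have key : ∀ s, ∀ᶠ t in 𝓝 s, (t ∈ S ↔ s ∈ S) := by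
    intro s
    have hc : Continuous fun t => ‖qmul (star (x s)) (x t)‖ := by
      simp only [qmul]; fun_prop
    have h0 : ‖qmul (star (x s)) (x s)‖ < 1 := by
      rw [(hx s).star_qmul_self]; simp
    filter_upwards [hc.continuousAt.eventually_lt_const h0] with t ht
    obtain ⟨w, hw, hpw⟩ := exists_quasiUnitary_lift_of_norm_lt hp ((hx s).star.circ (hx t)) ht
    change p w = qmul (star (x s)) (x t) at hpw
    constructor
    · rintro ⟨y, hy, hpy⟩
      refine ⟨qmul y (star w), hy.circ hw.star, ?_⟩
      rw [map_qmul, hpy, map_star, hpw]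
      have h3 : qmul (x s) (p w) = x t := by
        rw [hpw, ← qmul_assoc, (hx s).qmul_star_self, zero_qmul]
      have h4 := (hw.map p).qmul_star_self
      rw [← hpw]
      calc qmul (x t) (star (p w)) = qmul (qmul (x s) (p w)) (star (p w)) := by rw [h3]
        _ = x s := by rw [qmul_assoc, h4, qmul_zero]
    · rintro ⟨y, hy, hpy⟩
      refine ⟨qmul y w, hy.circ hw, ?_⟩
      rw [map_qmul, hpy, hpw, ← qmul_assoc, (hx s).qmul_star_self, zero_qmul]
  have hopen : IsOpen S := isOpen_iff_mem_nhds.2 fun s hs => by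
    filter_upwards [key s] with t ht using ht.2 hs
  have hclosed : IsClosed S := ⟨isOpen_iff_mem_nhds.2 fun s hs => by
    filter_upwards [key s] with t ht using fun h => hs (ht.1 h)⟩
  have huniv := IsClopen.eq_univ ⟨hclosed, hopen⟩ ⟨1, 0, IsQuasiUnitary.zero, by rw [map_zero, h1]⟩
  have : (0 : unitInterval) ∈ S := huniv ▸ Set.mem_univ _
  exact this

/-! ### Lifting maps from a compact space that are trivial on a closed subset -/

variable {Z : Type} [TopologicalSpace Z] [CompactSpace Z] [T2Space Z]

/-- The continuous functions on `Z` that vanish on `C`. -/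
def vanishSub (A : Type u) [NonUnitalCStarAlgebra A] (C : Set Z) :
    NonUnitalStarSubalgebra ℂ C(Z, A) where
  carrier := {f | ∀ z ∈ C, f z = 0}
  add_mem' hf hg z hz := by simp [hf z hz, hg z hz]
  zero_mem' _ _ := rfl
  mul_mem' hf hg z hz := by simp [hf z hz]
  smul_mem' c f hf z hz := by simp [hf z hz]
  star_mem' hf z hz := by simp [hf z hz]

/-- The C*-algebra of continuous functions on `Z` that vanish on `C`. -/
def VanishAlg (A : Type u) [NonUnitalCStarAlgebra A] (C : Set Z) : Type u := vanishSub A C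

instance (C : Set Z) : NonUnitalCStarAlgebra (VanishAlg A C) :=
  haveI : IsClosed (vanishSub A C : Set C(Z, A)) := by
    change IsClosed {f : C(Z, A) | ∀ z ∈ C, f z = 0}
    simp only [Set.ofPred_forall]
    exact isClosed_iInter fun z => isClosed_iInter fun _ =>
      isClosed_eq (ContinuousEvalConst.continuous_eval_const z) continuous_const
  inferInstanceAs (NonUnitalCStarAlgebra (vanishSub A C))

/-- A function that vanishes on `C`, as a continuous function. -/
def VanishAlg.val {C : Set Z} (f : VanishAlg A C) : C(Z, A) := Subtype.val f

theorem VanishAlg.isometry_val {C : Set Z} :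
    Isometry (VanishAlg.val : VanishAlg A C → C(Z, A)) := Isometry.of_dist_eq fun _ _ => rfl

/-- The map induced by a star-homomorphism on the functions that vanish on `C`. -/
def vanishMap (p : A →⋆ₙₐ[ℂ] B) (C : Set Z) : VanishAlg A C →⋆ₙₐ[ℂ] VanishAlg B C where
  toFun f := ⟨⟨fun z => p (f.1 z), (continuous_starHom p).comp f.1.continuous⟩, fun z hz => by
    simp [f.2 z hz]⟩
  map_smul' c f := Subtype.ext (ContinuousMap.ext fun z => map_smul p c (f.1 z))
  map_zero' := Subtype.ext (ContinuousMap.ext fun z => map_zero p)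
  map_add' f g := Subtype.ext (ContinuousMap.ext fun z => map_add p (f.1 z) (g.1 z))
  map_mul' f g := Subtype.ext (ContinuousMap.ext fun z => map_mul p (f.1 z) (g.1 z))
  map_star' f := Subtype.ext (ContinuousMap.ext fun z => map_star p (f.1 z))

/-- The `ε`-approximate lifts of `f z` that vanish when `z ∈ C` form a convex set, and locally a
constant lies in all of them: zero near a point of `C`, where `f` is small, and a preimage of the
value elsewhere. A partition of unity glues these constants. -/
theorem vanishMap_surjective {p : A →⋆ₙₐ[ℂ] B} (hp : Function.Surjective p) {C : Set Z}
    (hC : IsClosed C) : Function.Surjective (vanishMap p C) := by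
  refine surjective_of_approx _ fun f ε hε => ?_
  have hex : ∃ F : C(Z, A), ∀ z, F z ∈ {a : A | ‖p a - f.1 z‖ < ε ∧ (z ∈ C → a = 0)} := by
    refine exists_continuous_forall_mem_convex_of_local_const (fun z => ?_) fun z => ?_
    · have h0 : IsLinearMap ℝ fun a : A => p a :=
        ⟨map_add p, fun c x => by simpa using map_smul p (c : ℂ) x⟩
      have h1 := (convex_ball (f.1 z) ε).is_linear_preimage h0
      have h2 : Convex ℝ {a : A | z ∈ C → a = 0} := by
        by_cases hz : z ∈ C
        · simp [hz]
        · simp [hz, convex_univ]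
      have h3 : {a : A | ‖p a - f.1 z‖ < ε ∧ (z ∈ C → a = 0)} =
          (fun a => p a) ⁻¹' Metric.ball (f.1 z) ε ∩ {a | z ∈ C → a = 0} := by
        ext a
        simp [dist_eq_norm]
      rw [h3]
      exact h1.inter h2
    · by_cases hz : z ∈ C
      · refine ⟨0, ?_⟩
        have hc : Continuous fun y => ‖p 0 - f.1 y‖ := by fun_prop
        have : ‖p 0 - f.1 z‖ < ε := by simpa [f.2 z hz] using hε
        filter_upwards [hc.continuousAt.eventually_lt_const this] with y hy
        exact ⟨hy, fun _ => rfl⟩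
      · obtain ⟨a, ha⟩ := hp (f.1 z)
        refine ⟨a, ?_⟩
        have hc : Continuous fun y => ‖p a - f.1 y‖ := by fun_prop
        have : ‖p a - f.1 z‖ < ε := by simpa [ha] using hε
        filter_upwards [hc.continuousAt.eventually_lt_const this, hC.isOpen_compl.mem_nhds hz]
          with y hy hy'
        exact ⟨hy, fun h => absurd h hy'⟩
  obtain ⟨F, hF⟩ := hex
  refine ⟨⟨F, fun z hz => (hF z).2 hz⟩, ?_⟩
  change ‖(vanishMap p C ⟨F, _⟩ - f).1‖ ≤ ε
  rw [ContinuousMap.norm_le _ hε.le]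
  exact fun z => (hF z).1.le

theorem vanishAlg_isQuasiUnitary_iff {C : Set Z} {g : VanishAlg A C} :
    IsQuasiUnitary g ↔ ∀ z, IsQuasiUnitary (g.1 z) := by
  constructor
  · intro h z
    have h1 : star g.1 * g.1 + g.1 + star g.1 = 0 := congrArg Subtype.val h.1
    have h2 : g.1 * star g.1 + g.1 + star g.1 = 0 := congrArg Subtype.val h.2
    exact ⟨DFunLike.congr_fun h1 z, DFunLike.congr_fun h2 z⟩
  · intro h
    exact ⟨Subtype.ext (ContinuousMap.ext fun z => (h z).1),
      Subtype.ext (ContinuousMap.ext fun z => (h z).2)⟩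

/-- A contraction of the space `Z` into the closed subset `C` that preserves `C`. -/
structure Contraction (C : Set Z) where
  closed : IsClosed C
  toMap : C(unitInterval × Z, Z)
  zero : ∀ z, toMap (0, z) = z
  one : ∀ z, toMap (1, z) ∈ C
  mem : ∀ t, ∀ z ∈ C, toMap (t, z) ∈ C

/-- The path from a function to zero given by a contraction. -/
def Contraction.path {C : Set Z} (κ : Contraction C) (f : VanishAlg A C) :
    C(unitInterval, VanishAlg A C) where
  toFun t := ⟨(f.1.comp κ.toMap).curry t, fun z hz => f.2 (κ.toMap (t, z)) (κ.mem t z hz)⟩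
  continuous_toFun := by
    refine VanishAlg.isometry_val.isEmbedding.continuous_iff.2 ?_
    exact (f.1.comp κ.toMap).curry.continuous

theorem Contraction.path_one {C : Set Z} (κ : Contraction C) (f : VanishAlg A C) :
    κ.path f 1 = 0 :=
  Subtype.ext (ContinuousMap.ext fun z => f.2 (κ.toMap (1, z)) (κ.one z))

theorem Contraction.path_zero {C : Set Z} (κ : Contraction C) (f : VanishAlg A C) :
    κ.path f 0 = f :=
  Subtype.ext (ContinuousMap.ext fun z => congrArg f.1 (κ.zero z))

/-- Composition with the contraction is a path of quasi-unitaries from `f` to zero, so the path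
criterion applies to the surjection of function algebras rather than to `p`. -/
theorem Contraction.exists_lift_vanishAlg {C : Set Z} (κ : Contraction C) {p : A →⋆ₙₐ[ℂ] B}
    (hp : Function.Surjective p) (f : VanishAlg B C) (hf : IsQuasiUnitary f) :
    ∃ F, IsQuasiUnitary F ∧ vanishMap p C F = f := by
  have h1 : ∀ t, IsQuasiUnitary (κ.path f t) := fun t =>
    vanishAlg_isQuasiUnitary_iff.2 fun z => vanishAlg_isQuasiUnitary_iff.1 hf (κ.toMap (t, z))
  have h2 := exists_quasiUnitary_lift_of_path (vanishMap_surjective hp κ.closed) (κ.path f) h1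
    (κ.path_one f)
  rwa [κ.path_zero f] at h2

theorem Contraction.exists_lift {C : Set Z} (κ : Contraction C) {p : A →⋆ₙₐ[ℂ] B}
    (hp : Function.Surjective p) (f : C(Z, B)) (hf : ∀ z, IsQuasiUnitary (f z))
    (hfC : ∀ z ∈ C, f z = 0) : ∃ F : C(Z, A), (∀ z, IsQuasiUnitary (F z)) ∧ (∀ z, p (F z) = f z) ∧
      ∀ z ∈ C, F z = 0 := by
  obtain ⟨y, hy, hpy⟩ := κ.exists_lift_vanishAlg hp ⟨f, hfC⟩ (vanishAlg_isQuasiUnitary_iff.2 hf)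
  exact ⟨y.1, vanishAlg_isQuasiUnitary_iff.1 hy,
    fun z => DFunLike.congr_fun (congrArg Subtype.val hpy) z, y.2⟩

end Lifting

/-! ### Systems of matrix units -/

/-- A system of matrix units with coefficients in `P` in the C*-algebra `Q`. -/
structure MatrixSystem (P Q : Type u) [NonUnitalCStarAlgebra P] [NonUnitalCStarAlgebra Q] where
  toFun : ℕ → ℕ → P →ₗ[ℂ] Q
  mul_same : ∀ i j l a b, toFun i j a * toFun j l b = toFun i l (a * b)
  mul_ne : ∀ i j k l a b, j ≠ k → toFun i j a * toFun k l b = 0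
  star_apply : ∀ i j a, star (toFun i j a) = toFun j i (star a)

namespace MatrixSystem

variable {P Q R : Type u} [NonUnitalCStarAlgebra P] [NonUnitalCStarAlgebra Q]
  [NonUnitalCStarAlgebra R] (S : MatrixSystem P Q)

/-- The star-homomorphism `M_n(P) → Q`. -/
def hom (n : ℕ) : MatAlg n P →⋆ₙₐ[ℂ] Q where
  toFun M := ∑ p : Fin n, ∑ q : Fin n, S.toFun p q (M.entry p q)
  map_smul' c M := by simp [Finset.smul_sum]
  map_zero' := by simp
  map_add' M N := by simp [Finset.sum_add_distrib]
  map_mul' M N := by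
    simp only [MatAlg.entry_mul, map_sum, Finset.sum_mul_sum]
    refine Finset.sum_congr rfl fun p _ => ?_
    have h : ∀ (q r s : Fin n), S.toFun p q (M.entry p q) * S.toFun r s (N.entry r s) =
        if q = r then S.toFun p s (M.entry p q * N.entry r s) else 0 := by
      intro q r s
      split_ifs with hqr
      · subst hqr
        exact S.mul_same _ _ _ _ _
      · exact S.mul_ne _ _ _ _ _ _ fun h => hqr (Fin.ext h)
    rw [Finset.sum_comm]
    refine Finset.sum_congr rfl fun r _ => ?_
    simp only [h]
    rw [Finset.sum_comm]
    simp
  map_star' M := by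
    simp only [MatAlg.entry_star, star_sum, S.star_apply]
    exact Finset.sum_comm

theorem hom_apply (n : ℕ) (M : MatAlg n P) :
    S.hom n M = ∑ p : Fin n, ∑ q : Fin n, S.toFun p q (M.entry p q) := rfl

theorem hom_unit {n i j : ℕ} (hi : i < n) (hj : j < n) (a : P) :
    S.hom n (MatAlg.unit n i j a) = S.toFun i j a := by
  rw [hom_apply, Finset.sum_eq_single ⟨i, hi⟩, Finset.sum_eq_single ⟨j, hj⟩]
  · simp [MatAlg.unit]
  · intro q _ hq
    have : (q : ℕ) ≠ j := fun h => hq (Fin.ext h)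
    simp [MatAlg.unit, this]
  · simp
  · intro p _ hp
    have : (p : ℕ) ≠ i := fun h => hp (Fin.ext h)
    simp [MatAlg.unit, this]
  · simp

/-- The star-subalgebra of finite matrices. -/
def finite : NonUnitalStarSubalgebra ℂ Q where
  -- Asking for a representative in every large size makes two elements comparable in a common size,
  -- without inclusions between matrix algebras of different sizes.
  carrier := {x | ∃ N, ∀ n, N ≤ n → ∃ M, S.hom n M = x}
  add_mem' := by
    rintro x y ⟨N, hN⟩ ⟨N', hN'⟩
    refine ⟨max N N', fun n hn => ?_⟩
    obtain ⟨M, rfl⟩ := hN n (le_of_max_le_left hn)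
    obtain ⟨M', rfl⟩ := hN' n (le_of_max_le_right hn)
    exact ⟨M + M', map_add _ _ _⟩
  zero_mem' := ⟨0, fun n _ => ⟨0, map_zero _⟩⟩
  mul_mem' := by
    rintro x y ⟨N, hN⟩ ⟨N', hN'⟩
    refine ⟨max N N', fun n hn => ?_⟩
    obtain ⟨M, rfl⟩ := hN n (le_of_max_le_left hn)
    obtain ⟨M', rfl⟩ := hN' n (le_of_max_le_right hn)
    exact ⟨M * M', map_mul _ _ _⟩
  smul_mem' := by
    rintro c x ⟨N, hN⟩
    refine ⟨N, fun n hn => ?_⟩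
    obtain ⟨M, rfl⟩ := hN n hn
    exact ⟨c • M, map_smul _ _ _⟩
  star_mem' := by
    rintro x ⟨N, hN⟩
    refine ⟨N, fun n hn => ?_⟩
    obtain ⟨M, rfl⟩ := hN n hn
    exact ⟨star M, map_star _ _⟩

theorem toFun_mem_finite (i j : ℕ) (a : P) : S.toFun i j a ∈ S.finite :=
  ⟨max i j + 1, fun n hn => ⟨MatAlg.unit n i j a, S.hom_unit (by omega) (by omega) a⟩⟩

/-- The matrix units are faithful. -/
def Faithful : Prop := ∀ i j, Function.Injective (S.toFun i j)

/-- The matrix units generate the C*-algebra `Q`. -/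
def Generates : Prop := Dense (S.finite : Set Q)

variable {S}

/-- Any matrix unit can be moved into the faithful position: `e_ij(b a c) = e_ik(b) e_kl(a)
e_lj(c)`. So if `e_kl(a) = 0`, then `b a c = 0` for all `b` and `c`, and the C*-identity gives `a =
0`. -/
theorem faithful_of_injective {i j : ℕ} (h : Function.Injective (S.toFun i j)) : S.Faithful := by
  intro k l
  rw [injective_iff_map_eq_zero]
  intro a ha
  have h1 : ∀ b c, b * a * c = 0 := by
    intro b c
    apply (injective_iff_map_eq_zero _).1 h
    rw [← S.mul_same i l j, ← S.mul_same i k l, ha]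
    simp
  have h2 := h1 (star a) (star (star a * a))
  rwa [CStarRing.mul_star_self_eq_zero_iff, CStarRing.star_mul_self_eq_zero_iff] at h2

/-- Multiplication by matrix units on both sides isolates each entry of `M`, up to factors `b` and
`c` that are then chosen as for a single matrix unit. -/
theorem Faithful.hom_injective (hS : S.Faithful) (n : ℕ) : Function.Injective (S.hom n) := by
  rw [injective_iff_map_eq_zero]
  intro M hM
  refine MatAlg.ext fun p q => ?_
  have h1 : ∀ b c, b * M.entry p q * c = 0 := by
    intro b c
    apply (injective_iff_map_eq_zero _).1 (hS 0 0)
    have h2 : S.toFun 0 p b * S.hom n M * S.toFun q 0 c = 0 := by rw [hM]; simp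
    rw [← h2, hom_apply, Finset.mul_sum, Finset.sum_mul, Finset.sum_eq_single p]
    · rw [Finset.mul_sum, Finset.sum_mul, Finset.sum_eq_single q]
      · rw [S.mul_same, S.mul_same]
      · intro r _ hr
        rw [S.mul_same, S.mul_ne]
        exact fun h => hr (Fin.ext h)
      · simp
    · intro r _ hr
      rw [Finset.mul_sum, Finset.sum_mul]
      refine Finset.sum_eq_zero fun s _ => ?_
      rw [S.mul_ne, zero_mul]
      exact fun h => hr (Fin.ext h.symm)
    · simp
  have h2 := h1 (star (M.entry p q)) (star (star (M.entry p q) * M.entry p q))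
  rwa [CStarRing.mul_star_self_eq_zero_iff, CStarRing.star_mul_self_eq_zero_iff] at h2

theorem Generates.eq_of_eqOn {D : Type*} [TopologicalSpace D] [T2Space D] (hS : S.Generates)
    {f g : Q → D} (hf : Continuous f) (hg : Continuous g)
    (h : ∀ n M, f (S.hom n M) = g (S.hom n M)) (x : Q) : f x = g x := by
  refine congrFun (Continuous.ext_on hS hf hg ?_) x
  rintro _ ⟨N, hN⟩
  obtain ⟨M, rfl⟩ := hN N le_rfl
  exact h N M

theorem Generates.exists_norm_lt (hS : S.Generates) (x : Q) {ε : ℝ} (hε : 0 < ε) :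
    ∃ n M, ‖S.hom n M - x‖ < ε := by
  obtain ⟨y, ⟨N, hN⟩, hy⟩ := Metric.mem_closure_iff.1 (hS x) ε hε
  obtain ⟨M, rfl⟩ := hN N le_rfl
  exact ⟨N, M, by rwa [dist_comm, dist_eq_norm] at hy⟩

/-! ### The universal property of faithful generating matrix units -/

section Lift

variable (S) (S' : MatrixSystem P R)

/-- Finite matrices in terms of matrix units. -/
def sum : (ℕ × ℕ →₀ P) →ₗ[ℂ] Q := Finsupp.lsum ℂ fun p => S.toFun p.1 p.2

@[simp] theorem sum_single (p : ℕ × ℕ) (a : P) :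
    S.sum (Finsupp.single p a) = S.toFun p.1 p.2 a := by simp [sum]

theorem exists_hom_eq_sum (x : ℕ × ℕ →₀ P) :
    ∃ N, ∀ n, N ≤ n → ∃ M, S.hom n M = S.sum x ∧ S'.hom n M = S'.sum x := by
  induction x using Finsupp.induction_linear with
  | zero => exact ⟨0, fun n _ => ⟨0, by simp, by simp⟩⟩
  | add x y hx hy =>
    obtain ⟨N, hN⟩ := hx
    obtain ⟨N', hN'⟩ := hy
    refine ⟨max N N', fun n hn => ?_⟩
    obtain ⟨M, h1, h2⟩ := hN n (le_of_max_le_left hn)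
    obtain ⟨M', h3, h4⟩ := hN' n (le_of_max_le_right hn)
    exact ⟨M + M', by rw [map_add, map_add, h1, h3], by rw [map_add, map_add, h2, h4]⟩
  | single p a =>
    exact ⟨max p.1 p.2 + 1, fun n hn => ⟨MatAlg.unit n p.1 p.2 a,
      by rw [S.hom_unit (by omega) (by omega), sum_single],
      by rw [S'.hom_unit (by omega) (by omega), sum_single]⟩⟩

theorem exists_sum_eq_hom (n : ℕ) (M : MatAlg n P) : ∃ x, S.sum x = S.hom n M :=
  ⟨∑ p : Fin n, ∑ q : Fin n, Finsupp.single ((p : ℕ), (q : ℕ)) (M.entry p q), by simp [hom_apply]⟩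

variable {S}

theorem Generates.denseRange_sum (hS : S.Generates) : DenseRange S.sum := by
  refine hS.mono ?_
  rintro _ ⟨N, hN⟩
  obtain ⟨M, rfl⟩ := hN N le_rfl
  exact S.exists_sum_eq_hom N M

/-- Faithful units compute the norm of the finite matrix itself, since an injective
star-homomorphism is isometric; any other system is contractive on that matrix. This bound lets the
assignment of matrix units extend by continuity. -/
theorem Faithful.norm_sum_le (hS : S.Faithful) (x : ℕ × ℕ →₀ P) : ‖S'.sum x‖ ≤ 1 * ‖S.sum x‖ := by
  obtain ⟨N, hN⟩ := exists_hom_eq_sum S S' x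
  obtain ⟨M, h1, h2⟩ := hN N le_rfl
  rw [← h1, ← h2, one_mul, NonUnitalStarAlgHom.norm_map _ (hS.hom_injective N)]
  exact NonUnitalStarAlgHom.norm_apply_le _ _

theorem extend_hom (hS : S.Faithful) (hS' : S.Generates) (n : ℕ) (M : MatAlg n P) :
    S'.sum.extendOfNorm S.sum (S.hom n M) = S'.hom n M := by
  have h : ∀ x, S'.sum.extendOfNorm S.sum (S.sum x) = S'.sum x := fun x =>
    LinearMap.extendOfNorm_eq hS'.denseRange_sum ⟨1, hS.norm_sum_le S'⟩ x
  rw [hom_apply, hom_apply, map_sum]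
  refine Finset.sum_congr rfl fun p _ => ?_
  rw [map_sum]
  refine Finset.sum_congr rfl fun q _ => ?_
  have := h (Finsupp.single ((p : ℕ), (q : ℕ)) (M.entry p q))
  simpa using this

/-- The universal property of a C*-algebra that is generated by a faithful system of matrix
units. -/
def lift (hS : S.Faithful) (hS' : S.Generates) : Q →⋆ₙₐ[ℂ] R where
  toFun := S'.sum.extendOfNorm S.sum
  map_smul' := map_smul _
  map_zero' := map_zero _
  map_add' := map_add _
  map_mul' x y := by
    have hc := (S'.sum.extendOfNorm S.sum).continuous
    have h1 : ∀ n (M : MatAlg n P) m (N : MatAlg m P), S'.sum.extendOfNorm S.sum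
        (S.hom n M * S.hom m N) = S'.hom n M * S'.hom m N := by
      intro n M m N
      obtain ⟨x, hx⟩ := S.exists_sum_eq_hom n M
      obtain ⟨y, hy⟩ := S.exists_sum_eq_hom m N
      obtain ⟨N1, h1⟩ := exists_hom_eq_sum S S' x
      obtain ⟨N2, h2⟩ := exists_hom_eq_sum S S' y
      -- Both factors are rewritten in one matrix size, where the product is computed inside a
      -- single matrix algebra.
      obtain ⟨M', h3, -⟩ := h1 (max N1 N2) (le_max_left _ _)
      obtain ⟨N', h5, -⟩ := h2 (max N1 N2) (le_max_right _ _)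
      rw [← extend_hom S' hS hS' n M, ← extend_hom S' hS hS' m N, ← hx, ← hy, ← h3, ← h5,
        ← map_mul, extend_hom S' hS hS', extend_hom S' hS hS', extend_hom S' hS hS', map_mul]
    refine hS'.eq_of_eqOn (f := fun x => S'.sum.extendOfNorm S.sum (x * y))
      (g := fun x => S'.sum.extendOfNorm S.sum x * S'.sum.extendOfNorm S.sum y)
      (by fun_prop) (by fun_prop) (fun n M => ?_) x
    refine hS'.eq_of_eqOn (f := fun y => S'.sum.extendOfNorm S.sum (S.hom n M * y))
      (g := fun y => S'.sum.extendOfNorm S.sum (S.hom n M) * S'.sum.extendOfNorm S.sum y)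
      (by fun_prop) (by fun_prop) (fun m N => ?_) y
    rw [h1, extend_hom S' hS hS', extend_hom S' hS hS']
  map_star' x := by
    have hc := (S'.sum.extendOfNorm S.sum).continuous
    refine hS'.eq_of_eqOn (f := fun x => S'.sum.extendOfNorm S.sum (star x))
      (g := fun x => star (S'.sum.extendOfNorm S.sum x))
      (by fun_prop) (by fun_prop) (fun n M => ?_) x
    rw [← map_star, extend_hom S' hS hS', extend_hom S' hS hS', map_star]

theorem lift_hom (hS : S.Faithful) (hS' : S.Generates) (n : ℕ) (M : MatAlg n P) :
    lift S' hS hS' (S.hom n M) = S'.hom n M := extend_hom S' hS hS' n M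

theorem lift_toFun (hS : S.Faithful) (hS' : S.Generates) (i j : ℕ) (a : P) :
    lift S' hS hS' (S.toFun i j a) = S'.toFun i j a := by
  rw [← S.hom_unit (n := max i j + 1) (by omega) (by omega), lift_hom,
    S'.hom_unit (by omega) (by omega)]

/-- Universal property in both directions: the two lifts are mutually inverse on finite matrices,
which are dense on either side. -/
theorem lift_bijective (hS : S.Faithful) (hS' : S.Generates) (hF : S'.Faithful)
    (hG : S'.Generates) : Function.Bijective (lift S' hS hS') := by
  refine Function.bijective_iff_has_inverse.2 ⟨lift S hF hG, fun x => ?_, fun x => ?_⟩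
  · refine hS'.eq_of_eqOn (f := fun x => lift S hF hG (lift S' hS hS' x)) (g := id)
      ((continuous_starHom _).comp (continuous_starHom _)) continuous_id (fun n M => ?_) x
    rw [lift_hom, lift_hom, id]
  · refine hG.eq_of_eqOn (f := fun x => lift S' hS hS' (lift S hF hG x)) (g := id)
      ((continuous_starHom _).comp (continuous_starHom _)) continuous_id (fun n M => ?_) x
    rw [lift_hom, lift_hom, id]

end Lift

end MatrixSystem

/-! ### The matrix units of the stabilisation -/

section StabSystem

variable {A B J : Type u} [NonUnitalCStarAlgebra A] [NonUnitalCStarAlgebra B]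
  [NonUnitalCStarAlgebra J]

theorem nullSeq_of_eventually {T : MatSeq A} (N : ℕ) (h : ∀ n, N ≤ n → T n = 0) :
    T ∈ (nullSeq A).carrier :=
  tendsto_const_nhds.congr' (by
    filter_upwards [eventually_ge_atTop N] with n hn
    rw [h n hn, norm_zero])

/-- The element `e_{ij} ⊗ a` of the stabilisation. -/
def stabUnit (i j : ℕ) (a : A) : Stab A :=
  ⟨(nullSeq A).proj (unitSeq i j a), NonUnitalStarSubalgebra.le_topologicalClosure _
    (NonUnitalStarAlgebra.subset_adjoin ℂ _ ⟨i, j, a, rfl⟩)⟩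

theorem matAlg_unit_add (n i j : ℕ) (a b : A) :
    MatAlg.unit n i j (a + b) = MatAlg.unit n i j a + MatAlg.unit n i j b := by
  ext p q
  simp only [MatAlg.unit, MatAlg.entry_of, MatAlg.entry_add]
  split_ifs <;> simp

theorem matAlg_unit_smul (n i j : ℕ) (c : ℂ) (a : A) :
    MatAlg.unit n i j (c • a) = c • MatAlg.unit n i j a := by
  ext p q
  simp [MatAlg.unit]

theorem matAlg_star_unit (n i j : ℕ) (a : A) :
    star (MatAlg.unit n i j a) = MatAlg.unit n j i (star a) := by
  ext p q
  simp only [MatAlg.unit, MatAlg.entry_of, MatAlg.entry_star, and_comm]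
  split_ifs <;> simp

theorem matAlg_unit_mul_same {n j : ℕ} (hj : j < n) (i l : ℕ) (a b : A) :
    MatAlg.unit n i j a * MatAlg.unit n j l b = MatAlg.unit n i l (a * b) := by
  ext p q
  simp only [MatAlg.unit, MatAlg.entry_of, MatAlg.entry_mul]
  rw [Finset.sum_eq_single ⟨j, hj⟩]
  · by_cases h1 : (p : ℕ) = i <;> by_cases h2 : (q : ℕ) = l <;> simp [h1, h2]
  · intro r _ hr
    have : (r : ℕ) ≠ j := fun h => hr (Fin.ext h)
    simp [this]
  · simp

theorem matAlg_unit_mul_ne {j k : ℕ} (h : j ≠ k) (n i l : ℕ) (a b : A) :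
    MatAlg.unit n i j a * MatAlg.unit n k l b = 0 := by
  ext p q
  simp only [MatAlg.unit, MatAlg.entry_of, MatAlg.entry_mul, MatAlg.entry_zero]
  refine Finset.sum_eq_zero fun r _ => ?_
  by_cases h1 : (r : ℕ) = j
  · have : (r : ℕ) ≠ k := fun h' => h (h1.symm.trans h')
    simp [this]
  · simp [h1]

variable (A) in
/-- The system of matrix units of the stabilisation. -/
def stabSystem : MatrixSystem A (Stab A) where
  toFun i j :=
    { toFun := stabUnit i j
      map_add' := fun a b => Subtype.ext (congrArg (nullSeq A).proj (by
        ext n : 2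
        exact matAlg_unit_add n i j a b))
      map_smul' := fun c a => Subtype.ext (congrArg (nullSeq A).proj (by
        ext n : 2
        exact matAlg_unit_smul n i j c a)) }
  mul_same i j l a b := by
    refine Subtype.ext (((nullSeq A).proj_eq_iff (a := unitSeq i j a * unitSeq j l b)
      (b := unitSeq i l (a * b))).2 (nullSeq_of_eventually (j + 1) fun n hn => ?_))
    change MatAlg.unit n i j a * MatAlg.unit n j l b - MatAlg.unit n i l (a * b) = 0
    rw [matAlg_unit_mul_same (by omega), sub_self]
  mul_ne i j k l a b h := by
    refine Subtype.ext (congrArg (nullSeq A).proj (a₁ := unitSeq i j a * unitSeq k l b)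
      (a₂ := 0) ?_)
    ext n : 2
    exact matAlg_unit_mul_ne h n i l a b
  star_apply i j a := by
    refine Subtype.ext (congrArg (nullSeq A).proj (a₁ := star (unitSeq i j a)) ?_)
    ext n : 2
    exact matAlg_star_unit n i j a

theorem stabSystem_toFun (i j : ℕ) (a : A) : (stabSystem A).toFun i j a = stabUnit i j a := rfl

/-- It suffices to treat the corner `e_00`. For `n ≥ 1` its embedding into `M_n(A)` is isometric, so
if the sequence is null, then the constant `‖a‖` tends to zero. -/
theorem stabSystem_faithful : (stabSystem A).Faithful := by
  refine MatrixSystem.faithful_of_injective (i := 0) (j := 0) ?_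
  rw [injective_iff_map_eq_zero]
  intro a ha
  have h1 : (nullSeq A).proj (unitSeq 0 0 a) = (nullSeq A).proj 0 := congrArg Subtype.val ha
  rw [(nullSeq A).proj_eq_iff, sub_zero] at h1
  have h2 : Tendsto (fun n => ‖MatAlg.unit n 0 0 a‖) atTop (𝓝 0) := h1
  have h3 : Tendsto (fun _ : ℕ => ‖a‖) atTop (𝓝 0) := by
    refine h2.congr' ?_
    filter_upwards [eventually_ge_atTop 1] with n hn
    refine NonUnitalStarAlgHom.norm_map (MatAlg.diagHom (A := A) n 0) (fun b c hbc => ?_) a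
    have := congrArg (fun M => MatAlg.entry M ⟨0, hn⟩ ⟨0, hn⟩) hbc
    simpa [MatAlg.diagHom, MatAlg.unit] using this
  exact norm_eq_zero.1 (tendsto_nhds_unique tendsto_const_nhds h3)

/-- The inclusion of the stabilisation into `∏ₙ Mₙ(A) / ⨁ₙ Mₙ(A)`. -/
def stabIncl (A : Type u) [NonUnitalCStarAlgebra A] : Stab A →⋆ₙₐ[ℂ] (nullSeq A).Quo :=
  NonUnitalStarSubalgebraClass.subtype (stabSubalgebra A)

theorem stabSystem_generates : (stabSystem A).Generates := by
  have h : NonUnitalStarAlgebra.adjoin ℂ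
      {x | ∃ (i j : ℕ) (a : A), x = (nullSeq A).proj (unitSeq i j a)} ≤
      (stabSystem A).finite.map (stabIncl A) := by
    refine NonUnitalStarAlgebra.adjoin_le ?_
    rintro _ ⟨i, j, a, rfl⟩
    exact ⟨stabUnit i j a, (stabSystem A).toFun_mem_finite i j a, rfl⟩
  intro x
  rw [Metric.mem_closure_iff]
  intro ε hε
  obtain ⟨y, hy, hd⟩ := Metric.mem_closure_iff.1 (show x.1 ∈ closure _ from x.2) ε hε
  obtain ⟨z, hz, rfl⟩ := h hy
  exact ⟨z, hz, hd⟩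

theorem stabMap_stabUnit (φ : A →⋆ₙₐ[ℂ] B) (i j : ℕ) (a : A) :
    stabMap φ (stabUnit i j a) = stabUnit i j (φ a) := by
  refine Subtype.ext (congrArg (nullSeq B).proj ?_)
  ext n : 2
  exact MatAlg.map_unit φ n i j a

theorem stabMap_hom (φ : A →⋆ₙₐ[ℂ] B) (n : ℕ) (M : MatAlg n A) :
    stabMap φ ((stabSystem A).hom n M) = (stabSystem B).hom n (MatAlg.map n φ M) := by
  simp only [MatrixSystem.hom_apply, map_sum, stabSystem_toFun, stabMap_stabUnit, MatAlg.entry_map]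

end StabSystem

/-! ### Exactness of the stabilisation -/

section Exact

variable {A B J : Type u} [NonUnitalCStarAlgebra A] [NonUnitalCStarAlgebra B]
  [NonUnitalCStarAlgebra J]

theorem matAlg_map_injective {φ : A →⋆ₙₐ[ℂ] B} (h : Function.Injective φ) (n : ℕ) :
    Function.Injective (MatAlg.map n φ) := fun _ _ hMN => MatAlg.ext fun p q =>
  h (congrArg (fun K => MatAlg.entry K p q) hMN)

theorem matAlg_map_surjective {φ : A →⋆ₙₐ[ℂ] B} (h : Function.Surjective φ) (n : ℕ) :
    Function.Surjective (MatAlg.map n φ) := by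
  intro M
  choose f hf using h
  exact ⟨MatAlg.of fun p q => f (M.entry p q), MatAlg.ext fun p q => hf _⟩

theorem IsShortExact.matAlg_map {ι : J →⋆ₙₐ[ℂ] A} {π : A →⋆ₙₐ[ℂ] B} (h : IsShortExact ι π)
    (n : ℕ) : IsShortExact (MatAlg.map n ι) (MatAlg.map n π) := by
  refine ⟨matAlg_map_injective h.1 n, matAlg_map_surjective h.2.1 n, fun M => ⟨fun hM => ?_, ?_⟩⟩
  · have h1 : ∀ p q, ∃ a, ι a = M.entry p q := fun p q =>
      (h.2.2 _).1 (congrArg (fun K => MatAlg.entry K p q) hM)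
    choose f hf using h1
    exact ⟨MatAlg.of f, MatAlg.ext hf⟩
  · rintro ⟨N, rfl⟩
    exact MatAlg.ext fun p q => (h.2.2 _).2 ⟨_, rfl⟩

/-- The map is isometric on the dense set of finite matrices, because entrywise application of an
injective star-homomorphism is. -/
theorem stabMap_injective {φ : A →⋆ₙₐ[ℂ] B} (h : Function.Injective φ) :
    Function.Injective (stabMap φ) := by
  have h1 : ∀ x, ‖stabMap φ x‖ = ‖x‖ := by
    refine stabSystem_generates.eq_of_eqOn (continuous_starHom _).norm continuous_norm
      fun n M => ?_
    rw [stabMap_hom, NonUnitalStarAlgHom.norm_map _ (stabSystem_faithful.hom_injective n),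
      NonUnitalStarAlgHom.norm_map _ (stabSystem_faithful.hom_injective n),
      NonUnitalStarAlgHom.norm_map _ (matAlg_map_injective h n)]
  rw [injective_iff_map_eq_zero]
  intro x hx
  rw [← norm_eq_zero, ← h1, hx, norm_zero]

theorem stabMap_surjective {φ : A →⋆ₙₐ[ℂ] B} (h : Function.Surjective φ) :
    Function.Surjective (stabMap φ) := by
  refine surjective_of_approx _ fun x ε hε => ?_
  obtain ⟨n, M, hM⟩ := stabSystem_generates.exists_norm_lt x hε
  obtain ⟨N, rfl⟩ := matAlg_map_surjective h n M
  exact ⟨(stabSystem A).hom n N, by rw [stabMap_hom]; exact hM.le⟩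

/-- Exactness in the middle: an element of the kernel is close to a finite matrix whose image is
small. Subtracting a small lift of that image leaves a matrix with entries in `J`, and the range of
the first map is closed. -/
theorem IsShortExact.stabMap {ι : J →⋆ₙₐ[ℂ] A} {π : A →⋆ₙₐ[ℂ] B} (h : IsShortExact ι π) :
    IsShortExact (stabMap ι) (stabMap π) := by
  refine ⟨stabMap_injective h.1, stabMap_surjective h.2.1, fun x => ⟨fun hx => ?_, ?_⟩⟩
  · rw [← (isClosed_range_starHom (HigsonRoe.stabMap ι)).closure_eq, Metric.mem_closure_iff]
    intro ε hε
    obtain ⟨n, M, hM⟩ := stabSystem_generates.exists_norm_lt x (show 0 < ε / 3 by positivity)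
    have h1 : ‖MatAlg.map n π M‖ < ε / 3 := by
      rw [← NonUnitalStarAlgHom.norm_map _ (stabSystem_faithful.hom_injective n), ← stabMap_hom,
        ← sub_zero (HigsonRoe.stabMap π _), ← hx, ← map_sub]
      exact (NonUnitalStarAlgHom.norm_apply_le _ _).trans_lt hM
    -- The lift has norm below `2ε/3`; with the error `ε/3` of the first approximation the total is
    -- below `ε`.
    obtain ⟨N, hN, hN'⟩ := exists_lift_norm_lt (h.matAlg_map n).2.1 (MatAlg.map n π M)
      (show 0 < ε / 3 by positivity)
    obtain ⟨L, hL⟩ := ((h.matAlg_map n).2.2 (M - N)).1 (by rw [map_sub, hN, sub_self])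
    refine ⟨_, ⟨(stabSystem J).hom n L, rfl⟩, ?_⟩
    rw [stabMap_hom, hL, dist_comm, dist_eq_norm, map_sub, sub_right_comm]
    have h2 : ‖(stabSystem A).hom n N‖ ≤ ‖N‖ := NonUnitalStarAlgHom.norm_apply_le _ _
    linarith [norm_sub_le ((stabSystem A).hom n M - x) ((stabSystem A).hom n N)]
  · rintro ⟨y, rfl⟩
    have := stabSystem_generates.eq_of_eqOn (f := fun y => HigsonRoe.stabMap π (HigsonRoe.stabMap ι y))
      (g := fun _ => 0) ((continuous_starHom _).comp (continuous_starHom _)) continuous_const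
      (fun n M => ?_) y
    · exact this
    · simp only [stabMap_hom]
      rw [((h.matAlg_map n).2.2 _).2 ⟨M, rfl⟩, map_zero]

end Exact

/-- A levelwise short exact sequence of towers such that the maps in the tower `J` are surjective
from some index on. -/
structure IsExactSeq {J A B : Tower.{u}} (ι : TowerHom J A) (π : TowerHom A B) (k₀ : ℕ) : Prop where
  exact : ∀ n, IsShortExact (ι.app n) (π.app n)
  surjective : ∀ n, k₀ ≤ n → Function.Surjective (J.map n)

theorem IsExactSeq.stage {J A B : Tower.{u}} {ι : TowerHom J A} {π : TowerHom A B} {k₀ : ℕ}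
    (h : IsExactSeq ι π k₀) : ∀ k, IsExactSeq (ι.stage k) (π.stage k) k₀
  | 0 => ⟨fun n => (h.exact n).stabMap, fun n hn => stabMap_surjective (h.surjective n hn)⟩
  | k + 1 => ⟨fun n => ((h.stage k).exact n).matAlg_map 2,
      fun n hn => matAlg_map_surjective ((h.stage k).surjective n hn) 2⟩

/-! ### Lifting maps to unitaries over towers -/

/-- The tower without its bottom algebra. -/
def Tower.shift (T : Tower.{u}) : Tower.{u} where
  obj n := T.obj (n + 1)
  map n := T.map (n + 1)

def TowerHom.shift {S T : Tower.{u}} (φ : TowerHom S T) : TowerHom S.shift T.shift where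
  app n := φ.app (n + 1)
  comm n := φ.comm (n + 1)

namespace Tower

variable {T : Tower.{u}}

theorem Unitaries.ext {x y : T.Unitaries} (h : ∀ n, x.1 n = y.1 n) : x = y :=
  Subtype.ext (funext h)

theorem continuous_unitaries_iff {Z : Type*} [TopologicalSpace Z] {f : Z → T.Unitaries} :
    Continuous f ↔ ∀ n, Continuous fun z => (f z).1 n := by
  rw [continuous_induced_rng, continuous_pi_iff]
  rfl

/-- Multiplication of unitaries. -/
def mul (x y : T.Unitaries) : T.Unitaries :=
  ⟨fun n => qmul (x.1 n) (y.1 n), fun n => by rw [map_qmul, x.2.1, y.2.1],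
    fun n => (x.2.2 n).circ (y.2.2 n)⟩

/-- The inverse of a unitary. -/
def inv (x : T.Unitaries) : T.Unitaries :=
  ⟨fun n => star (x.1 n), fun n => by rw [map_star, x.2.1], fun n => (x.2.2 n).star⟩

theorem mul_inv_mul (x y : T.Unitaries) : mul x (mul (inv x) y) = y :=
  Unitaries.ext fun n => by
    change qmul (x.1 n) (qmul (star (x.1 n)) (y.1 n)) = y.1 n
    rw [← qmul_assoc, (x.2.2 n).qmul_star_self, zero_qmul]

theorem inv_mul_self (x : T.Unitaries) : mul (inv x) x = T.base :=
  Unitaries.ext fun n => (x.2.2 n).star_qmul_self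

theorem mul_base (x : T.Unitaries) : mul x T.base = x := Unitaries.ext fun _ => qmul_zero _

theorem continuous_mul {Z : Type*} [TopologicalSpace Z] {f g : Z → T.Unitaries}
    (hf : Continuous f) (hg : Continuous g) : Continuous fun z => mul (f z) (g z) := by
  rw [continuous_unitaries_iff] at hf hg ⊢
  exact fun n => ((hf n).add (hg n)).add ((hf n).mul (hg n))

theorem continuous_inv {Z : Type*} [TopologicalSpace Z] {f : Z → T.Unitaries}
    (hf : Continuous f) : Continuous fun z => inv (f z) := by
  rw [continuous_unitaries_iff] at hf ⊢
  exact fun n => (hf n).star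

end Tower

/-- The unitaries over an inverse limit do not depend on the bottom algebra. -/
def Tower.shiftHomeo (T : Tower.{u}) : T.Unitaries ≃ₜ T.shift.Unitaries where
  toFun x := ⟨fun n => x.1 (n + 1), fun n => x.2.1 (n + 1), fun n => x.2.2 (n + 1)⟩
  invFun y := ⟨fun n => match n with
      | 0 => T.map 0 (y.1 0)
      | n + 1 => y.1 n, fun n => match n with
      | 0 => rfl
      | n + 1 => y.2.1 n, fun n => match n with
      | 0 => (y.2.2 0).map (T.map 0)
      | n + 1 => y.2.2 n⟩
  left_inv x := Subtype.ext (funext fun n => match n with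
      | 0 => x.2.1 0
      | _ + 1 => rfl)
  right_inv _ := rfl
  continuous_toFun := Tower.continuous_unitaries_iff.2 fun n =>
    Tower.continuous_unitaries_iff.1 continuous_id (n + 1)
  continuous_invFun := Tower.continuous_unitaries_iff.2 fun n => match n with
      | 0 => (continuous_starHom (T.map 0)).comp
          (Tower.continuous_unitaries_iff.1 continuous_id 0)
      | n + 1 => Tower.continuous_unitaries_iff.1 continuous_id n

theorem TowerHom.unitaries_mul {S T : Tower.{u}} (φ : TowerHom S T) (x y : S.Unitaries) :
    φ.unitaries (Tower.mul x y) = Tower.mul (φ.unitaries x) (φ.unitaries y) :=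
  Tower.Unitaries.ext fun n => map_qmul (φ.app n) _ _

theorem TowerHom.unitaries_inv {S T : Tower.{u}} (φ : TowerHom S T) (x : S.Unitaries) :
    φ.unitaries (Tower.inv x) = Tower.inv (φ.unitaries x) :=
  Tower.Unitaries.ext fun n => map_star (φ.app n) _

section LiftTower

variable {Z : Type} [TopologicalSpace Z] [CompactSpace Z] [T2Space Z]

/-- Pointwise preimages are unique, and they depend continuously on the point because the injection
is isometric. -/
theorem IsShortExact.exists_factor {Z : Type*} [TopologicalSpace Z]
    {J A B : Type u} [NonUnitalCStarAlgebra J] [NonUnitalCStarAlgebra A]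
    [NonUnitalCStarAlgebra B] {ι : J →⋆ₙₐ[ℂ] A} {π : A →⋆ₙₐ[ℂ] B} (h : IsShortExact ι π)
    {w : Z → A} (hw : Continuous w) (h0 : ∀ z, π (w z) = 0) :
    ∃ g : C(Z, J), ∀ z, ι (g z) = w z := by
  choose g hg using fun z => (h.2.2 (w z)).1 (h0 z)
  refine ⟨⟨g, ?_⟩, hg⟩
  rw [(NonUnitalStarAlgHom.isometry ι h.1).isEmbedding.continuous_iff]
  exact hw.congr fun z => (hg z).symm

theorem IsExactSeq.exists_factor {Z : Type*} [TopologicalSpace Z]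
    {J A B : Tower.{u}} {ι : TowerHom J A} {π : TowerHom A B}
    {k₀ : ℕ} (h : IsExactSeq ι π k₀) (F : C(Z, A.Unitaries))
    (hF : ∀ z, π.unitaries (F z) = B.base) : ∃ g : C(Z, J.Unitaries), ∀ z,
      ι.unitaries (g z) = F z := by
  have h1 : ∀ n, ∃ g : C(Z, (J.obj n).carrier), ∀ z, ι.app n (g z) = (F z).1 n := fun n =>
    (h.exact n).exists_factor (Tower.continuous_unitaries_iff.1 F.continuous n)
      fun z => congrArg (fun x => x.1 n) (hF z)
  choose g hg using h1
  refine ⟨⟨fun z => ⟨fun n => g n z, fun n => (h.exact n).1 ?_, fun n => ?_⟩, ?_⟩,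
    fun z => Tower.Unitaries.ext fun n => hg n z⟩
  · rw [ι.comm, hg, hg, (F z).2.1]
  · refine IsQuasiUnitary.of_map (ι.app n) (h.exact n).1 ?_
    rw [hg]
    exact (F z).2.2 n
  · rw [Tower.continuous_unitaries_iff]
    exact fun n => (g n).continuous

theorem IsExactSeq.unitaries_injective {J A B : Tower.{u}} {ι : TowerHom J A} {π : TowerHom A B}
    {k₀ : ℕ} (h : IsExactSeq ι π k₀) : Function.Injective ι.unitaries := fun _ _ hxy =>
  Tower.Unitaries.ext fun n => (h.exact n).1 (congrArg (fun z => z.1 n) hxy)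

theorem IsExactSeq.comp_eq_base {J A B : Tower.{u}} {ι : TowerHom J A} {π : TowerHom A B}
    {k₀ : ℕ} (h : IsExactSeq ι π k₀) (x : J.Unitaries) :
    π.unitaries (ι.unitaries x) = B.base :=
  Tower.Unitaries.ext fun n => ((h.exact n).2.2 _).2 ⟨x.1 n, rfl⟩

/-- A lift to the `n`-th algebra of a tower of a map that vanishes on `C`. -/
def LevelLift {A B : Tower.{u}} (π : TowerHom A B) (C : Set Z) (f : C(Z, B.Unitaries))
    (n : ℕ) : Type u :=
  {F : C(Z, (A.obj n).carrier) // (∀ z, IsQuasiUnitary (F z)) ∧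
    (∀ z, π.app n (F z) = (f z).1 n) ∧ ∀ z ∈ C, F z = 0}

theorem Contraction.exists_levelLift {C : Set Z} (κ : Contraction C) {A B : Tower.{u}}
    {π : TowerHom A B} {n : ℕ} (h : Function.Surjective (π.app n)) (f : C(Z, B.Unitaries))
    (hf : ∀ z ∈ C, f z = B.base) : Nonempty (LevelLift π C f n) := by
  obtain ⟨F, h1, h2, h3⟩ := κ.exists_lift h
    ⟨fun z => (f z).1 n, Tower.continuous_unitaries_iff.1 f.continuous n⟩ (fun z => (f z).2.2 n)
    fun z hz => congrArg (fun x => x.1 n) (hf z hz)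
  exact ⟨F, h1, h2, h3⟩

/-- Mittag-Leffler correction. An arbitrary lift at level `n + 1`, pushed down, differs from the
given lift at level `n` by a unitary that is trivial over `B`, hence comes from `J` at level `n`.
Surjectivity of the transition map of `J` lifts this discrepancy to level `n + 1`, where it is
multiplied in without changing the image over `B`. -/
theorem Contraction.exists_levelLift_succ {C : Set Z} (κ : Contraction C) {J A B : Tower.{u}}
    {ι : TowerHom J A} {π : TowerHom A B} (h : IsExactSeq ι π 0) (f : C(Z, B.Unitaries))
    (hf : ∀ z ∈ C, f z = B.base) (n : ℕ) (F : LevelLift π C f n) :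
    ∃ F' : LevelLift π C f (n + 1), ∀ z, A.map n (F'.1 z) = F.1 z := by
  obtain ⟨F', h1, h2, h3⟩ := κ.exists_levelLift (h.exact (n + 1)).2.1 f hf
  obtain ⟨F, h4, h5, h6⟩ := F
  have hw : Continuous fun z => qmul (star (A.map n (F' z))) (F z) := by
    have := continuous_starHom (A.map n)
    simp only [qmul]
    fun_prop
  have hπ : ∀ z, π.app n (A.map n (F' z)) = (f z).1 n := fun z => by
    rw [π.comm, h2, (f z).2.1]
  obtain ⟨g, hg⟩ := (h.exact n).exists_factor hw fun z => by
    rw [map_qmul, map_star, hπ, h5, ((f z).2.2 n).star_qmul_self]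
  obtain ⟨g', h7, h8, h9⟩ := κ.exists_lift (h.surjective n (Nat.zero_le n)) g
    (fun z => by
      refine IsQuasiUnitary.of_map (ι.app n) (h.exact n).1 ?_
      rw [hg]
      exact ((h1 z).map (A.map n)).star.circ (h4 z))
    (fun z hz => by
      refine (h.exact n).1 ?_
      rw [hg, h3 z hz, h6 z hz]
      simp)
  refine ⟨⟨⟨fun z => qmul (F' z) (ι.app (n + 1) (g' z)), ?_⟩, fun z => ?_, fun z => ?_,
    fun z hz => ?_⟩, fun z => ?_⟩
  · have := continuous_starHom (ι.app (n + 1))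
    simp only [qmul]
    fun_prop
  · exact (h1 z).circ ((h7 z).map _)
  · change π.app (n + 1) (qmul (F' z) (ι.app (n + 1) (g' z))) = _
    rw [map_qmul, ((h.exact (n + 1)).2.2 _).2 ⟨g' z, rfl⟩, qmul_zero, h2]
  · change qmul (F' z) (ι.app (n + 1) (g' z)) = 0
    rw [h3 z hz, h9 z hz]
    simp
  · change A.map n (qmul (F' z) (ι.app (n + 1) (g' z))) = _
    rw [map_qmul, ← ι.comm, h8, hg, ← qmul_assoc, ((h1 z).map (A.map n)).qmul_star_self, zero_qmul]

theorem IsExactSeq.shift {J A B : Tower.{u}} {ι : TowerHom J A} {π : TowerHom A B} {k₀ : ℕ}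
    (h : IsExactSeq ι π (k₀ + 1)) : IsExactSeq ι.shift π.shift k₀ :=
  ⟨fun n => h.exact (n + 1), fun n hn => h.surjective (n + 1) (by omega)⟩

/-- Compatible lifts are built level by level. If the transition maps of `J` are surjective only
from `k₀` on, the bottom algebras are dropped one at a time, which leaves the spaces of unitaries
unchanged up to homeomorphism. -/
theorem Contraction.exists_lift_tower_base {C : Set Z} (κ : Contraction C) {k₀ : ℕ} :
    ∀ {J A B : Tower.{u}} {ι : TowerHom J A} {π : TowerHom A B}, IsExactSeq ι π k₀ →
    ∀ f : C(Z, B.Unitaries), (∀ z ∈ C, f z = B.base) →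
    ∃ F : C(Z, A.Unitaries), (∀ z, π.unitaries (F z) = f z) ∧ ∀ z ∈ C, F z = A.base := by
  induction k₀ with
  | zero =>
    intro J A B ι π h f hf
    choose s hs using κ.exists_levelLift_succ h f hf
    let F : ∀ n, LevelLift π C f n := fun n =>
      Nat.rec (κ.exists_levelLift (h.exact 0).2.1 f hf).some s n
    refine ⟨⟨fun z => ⟨fun n => (F n).1 z, fun n => hs n (F n) z, fun n => (F n).2.1 z⟩, ?_⟩,
      fun z => Tower.Unitaries.ext fun n => (F n).2.2.1 z,
      fun z hz => Tower.Unitaries.ext fun n => (F n).2.2.2 z hz⟩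
    exact Tower.continuous_unitaries_iff.2 fun n => (F n).1.continuous
  | succ k₀ ih =>
    intro J A B ι π h f hf
    obtain ⟨F, h1, h2⟩ := ih h.shift ⟨fun z => B.shiftHomeo (f z), by fun_prop⟩ fun z hz => by
      change B.shiftHomeo (f z) = _
      rw [hf z hz]
      rfl
    refine ⟨⟨fun z => A.shiftHomeo.symm (F z), by fun_prop⟩, fun z => ?_, fun z hz => ?_⟩
    · refine B.shiftHomeo.injective ?_
      exact h1 z
    · refine A.shiftHomeo.injective ?_
      exact h2 z hz

/-- A lift can be prescribed on `C`. -/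
theorem Contraction.exists_lift_tower {C : Set Z} (κ : Contraction C) {k₀ : ℕ}
    {J A B : Tower.{u}} {ι : TowerHom J A} {π : TowerHom A B} (h : IsExactSeq ι π k₀)
    (f : C(Z, B.Unitaries)) (l : C(Z, A.Unitaries)) (hl : ∀ z ∈ C, π.unitaries (l z) = f z) :
    ∃ F : C(Z, A.Unitaries), (∀ z, π.unitaries (F z) = f z) ∧ ∀ z ∈ C, F z = l z := by
  -- Dividing `f` by the image of `l` makes it trivial on `C`; the resulting lift is multiplied by
  -- `l` afterwards.
  obtain ⟨F, h1, h2⟩ := κ.exists_lift_tower_base h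
    ⟨fun z => Tower.mul (Tower.inv (π.unitaries (l z))) (f z), Tower.continuous_mul
      (Tower.continuous_inv (by fun_prop)) (by fun_prop)⟩ fun z hz => by
      change Tower.mul (Tower.inv (π.unitaries (l z))) (f z) = _
      rw [hl z hz, Tower.inv_mul_self]
  refine ⟨⟨fun z => Tower.mul (l z) (F z), Tower.continuous_mul (by fun_prop) (by fun_prop)⟩,
    fun z => ?_, fun z hz => ?_⟩
  · change π.unitaries (Tower.mul (l z) (F z)) = f z
    rw [TowerHom.unitaries_mul, h1]
    exact Tower.mul_inv_mul _ _
  · change Tower.mul (l z) (F z) = l z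
    rw [h2 z hz, Tower.mul_base]

end LiftTower

/-! ### Loops of unitaries -/

section Loops

theorem homotopic_of_map {d : ℕ} {X : Type*} [TopologicalSpace X] {x : X}
    {f g : GenLoop (Fin d) X x} (K : C(unitInterval × (Fin d → unitInterval), X))
    (h0 : ∀ w, K (0, w) = f w) (h1 : ∀ w, K (1, w) = g w)
    (hb : ∀ s, ∀ w ∈ Cube.boundary (Fin d), K (s, w) = x) : GenLoop.Homotopic f g :=
  ⟨{ K with
      map_zero_left := h0
      map_one_left := h1
      prop' := fun s w hw => (hb s w hw).trans (f.2 w hw).symm }⟩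

theorem exists_map_of_homotopic {d : ℕ} {X : Type*} [TopologicalSpace X] {x : X}
    {f g : GenLoop (Fin d) X x} (h : GenLoop.Homotopic f g) :
    ∃ K : C(unitInterval × (Fin d → unitInterval), X), (∀ w, K (0, w) = f w) ∧
      (∀ w, K (1, w) = g w) ∧ ∀ s, ∀ w ∈ Cube.boundary (Fin d), K (s, w) = x := by
  obtain ⟨H⟩ := h
  exact ⟨H.toContinuousMap, H.map_zero_left, H.map_one_left,
    fun s w hw => (H.prop' s w hw).trans (f.2 w hw)⟩

variable {T : Tower.{u}} {d : ℕ}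

/-- The pointwise product of loops of unitaries. -/
def loopMul (f g : GenLoop (Fin d) T.Unitaries T.base) : GenLoop (Fin d) T.Unitaries T.base :=
  ⟨⟨fun z => Tower.mul (f z) (g z), Tower.continuous_mul f.1.continuous g.1.continuous⟩,
    fun z hz => by
      exact (congrArg₂ Tower.mul (f.2 z hz) (g.2 z hz)).trans (Tower.mul_base _)⟩

/-- The pointwise inverse of a loop of unitaries. -/
def loopInv (f : GenLoop (Fin d) T.Unitaries T.base) : GenLoop (Fin d) T.Unitaries T.base :=
  ⟨⟨fun z => Tower.inv (f z), Tower.continuous_inv f.1.continuous⟩,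
    fun z hz => by
      exact (congrArg Tower.inv (f.2 z hz)).trans
        (Tower.Unitaries.ext fun n => star_zero _)⟩

theorem loopMul_homotopic {f f' g g' : GenLoop (Fin d) T.Unitaries T.base}
    (h : GenLoop.Homotopic f f') (h' : GenLoop.Homotopic g g') :
    GenLoop.Homotopic (loopMul f g) (loopMul f' g') := by
  obtain ⟨K, h1, h2, h3⟩ := exists_map_of_homotopic h
  obtain ⟨K', h1', h2', h3'⟩ := exists_map_of_homotopic h'
  refine homotopic_of_map ⟨fun z => Tower.mul (K z) (K' z),
    Tower.continuous_mul K.continuous K'.continuous⟩ (fun w => ?_) (fun w => ?_) fun s w hw => ?_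
  · exact congrArg₂ Tower.mul (h1 w) (h1' w)
  · exact congrArg₂ Tower.mul (h2 w) (h2' w)
  · exact (congrArg₂ Tower.mul (h3 s w hw) (h3' s w hw)).trans (Tower.mul_base _)

/-- The class of a loop in the homotopy group. -/
abbrev loopClass {d : ℕ} (f : GenLoop (Fin d) T.Unitaries T.base) :
    HomotopyGroup (Fin d) T.Unitaries T.base := Quotient.mk _ f

/-- Eckmann–Hilton: the concatenation of `f` and `g` is exactly the pointwise product of `f`
followed by a constant and a constant followed by `g`, and these factors are homotopic to `f` and
`g`. -/
theorem homotopyGroup_mul_eq (f g : GenLoop (Fin (d + 1)) T.Unitaries T.base) :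
    loopClass f * loopClass g = loopClass (loopMul f g) := by
  have h1 : loopClass f * loopClass GenLoop.const = loopClass f := mul_one _
  have h2 : loopClass GenLoop.const * loopClass g = loopClass g := one_mul _
  have h3 := (HomotopyGroup.mul_spec (i := 0) (p := f) (q := GenLoop.const)).symm.trans h1
  have h4 := (HomotopyGroup.mul_spec (i := 0) (p := GenLoop.const) (q := g)).symm.trans h2
  refine (HomotopyGroup.mul_spec (i := 0) (p := f) (q := g)).trans ?_
  refine Eq.trans ?_ (Quotient.sound (loopMul_homotopic (Quotient.exact h3) (Quotient.exact h4)))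
  refine congrArg (Quotient.mk _) (GenLoop.ext _ _ fun t => ?_)
  change GenLoop.transAt 0 g f t = Tower.mul (GenLoop.transAt 0 GenLoop.const f t)
    (GenLoop.transAt 0 g GenLoop.const t)
  simp only [GenLoop.transAt, GenLoop.coe_copy]
  split_ifs
  · exact Tower.Unitaries.ext fun n => (zero_qmul _).symm
  · exact Tower.Unitaries.ext fun n => (qmul_zero _).symm

theorem homotopyGroup_inv_eq (f : GenLoop (Fin (d + 1)) T.Unitaries T.base) :
    (loopClass f)⁻¹ = loopClass (loopInv f) := by
  refine inv_eq_of_mul_eq_one_left ?_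
  rw [homotopyGroup_mul_eq]
  exact congrArg (Quotient.mk _) (GenLoop.ext _ _ fun t => Tower.inv_mul_self (f t))

/-- The Bott map as a map on unitaries with parameters. -/
def bottPt (T : Tower.{u}) (x : T.Unitaries) (s t : unitInterval) : T.mat2.Unitaries :=
  ⟨fun n => bottElt (x.1 n) s t, fun n => (map_bottElt (T.map n) _ _ _).trans
    (congrArg (fun x => bottElt x _ _) (x.2.1 n)), fun n => bottElt_quasiUnitary (x.2.2 n) _ _⟩

theorem continuous_bottPt {Z : Type*} [TopologicalSpace Z] {x : Z → T.Unitaries}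
    {s t : Z → unitInterval} (hx : Continuous x) (hs : Continuous s) (ht : Continuous t) :
    Continuous fun z => bottPt T (x z) (s z) (t z) :=
  Tower.continuous_unitaries_iff.2 fun n =>
    continuous_bottElt (Tower.continuous_unitaries_iff.1 hx n) (by fun_prop) (by fun_prop)

theorem bottPt_base (s t : unitInterval) : bottPt T T.base s t = T.mat2.base :=
  Tower.Unitaries.ext fun _ => bottElt_zero _ _

theorem bottPt_edge (x : T.Unitaries) {s t : unitInterval}
    (h : (s = 0 ∨ s = 1) ∨ (t = 0 ∨ t = 1)) : bottPt T x s t = T.mat2.base :=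
  Tower.Unitaries.ext fun n => bottElt_edge (x.2.2 n)
    (h.imp (Or.imp (congrArg Subtype.val) (congrArg Subtype.val))
      (Or.imp (congrArg Subtype.val) (congrArg Subtype.val)))

theorem bottPt_map {S : Tower.{u}} (φ : TowerHom T S) (x : T.Unitaries) (s t : unitInterval) :
    φ.mat2.unitaries (bottPt T x s t) = bottPt S (φ.unitaries x) s t :=
  Tower.Unitaries.ext fun n => map_bottElt (φ.app n) _ _ _

theorem bott_apply (f : GenLoop (Fin d) T.Unitaries T.base) (z : Fin (d + 2) → unitInterval) :
    bott T f z = bottPt T (f fun i => z (i.castAdd 2)) (z (Fin.natAdd d 0)) (z (Fin.natAdd d 1)) :=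
  rfl

theorem bottPt_boundary {x : (Fin d → unitInterval) → T.Unitaries}
    (hx : ∀ z ∈ Cube.boundary (Fin d), x z = T.base) {z : Fin (d + 2) → unitInterval}
    (hz : z ∈ Cube.boundary (Fin (d + 2))) :
    bottPt T (x fun i => z (i.castAdd 2)) (z (Fin.natAdd d 0)) (z (Fin.natAdd d 1)) =
      T.mat2.base := by
  obtain ⟨i, hi⟩ := hz
  induction i using Fin.addCases with
  | left i => rw [hx (fun i => z (i.castAdd 2)) ⟨i, hi⟩, bottPt_base]
  | right i =>
    refine bottPt_edge _ ?_
    fin_cases i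
    · exact Or.inl hi
    · exact Or.inr hi

theorem bott_homotopic {f g : GenLoop (Fin d) T.Unitaries T.base} (h : GenLoop.Homotopic f g) :
    GenLoop.Homotopic (bott T f) (bott T g) := by
  obtain ⟨K, h1, h2, h3⟩ := exists_map_of_homotopic h
  refine homotopic_of_map ⟨fun z => bottPt T (K (z.1, fun i => z.2 (i.castAdd 2)))
    (z.2 (Fin.natAdd d 0)) (z.2 (Fin.natAdd d 1)),
    continuous_bottPt (K.continuous.comp (by fun_prop)) (by fun_prop) (by fun_prop)⟩
    (fun w => ?_) (fun w => ?_) fun s w hw => ?_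
  · exact congrArg (fun x => bottPt T x _ _) (h1 _)
  · exact congrArg (fun x => bottPt T x _ _) (h2 _)
  · exact bottPt_boundary (x := fun w => K (s, w)) (h3 s) hw

/-- The Bott map on homotopy groups. -/
def bottPi (T : Tower.{u}) (d : ℕ) : HomotopyGroup (Fin (d + 1)) T.Unitaries T.base →*
    HomotopyGroup (Fin (d + 1 + 2)) T.mat2.Unitaries T.mat2.base :=
  MonoidHom.mk' (Quotient.map (bott T) fun _ _ => bott_homotopic) (by
    rintro ⟨f⟩ ⟨g⟩
    refine (congrArg _ (HomotopyGroup.mul_spec (i := 0) (p := f) (q := g))).trans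
      (Eq.trans ?_ (HomotopyGroup.mul_spec (i := 0) (p := bott T f) (q := bott T g)).symm)
    refine congrArg (Quotient.mk _) (GenLoop.ext _ _ fun z => ?_)
    rw [bott_apply]
    simp only [GenLoop.transAt, GenLoop.coe_copy]
    -- Concatenation takes place in coordinate `0`, which belongs to the loop and not to the two
    -- Bott coordinates at the end.
    have h0 : ∀ x, (fun i : Fin (d + 1) => Function.update z 0 x (i.castAdd 2)) =
        Function.update (fun i => z (i.castAdd 2)) 0 x := by
      intro x
      funext i
      by_cases hi : i = 0
      · subst hi
        have h1 := Function.update_self (0 : Fin (d + 1 + 2)) x z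
        have h2 := Function.update_self (0 : Fin (d + 1)) x fun i => z (i.castAdd 2)
        exact h1.trans h2.symm
      · have : Fin.castAdd 2 i ≠ 0 := fun h => hi (Fin.ext (by simpa using congrArg Fin.val h))
        rw [Function.update_of_ne this, Function.update_of_ne hi]
    have h1 : ∀ x (j : Fin 2), Function.update z 0 x (Fin.natAdd (d + 1) j) =
        z (Fin.natAdd (d + 1) j) := by
      intro x j
      refine Function.update_of_ne (fun h => ?_) _ _
      have := congrArg Fin.val h
      simp at this
    have h2 : z (Fin.castAdd 2 0) = z 0 := rfl
    rw [h2]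
    split_ifs <;> rw [bott_apply, h0, h1, h1])

end Loops

/-! ### Boundaries of loops -/

section Boundary

/-- The union of all faces of the cube except the face on which the first coordinate is `1`. -/
def openBox (d : ℕ) : Set (Fin (d + 1) → unitInterval) :=
  {z | z 0 = 0 ∨ ∃ i : Fin d, z i.succ = 0 ∨ z i.succ = 1}

theorem openBox_subset_boundary {d : ℕ} {z : Fin (d + 1) → unitInterval} (hz : z ∈ openBox d) :
    z ∈ Cube.boundary (Fin (d + 1)) := by
  obtain hz | ⟨i, hi⟩ := hz
  · exact ⟨0, Or.inl hz⟩
  · exact ⟨i.succ, hi⟩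

theorem cons_one_mem_boundary {d : ℕ} (w : Fin d → unitInterval) :
    (Fin.cons 1 w : Fin (d + 1) → unitInterval) ∈ Cube.boundary (Fin (d + 1)) :=
  ⟨0, Or.inr rfl⟩

theorem cons_mem_openBox {d : ℕ} {w : Fin d → unitInterval} (hw : w ∈ Cube.boundary (Fin d))
    (s : unitInterval) : (Fin.cons s w : Fin (d + 1) → unitInterval) ∈ openBox d := by
  obtain ⟨i, hi⟩ := hw
  exact Or.inr ⟨i, by simpa using hi⟩

theorem isClosed_openBox (d : ℕ) : IsClosed (openBox d) := by
  have : openBox d = {z | z 0 = 0} ∪ ⋃ i : Fin d, ({z | z i.succ = 0} ∪ {z | z i.succ = 1}) := by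
    ext z
    simp [openBox]
  rw [this]
  refine (isClosed_eq (continuous_apply 0) continuous_const).union
    (isClosed_iUnion_of_finite fun i => ?_)
  exact (isClosed_eq (continuous_apply _) continuous_const).union
    (isClosed_eq (continuous_apply _) continuous_const)

/-- The contraction of the cube onto the face on which the first coordinate is `0`. -/
def boxContraction (d : ℕ) : Contraction (openBox d) where
  closed := isClosed_openBox d
  toMap := ⟨fun p => Function.update p.2 0 (unitInterval.symm p.1 * p.2 0), by fun_prop⟩
  zero z := by simp
  one z := Or.inl (by simp)
  mem t z hz := by
    obtain hz | ⟨i, hi⟩ := hz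
    · exact Or.inl (by simp [hz])
    · exact Or.inr ⟨i, by simpa [Function.update_of_ne] using hi⟩

/-- The bottom of the cylinder over the cube, together with the cylinder over the open box. -/
def cylinder (d : ℕ) : Set (unitInterval × (Fin (d + 1) → unitInterval)) :=
  {p | p.1 = 0 ∨ p.2 ∈ openBox d}

/-- The contraction of the cylinder over the cube onto its bottom. -/
def cylinderContraction (d : ℕ) : Contraction (cylinder d) where
  closed := (isClosed_eq continuous_fst continuous_const).union
    ((isClosed_openBox d).preimage continuous_snd)
  toMap := ⟨fun p => (unitInterval.symm p.1 * p.2.1, p.2.2), by fun_prop⟩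
  zero z := by simp
  one z := Or.inl (by simp)
  mem t z hz := hz.imp (fun h => by simp [h]) id

variable {J A B : Tower.{u}} {ι : TowerHom J A} {π : TowerHom A B} {k₀ d : ℕ}

/-- The loop `g` is the boundary of the loop `f`. -/
def IsLoopBoundary (ι : TowerHom J A) (π : TowerHom A B)
    (f : GenLoop (Fin (d + 1)) B.Unitaries B.base) (g : GenLoop (Fin d) J.Unitaries J.base) :
    Prop :=
  ∃ F : C(Fin (d + 1) → unitInterval, A.Unitaries), (∀ z, π.unitaries (F z) = f z) ∧
    (∀ z, (z 0 = 0 ∨ ∃ i : Fin d, z i.succ = 0 ∨ z i.succ = 1) → F z = A.base) ∧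
    ∀ z : Fin d → unitInterval, F (Fin.cons 1 z) = ι.unitaries (g z)

theorem continuous_cons {Z : Type*} [TopologicalSpace Z] {s : Z → unitInterval}
    {w : Z → Fin d → unitInterval} (hs : Continuous s) (hw : Continuous w) :
    Continuous fun z => (Fin.cons (s z) (w z) : Fin (d + 1) → unitInterval) := by
  refine continuous_pi fun i => ?_
  induction i using Fin.cases with
  | zero => exact hs
  | succ i => exact (continuous_apply i).comp hw

/-- The cube contracts onto the open box, so `f` has a lift that is trivial there. On the remaining
face `f` is trivial, so the lift takes values in the unitaries of `J`. -/
theorem IsExactSeq.exists_isLoopBoundary (h : IsExactSeq ι π k₀)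
    (f : GenLoop (Fin (d + 1)) B.Unitaries B.base) : ∃ g, IsLoopBoundary ι π f g := by
  obtain ⟨F, h1, h2⟩ := (boxContraction d).exists_lift_tower_base h f.1
    fun z hz => f.2 z (openBox_subset_boundary hz)
  obtain ⟨g, hg⟩ := h.exists_factor (F.comp ⟨fun w : Fin d → unitInterval => Fin.cons 1 w,
    continuous_cons continuous_const continuous_id⟩)
    fun w => (h1 _).trans (f.2 _ (cons_one_mem_boundary w))
  refine ⟨⟨g, fun w hw => h.unitaries_injective ?_⟩, F, h1, h2, fun w => (hg w).symm⟩
  rw [ι.unitaries_base]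
  exact (hg w).trans (h2 _ (cons_mem_openBox hw 1))

/-- A null homotopy of `f` is lifted to the cylinder over the cube, starting with `F` at the bottom
and trivial over the open box. The part of the lift over the face with first coordinate `1` deforms
`g`, inside `J`, into a face of the top; the top itself also lies in `J` and contracts that face.
This lemma makes the boundary map well defined. -/
theorem IsExactSeq.isLoopBoundary_null (h : IsExactSeq ι π k₀)
    {f : GenLoop (Fin (d + 1)) B.Unitaries B.base} {g : GenLoop (Fin d) J.Unitaries J.base}
    (hfg : IsLoopBoundary ι π f g) (hf : GenLoop.Homotopic f GenLoop.const) :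
    GenLoop.Homotopic g GenLoop.const := by
  obtain ⟨F, h1, h2, h3⟩ := hfg
  obtain ⟨H, h4, h5, h6⟩ := exists_map_of_homotopic hf
  obtain ⟨L, h7, h8⟩ := (cylinderContraction d).exists_lift_tower h H
    (F.comp ⟨Prod.snd, continuous_snd⟩) (by
      rintro ⟨s, z⟩ (rfl | hz)
      · exact (h1 z).trans (h4 z).symm
      · change π.unitaries (F z) = _
        rw [h2 z hz, π.unitaries_base]
        exact (h6 s z (openBox_subset_boundary hz)).symm)
  -- The top of the cylinder lies over the constant end of the null homotopy.
  obtain ⟨G, hG⟩ := h.exists_factor (L.comp ⟨fun z : Fin (d + 1) → unitInterval => (1, z),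
    by fun_prop⟩) fun z => (h7 _).trans (h5 z)
  -- The side over the face lies over the boundary of the cube, where the homotopy is constant.
  obtain ⟨K, hK⟩ := h.exists_factor (L.comp ⟨fun p : unitInterval × (Fin d → unitInterval) =>
    (p.1, Fin.cons 1 p.2), continuous_fst.prodMk (continuous_cons continuous_const continuous_snd)⟩)
    fun p => (h7 _).trans (h6 _ _ (cons_one_mem_boundary _))
  have hGbox : ∀ z ∈ openBox d, G z = J.base := by
    intro z hz
    refine h.unitaries_injective ?_
    rw [ι.unitaries_base]
    exact (hG z).trans ((h8 (1, z) (Or.inr hz)).trans (h2 z hz))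
  have hcont : Continuous fun w : Fin d → unitInterval => G (Fin.cons 1 w) :=
    G.continuous.comp (continuous_cons continuous_const continuous_id)
  refine GenLoop.Homotopic.trans (g := ⟨⟨fun w => G (Fin.cons 1 w), hcont⟩,
    fun w hw => hGbox _ (cons_mem_openBox hw 1)⟩) (homotopic_of_map K (fun w => ?_) (fun w => ?_)
      fun s w hw => ?_) (homotopic_of_map (G.comp
        ⟨fun p : unitInterval × (Fin d → unitInterval) => Fin.cons (unitInterval.symm p.1) p.2,
          continuous_cons (by fun_prop) continuous_snd⟩) (fun w => ?_) (fun w => ?_)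
      fun s w hw => ?_)
  · refine h.unitaries_injective ?_
    rw [hK, ← h3]
    exact h8 (0, Fin.cons 1 w) (Or.inl rfl)
  · refine h.unitaries_injective ?_
    rw [hK]
    exact (hG _).symm
  · refine h.unitaries_injective ?_
    rw [hK, ι.unitaries_base]
    exact (h8 (s, Fin.cons 1 w) (Or.inr (cons_mem_openBox hw 1))).trans
      (h2 _ (cons_mem_openBox hw 1))
  · change G (Fin.cons (unitInterval.symm 0) w) = G (Fin.cons 1 w)
    rw [unitInterval.symm_zero]
  · exact hGbox _ (Or.inl (by simp))
  · exact hGbox _ (cons_mem_openBox hw _)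

theorem IsLoopBoundary.mul {f f' : GenLoop (Fin (d + 1)) B.Unitaries B.base}
    {g g' : GenLoop (Fin d) J.Unitaries J.base} (h : IsLoopBoundary ι π f g)
    (h' : IsLoopBoundary ι π f' g') : IsLoopBoundary ι π (loopMul f f') (loopMul g g') := by
  obtain ⟨F, h1, h2, h3⟩ := h
  obtain ⟨F', h1', h2', h3'⟩ := h'
  refine ⟨⟨fun z => Tower.mul (F z) (F' z), Tower.continuous_mul F.continuous F'.continuous⟩,
    fun z => ?_, fun z hz => ?_, fun z => ?_⟩
  · exact (π.unitaries_mul _ _).trans (congrArg₂ Tower.mul (h1 z) (h1' z))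
  · exact (congrArg₂ Tower.mul (h2 z hz) (h2' z hz)).trans (Tower.mul_base _)
  · exact (congrArg₂ Tower.mul (h3 z) (h3' z)).trans (ι.unitaries_mul _ _).symm

theorem IsLoopBoundary.inv {f : GenLoop (Fin (d + 1)) B.Unitaries B.base}
    {g : GenLoop (Fin d) J.Unitaries J.base} (h : IsLoopBoundary ι π f g) :
    IsLoopBoundary ι π (loopInv f) (loopInv g) := by
  obtain ⟨F, h1, h2, h3⟩ := h
  refine ⟨⟨fun z => Tower.inv (F z), Tower.continuous_inv F.continuous⟩,
    fun z => ?_, fun z hz => ?_, fun z => ?_⟩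
  · exact (π.unitaries_inv _).trans (congrArg Tower.inv (h1 z))
  · exact (congrArg Tower.inv (h2 z hz)).trans (Tower.Unitaries.ext fun n => star_zero _)
  · exact (congrArg Tower.inv (h3 z)).trans (ι.unitaries_inv _).symm

/-- The Bott map acts pointwise on `F` and adds its coordinates at the end, so the distinguished
first coordinate and its faces are preserved. Triviality on the new faces is the edge property of
the Bott element. -/
theorem IsLoopBoundary.bott {f : GenLoop (Fin (d + 1)) B.Unitaries B.base}
    {g : GenLoop (Fin d) J.Unitaries J.base} (h : IsLoopBoundary ι π f g) :
    IsLoopBoundary (d := d + 2) ι.mat2 π.mat2 (bott B f) (bott J g) := by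
  obtain ⟨F, h1, h2, h3⟩ := h
  have hc : Continuous fun z : Fin (d + 1 + 2) → unitInterval => bottPt A
      (F fun i => z (i.castAdd 2)) (z (Fin.natAdd (d + 1) 0)) (z (Fin.natAdd (d + 1) 1)) :=
    continuous_bottPt (F.continuous.comp (by fun_prop)) (continuous_apply _) (continuous_apply _)
  have h4 : ∀ z : Fin (d + 1 + 2) → unitInterval, π.mat2.unitaries (bottPt A
      (F fun i => z (i.castAdd 2)) (z (Fin.natAdd (d + 1) 0)) (z (Fin.natAdd (d + 1) 1))) =
      HigsonRoe.bott B f z := fun z =>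
    (bottPt_map π _ _ _).trans (congrArg (fun x => bottPt B x _ _) (h1 _))
  have h5 : ∀ z : Fin (d + 1 + 2) → unitInterval,
      (z 0 = 0 ∨ ∃ i : Fin (d + 2), z i.succ = 0 ∨ z i.succ = 1) → bottPt A
      (F fun i => z (i.castAdd 2)) (z (Fin.natAdd (d + 1) 0)) (z (Fin.natAdd (d + 1) 1)) =
      A.mat2.base := by
    rintro z (hz | ⟨i, hi⟩)
    · rw [h2 (fun i => z (i.castAdd 2)) (Or.inl hz), bottPt_base]
    · induction i using Fin.addCases with
      | left i => rw [h2 (fun i => z (i.castAdd 2)) (Or.inr ⟨i, hi⟩), bottPt_base]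
      | right i =>
        refine bottPt_edge _ ?_
        have hi' : z (Fin.natAdd (d + 1) i) = 0 ∨ z (Fin.natAdd (d + 1) i) = 1 := by
          have : (Fin.natAdd d i).succ = Fin.natAdd (d + 1) i :=
            Fin.ext (by simp only [Fin.val_succ, Fin.val_natAdd]; omega)
          exact this ▸ hi
        fin_cases i
        · exact Or.inl hi'
        · exact Or.inr hi'
  refine ⟨⟨_, hc⟩, h4, h5, fun z => ?_⟩
  have h6 : (fun i : Fin (d + 1) => (Fin.cons 1 z : Fin (d + 2 + 1) → unitInterval)
      (Fin.castAdd 2 i)) = Fin.cons 1 fun i => z (i.castAdd 2) := by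
    funext i
    induction i using Fin.cases with
    | zero => rfl
    | succ i => rfl
  -- The same Bott coordinate is addressed in two ways: after the `d + 1` loop coordinates of the
  -- large cube, and as a successor of a coordinate of the face.
  have h7 : ∀ j : Fin 2, (Fin.cons 1 z : Fin (d + 2 + 1) → unitInterval)
      (Fin.cast (by omega) (Fin.natAdd (d + 1) j)) = z (Fin.natAdd d j) := fun j => by
    have : Fin.cast (by omega) (Fin.natAdd (d + 1) j) = (Fin.natAdd d j).succ :=
      Fin.ext (by simp only [Fin.val_succ, Fin.val_natAdd, Fin.val_cast]; omega)
    rw [this, Fin.cons_succ]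
  have h8 := h7 0
  have h9 := h7 1
  refine Eq.trans ?_ (bottPt_map ι _ (z (Fin.natAdd d 0)) (z (Fin.natAdd d 1))).symm
  rw [← h3, ← h6, ← h8, ← h9]
  rfl

/-- The lift `F`, read along its first coordinate from `1` to `0`, is itself the null homotopy. -/
theorem IsLoopBoundary.map_null {f : GenLoop (Fin (d + 1)) B.Unitaries B.base}
    {g : GenLoop (Fin d) J.Unitaries J.base} (h : IsLoopBoundary ι π f g) :
    GenLoop.Homotopic (loopMap ι.unitaries ι.unitaries_base g) GenLoop.const := by
  obtain ⟨F, h1, h2, h3⟩ := h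
  refine homotopic_of_map (F.comp
    ⟨fun p : unitInterval × (Fin d → unitInterval) => Fin.cons (unitInterval.symm p.1) p.2,
      continuous_cons (by fun_prop) continuous_snd⟩) (fun w => ?_) (fun w => ?_) fun s w hw => ?_
  · change F (Fin.cons (unitInterval.symm 0) w) = _
    rw [unitInterval.symm_zero, h3]
    rfl
  · exact h2 _ (Or.inl (by simp))
  · exact h2 _ (cons_mem_openBox hw _)

/-- Conversely, a null homotopy of the image of `g` is a map on the cube of one dimension more. Its
projection to `B` is a loop, because on the face carrying `g` the values come from `J`. -/
theorem IsExactSeq.exists_isLoopBoundary_of_null (h : IsExactSeq ι π k₀)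
    {g : GenLoop (Fin d) J.Unitaries J.base}
    (hg : GenLoop.Homotopic (loopMap ι.unitaries ι.unitaries_base g) GenLoop.const) :
    ∃ f, IsLoopBoundary ι π f g := by
  obtain ⟨H, h1, h2, h3⟩ := exists_map_of_homotopic hg
  have hF : Continuous fun z : Fin (d + 1) → unitInterval =>
      H (unitInterval.symm (z 0), fun i => z i.succ) := H.continuous.comp (by fun_prop)
  have hbox : ∀ z : Fin (d + 1) → unitInterval, z ∈ openBox d →
      H (unitInterval.symm (z 0), fun i => z i.succ) = A.base := by
    rintro z (hz | hz)
    · rw [hz, unitInterval.symm_zero, h2]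
      rfl
    · exact h3 _ _ hz
  refine ⟨⟨⟨fun z => π.unitaries (H (unitInterval.symm (z 0), fun i => z i.succ)),
    by fun_prop⟩, ?_⟩, ⟨_, hF⟩, fun z => rfl, hbox, fun z => ?_⟩
  · rintro z ⟨i, hi⟩
    change π.unitaries (H (unitInterval.symm (z 0), fun i => z i.succ)) = _
    by_cases hz : z ∈ openBox d
    · rw [hbox z hz, π.unitaries_base]
    · have h0 : z 0 = 1 := by
        induction i using Fin.cases with
        | zero => exact hi.resolve_left fun h => hz (Or.inl h)
        | succ i => exact absurd (Or.inr ⟨i, hi⟩) hz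
      rw [h0, unitInterval.symm_one, h1]
      exact h.comp_eq_base _
  · change H (unitInterval.symm 1, fun i => z i) = _
    rw [unitInterval.symm_one, h1]
    rfl

end Boundary

/-! ### Classes in K-theory -/

section KClass

variable {T : Tower.{u}} {m : ℤ}

/-- The loop `f` becomes null-homotopic after `j` applications of the Bott map. -/
def EvNull : ∀ (T : Tower.{u}) {d : ℕ}, ℕ → GenLoop (Fin d) T.Unitaries T.base → Prop
  | _, _, 0, f => GenLoop.Homotopic f GenLoop.const
  | T, _, j + 1, f => EvNull T.mat2 j (bott T f)

/-- The Bott map on the groups that define K-theory. -/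
def bottHom (T : Tower.{u}) (p : KIndex m) : T.KPiece p →+ T.KPiece p.next :=
  MonoidHom.toAdditive (bottPi (T.stage p.1.2) (p.1.1 + 1))

/-- The iterated Bott map. -/
def iterHom (T : Tower.{u}) : ∀ (j : ℕ) (p : KIndex m), T.KPiece p →+ T.KPiece (KIndex.next^[j] p)
  | 0, _ => AddMonoidHom.id _
  | j + 1, p => (iterHom T j p.next).comp (bottHom T p)

theorem loopClass_eq_one_iff {d : ℕ} {f : GenLoop (Fin (d + 1)) T.Unitaries T.base} :
    loopClass f = 1 ↔ GenLoop.Homotopic f GenLoop.const :=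
  ⟨fun h => Quotient.exact h, fun h => Quotient.sound h⟩

theorem iterHom_eq_zero_iff (j : ℕ) : ∀ (p : KIndex m) (f : T.KLoop p),
    iterHom T j p (Additive.ofMul (loopClass f)) = 0 ↔ EvNull (T.stage p.1.2) j f := by
  induction j with
  | zero => exact fun p f => loopClass_eq_one_iff
  | succ j ih => exact fun p f => ih p.next (bott (T.stage p.1.2) f)

theorem next_iterate_snd (j : ℕ) : ∀ p : KIndex m, (KIndex.next^[j] p).1.2 = p.1.2 + j := by
  induction j with
  | zero => exact fun p => rfl
  | succ j ih =>
    intro p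
    rw [Function.iterate_succ_apply, ih]
    change p.1.2 + 1 + j = _
    omega

/-- The degree equation determines the first component from the second. -/
theorem KIndex.ext {p q : KIndex m} (h : p.1.2 = q.1.2) : p = q := by
  refine Subtype.ext (Prod.ext ?_ h)
  have h1 := p.2
  have h2 := q.2
  omega

theorem KIndex.eq_iterate {p q : KIndex m} (h : p.1.2 ≤ q.1.2) :
    q = KIndex.next^[q.1.2 - p.1.2] p := by
  refine KIndex.ext ?_
  rw [next_iterate_snd]
  omega

theorem KIndex.exists_le (m : ℤ) (N : ℕ) : ∃ p : KIndex m, N ≤ p.1.2 :=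
  -- The summands `3` and `(-m).toNat` make `m - 3 + 2k` nonnegative, so truncation by `toNat` does
  -- not change it.
  ⟨⟨((m - 3 + 2 * (N + 3 + (-m).toNat : ℕ)).toNat, N + 3 + (-m).toNat), by
    change ((m - 3 + 2 * (N + 3 + (-m).toNat : ℕ)).toNat : ℤ) + 2 = _ - 1 + 2 * (_ : ℕ)
    omega⟩, by change N ≤ N + 3 + (-m).toNat; omega⟩

open Classical in
/-- The components of the map from the direct sum of all groups to the group with index `q`. -/
def evalComp (T : Tower.{u}) (q p : KIndex m) : T.KPiece p →+ T.KPiece q :=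
  if h : ∃ j, KIndex.next^[j] p = q then h.choose_spec ▸ iterHom T h.choose p else 0

/-- The number of Bott steps between two indices is the difference of their second components, so
the choice and the transport in the definition are harmless. -/
theorem evalComp_iterate (j : ℕ) (p : KIndex m) :
    evalComp T (KIndex.next^[j] p) p = iterHom T j p := by
  have h : ∃ j', KIndex.next^[j'] p = KIndex.next^[j] p := ⟨j, rfl⟩
  have key : ∀ j' (h' : KIndex.next^[j'] p = KIndex.next^[j] p),
      (h' ▸ iterHom T j' p : T.KPiece p →+ T.KPiece (KIndex.next^[j] p)) = iterHom T j p := by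
    intro j' h'
    have : j' = j := by
      have := congrArg (fun q : KIndex m => q.1.2) h'
      simp only [next_iterate_snd] at this
      omega
    subst this
    rfl
  rw [evalComp, dif_pos h]
  exact key _ _

/-- The exclusion `q ≠ p` is necessary: for `q = p` the left side is `x`, whereas the right side is
zero because `p` is not reached from its successor. -/
theorem evalComp_bott {q p : KIndex m} (h : q ≠ p) (x : T.KPiece p) :
    evalComp T q p x = evalComp T q p.next (bottHom T p x) := by
  by_cases hj : ∃ j, KIndex.next^[j] p = q
  · obtain ⟨j, rfl⟩ := hj
    obtain - | j := j
    · exact absurd rfl h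
    · exact (DFunLike.congr_fun (evalComp_iterate (j + 1) p) x).trans
        (DFunLike.congr_fun (evalComp_iterate j p.next) _).symm
  · have hj' : ¬ ∃ j, KIndex.next^[j] p.next = q := fun ⟨j, hj'⟩ => hj ⟨j + 1, hj'⟩
    rw [evalComp, evalComp, dif_neg hj, dif_neg hj']
    rfl

/-- The map from the direct sum of all groups to the group with index `q` that is given by iterated
Bott maps. -/
def evalAt (T : Tower.{u}) (q : KIndex m) : DirectSum (KIndex m) T.KPiece →+ T.KPiece q :=
  DirectSum.toAddMonoid (evalComp T q)

theorem evalAt_of (q p : KIndex m) (x : T.KPiece p) :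
    evalAt T q (DirectSum.of T.KPiece p x) = evalComp T q p x :=
  DirectSum.toAddMonoid_of _ _ _

/-- Evaluation at `q` respects every Bott relation except those starting at `q`. An element of the
relation group involves finitely many relations, so it evaluates to zero at all late indices. -/
theorem evalAt_kRel {x : DirectSum (KIndex m) T.KPiece} (hx : x ∈ T.kRel m) :
    ∃ N, ∀ q : KIndex m, N ≤ q.1.2 → evalAt T q x = 0 := by
  induction hx using AddSubgroup.closure_induction with
  | mem x hx =>
    obtain ⟨p, f, rfl⟩ := hx
    refine ⟨p.1.2 + 1, fun q hq => ?_⟩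
    rw [map_sub, sub_eq_zero]
    refine (evalAt_of q p _).trans (Eq.trans ?_ (evalAt_of q p.next _).symm)
    refine evalComp_bott ?_ _
    rintro rfl
    omega
  | zero => exact ⟨0, fun q _ => map_zero _⟩
  | add x y _ _ hx hy =>
    obtain ⟨N, hN⟩ := hx
    obtain ⟨M, hM⟩ := hy
    exact ⟨max N M, fun q hq => by
      rw [map_add, hN q (le_trans (le_max_left _ _) hq), hM q (le_trans (le_max_right _ _) hq),
        add_zero]⟩
  | neg x _ hx =>
    obtain ⟨N, hN⟩ := hx
    exact ⟨N, fun q hq => by rw [map_neg, hN q hq, neg_zero]⟩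

/-- A class that dies in the direct limit dies at a finite stage. Together with `exists_kClass` this
reduces all of K-theory to loops and null homotopies. -/
theorem exists_evNull_of_kClass_eq_zero {p : KIndex m} {f : T.KLoop p} (h : T.kClass p f = 0) :
    ∃ j, EvNull (T.stage p.1.2) j f := by
  have h1 : T.kGen p f ∈ T.kRel m := (QuotientAddGroup.eq_zero_iff _).1 h
  obtain ⟨N, hN⟩ := evalAt_kRel h1
  have h2 := hN (KIndex.next^[N] p) (by rw [next_iterate_snd]; omega)
  refine ⟨N, (iterHom_eq_zero_iff N p f).1 ?_⟩
  rw [← evalComp_iterate]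
  exact (evalAt_of _ _ _).symm.trans h2

/-- The map from homotopy classes of loops to K-theory. -/
def kHom (T : Tower.{u}) (p : KIndex m) : T.KPiece p →+ T.K m :=
  (QuotientAddGroup.mk' (T.kRel m)).comp (DirectSum.of T.KPiece p)

theorem kClass_bott (p : KIndex m) (f : T.KLoop p) :
    T.kClass p f = T.kClass p.next (bott (T.stage p.1.2) f) := by
  refine (QuotientAddGroup.eq_iff_sub_mem).2 (AddSubgroup.subset_closure ⟨p, f, rfl⟩)

theorem kClass_congr {p : KIndex m} {f g : T.KLoop p} (h : GenLoop.Homotopic f g) :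
    T.kClass p f = T.kClass p g :=
  congrArg (fun x => kHom T p (Additive.ofMul x)) (Quotient.sound h)

theorem kClass_mul (p : KIndex m) (f g : T.KLoop p) :
    T.kClass p (loopMul f g) = T.kClass p f + T.kClass p g :=
  (congrArg (fun x => kHom T p (Additive.ofMul x)) (homotopyGroup_mul_eq f g).symm).trans
    (map_add (kHom T p) _ _)

theorem kClass_inv (p : KIndex m) (f : T.KLoop p) :
    T.kClass p (loopInv f) = -T.kClass p f :=
  (congrArg (fun x => kHom T p (Additive.ofMul x)) (homotopyGroup_inv_eq f).symm).trans
    (map_neg (kHom T p) _)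

theorem kClass_const (p : KIndex m) : T.kClass p GenLoop.const = 0 := map_zero (kHom T p)

theorem kClass_eq_zero_of_homotopic {p : KIndex m} {f : T.KLoop p}
    (h : GenLoop.Homotopic f GenLoop.const) : T.kClass p f = 0 :=
  (kClass_congr h).trans (kClass_const p)

theorem exists_kClass_iterate (j : ℕ) : ∀ (p : KIndex m) (f : T.KLoop p),
    ∃ g : T.KLoop (KIndex.next^[j] p), T.kClass p f = T.kClass (KIndex.next^[j] p) g := by
  induction j with
  | zero => exact fun p f => ⟨f, rfl⟩
  | succ j ih =>
    intro p f
    obtain ⟨g, hg⟩ := ih p.next (bott (T.stage p.1.2) f)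
    exact ⟨g, (kClass_bott p f).trans hg⟩

/-- The finitely many summands are moved to a common late index by Bott maps and added there by
pointwise multiplication of loops. Having representatives at all late indices allows several classes
to be treated at once. -/
theorem exists_kClass (x : T.K m) :
    ∃ N, ∀ p : KIndex m, N ≤ p.1.2 → ∃ f : T.KLoop p, x = T.kClass p f := by
  obtain ⟨x, rfl⟩ := QuotientAddGroup.mk_surjective x
  induction x using DirectSum.induction_on with
  | zero => exact ⟨0, fun p _ => ⟨GenLoop.const, (kClass_const p).symm⟩⟩
  | of p x =>
    refine ⟨p.1.2, fun q hq => ?_⟩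
    obtain ⟨f⟩ := x
    rw [KIndex.eq_iterate hq]
    exact exists_kClass_iterate _ p f
  | add x y hx hy =>
    obtain ⟨N, hN⟩ := hx
    obtain ⟨M, hM⟩ := hy
    refine ⟨max N M, fun p hp => ?_⟩
    obtain ⟨f, hf⟩ := hN p (le_trans (le_max_left _ _) hp)
    obtain ⟨g, hg⟩ := hM p (le_trans (le_max_right _ _) hp)
    exact ⟨loopMul f g, (congrArg₂ _ hf hg).trans (kClass_mul p f g).symm⟩

end KClass

/-! ### Functoriality of K-theory -/

section Functor

variable {S T R : Tower.{u}} {m : ℤ}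

/-- Postcomposition of loops with the map on unitaries induced by a morphism of towers. -/
abbrev TowerHom.loop (φ : TowerHom S T) {d : ℕ} (f : GenLoop (Fin d) S.Unitaries S.base) :
    GenLoop (Fin d) T.Unitaries T.base := loopMap φ.unitaries φ.unitaries_base f

theorem TowerHom.kMap_kClass (φ : TowerHom S T) (p : KIndex m) (f : S.KLoop p) :
    φ.kMap m (S.kClass p f) = T.kClass p ((φ.stage p.1.2).loop f) := by
  refine (QuotientAddGroup.map_mk _ _ _ _ _).trans (congrArg _ ?_)
  exact DirectSum.map_of _ _ _

theorem TowerHom.stage_comp {S' : Tower.{u}} {φ : TowerHom S T} {ψ : TowerHom T R}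
    {φ' : TowerHom S S'} {ψ' : TowerHom S' R}
    (h : ∀ n x, ψ.app n (φ.app n x) = ψ'.app n (φ'.app n x)) :
    ∀ k n x, (ψ.stage k).app n ((φ.stage k).app n x) = (ψ'.stage k).app n ((φ'.stage k).app n x)
  | 0, n, x => Stab.map_comp _ _ _ _ (h n) x
  | k + 1, n, x => MatAlg.ext fun p q => TowerHom.stage_comp h k n (MatAlg.entry x p q)

theorem TowerHom.loop_comp {S' : Tower.{u}} {φ : TowerHom S T} {ψ : TowerHom T R}
    {φ' : TowerHom S S'} {ψ' : TowerHom S' R}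
    (h : ∀ n x, ψ.app n (φ.app n x) = ψ'.app n (φ'.app n x)) {d : ℕ}
    (f : GenLoop (Fin d) S.Unitaries S.base) : ψ.loop (φ.loop f) = ψ'.loop (φ'.loop f) :=
  GenLoop.ext _ _ fun _ => Tower.Unitaries.ext fun n => h n _

theorem TowerHom.kMap_comp {S' : Tower.{u}} {φ : TowerHom S T} {ψ : TowerHom T R}
    {φ' : TowerHom S S'} {ψ' : TowerHom S' R}
    (h : ∀ n x, ψ.app n (φ.app n x) = ψ'.app n (φ'.app n x)) (x : S.K m) :
    ψ.kMap m (φ.kMap m x) = ψ'.kMap m (φ'.kMap m x) := by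
  obtain ⟨N, hN⟩ := exists_kClass x
  obtain ⟨p, hp⟩ := KIndex.exists_le m N
  obtain ⟨f, rfl⟩ := hN p hp
  simp only [TowerHom.kMap_kClass]
  exact congrArg _ (TowerHom.loop_comp (TowerHom.stage_comp h p.1.2) f)

/-- The identity morphism of a tower. -/
def TowerHom.refl (S : Tower.{u}) : TowerHom S S :=
  ⟨fun _ => NonUnitalStarAlgHom.id ℂ _, fun _ _ => rfl⟩

theorem stabMap_id {A : Type u} [NonUnitalCStarAlgebra A] {φ : A →⋆ₙₐ[ℂ] A} (h : ∀ x, φ x = x)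
    (x : Stab A) : stabMap φ x = x :=
  stabSystem_generates.eq_of_eqOn (continuous_starHom _) continuous_id (fun n M => by
    rw [stabMap_hom]
    exact congrArg _ (MatAlg.ext fun p q => h _)) x

theorem TowerHom.stage_refl : ∀ k n x, ((TowerHom.refl S).stage k).app n x = x
  | 0, _, x => stabMap_id (fun _ => rfl) x
  | k + 1, n, x => MatAlg.ext fun p q => TowerHom.stage_refl k n (MatAlg.entry x p q)

theorem TowerHom.kMap_refl (x : S.K m) : (TowerHom.refl S).kMap m x = x := by
  obtain ⟨N, hN⟩ := exists_kClass x
  obtain ⟨p, hp⟩ := KIndex.exists_le m N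
  obtain ⟨f, rfl⟩ := hN p hp
  rw [TowerHom.kMap_kClass]
  exact congrArg _ (GenLoop.ext _ _ fun _ => Tower.Unitaries.ext fun n => TowerHom.stage_refl _ n _)

theorem TowerHom.kMap_triangle {φ : TowerHom S T} {ψ : TowerHom T R} {χ : TowerHom S R}
    (h : ∀ n x, ψ.app n (φ.app n x) = χ.app n x) (x : S.K m) :
    ψ.kMap m (φ.kMap m x) = χ.kMap m x :=
  (TowerHom.kMap_comp (ψ' := TowerHom.refl R) (φ' := χ) h x).trans (TowerHom.kMap_refl _)

/-- A morphism of towers that induces bijections on homotopy classes of loops of unitaries. -/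
structure TowerHom.LoopBijective (φ : TowerHom S T) : Prop where
  injective : ∀ {d : ℕ} (f : GenLoop (Fin d) S.Unitaries S.base),
    GenLoop.Homotopic (φ.loop f) GenLoop.const → GenLoop.Homotopic f GenLoop.const
  surjective : ∀ {d : ℕ} (g : GenLoop (Fin d) T.Unitaries T.base),
    ∃ f, GenLoop.Homotopic (φ.loop f) g

/-- Stagewise bijections on homotopy classes pass to the direct limit. For injectivity, a loop whose
image dies after `j` Bott maps is replaced by its `j`-fold Bott image, whose own image is null
homotopic already. -/
theorem TowerHom.kMap_bijective {φ : TowerHom S T} (h : ∀ k, (φ.stage k).LoopBijective) (m : ℤ) :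
    Function.Bijective (φ.kMap m) := by
  constructor
  · rw [injective_iff_map_eq_zero]
    intro x hx
    obtain ⟨N, hN⟩ := exists_kClass x
    obtain ⟨p, hp⟩ := KIndex.exists_le m N
    obtain ⟨f, rfl⟩ := hN p hp
    rw [TowerHom.kMap_kClass] at hx
    obtain ⟨j, hj⟩ := exists_evNull_of_kClass_eq_zero hx
    clear hx hp hN
    induction j generalizing p with
    | zero => exact kClass_eq_zero_of_homotopic ((h _).injective f hj)
    | succ j ih =>
      rw [kClass_bott]
      refine ih p.next _ ?_
      change EvNull _ j (bott _ _) at hj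
      rw [← loopMap_bott] at hj
      exact hj
  · intro y
    obtain ⟨N, hN⟩ := exists_kClass y
    obtain ⟨p, hp⟩ := KIndex.exists_le m N
    obtain ⟨g, rfl⟩ := hN p hp
    obtain ⟨f, hf⟩ := (h p.1.2).surjective g
    exact ⟨S.kClass p f, (TowerHom.kMap_kClass φ p f).trans (kClass_congr hf)⟩

theorem TowerHom.loop_homotopic (φ : TowerHom S T) {d : ℕ}
    {f g : GenLoop (Fin d) S.Unitaries S.base} (h : GenLoop.Homotopic f g) :
    GenLoop.Homotopic (φ.loop f) (φ.loop g) :=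
  Nonempty.map (fun H => H.compContinuousMap φ.unitaries) h

theorem TowerHom.LoopBijective.of_homeomorph {φ : TowerHom S T}
    (h : ∃ e : S.Unitaries ≃ₜ T.Unitaries, ∀ x, e x = φ.unitaries x) : φ.LoopBijective := by
  obtain ⟨e, he⟩ := h
  have he' : e.symm T.base = S.base := by
    rw [e.symm_apply_eq, he, φ.unitaries_base]
  have h1 : ∀ {d : ℕ} (f : GenLoop (Fin d) S.Unitaries S.base),
      loopMap (e.symm : C(T.Unitaries, S.Unitaries)) he' (φ.loop f) = f := fun f =>
    GenLoop.ext _ _ fun z => (congrArg e.symm (he (f z)).symm).trans (e.symm_apply_apply _)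
  refine ⟨fun {d} f hf => ?_, fun g => ⟨loopMap (e.symm : C(T.Unitaries, S.Unitaries)) he' g, ?_⟩⟩
  · have h2 := Nonempty.map (fun H => H.compContinuousMap
      (e.symm : C(T.Unitaries, S.Unitaries))) hf
    have h3 : GenLoop.Homotopic (loopMap (e.symm : C(T.Unitaries, S.Unitaries)) he' (φ.loop f))
        (loopMap (e.symm : C(T.Unitaries, S.Unitaries)) he' GenLoop.const) := h2
    rw [h1] at h3
    have h4 : loopMap (e.symm : C(T.Unitaries, S.Unitaries)) he'
        (GenLoop.const : GenLoop (Fin d) T.Unitaries T.base) = GenLoop.const :=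
      GenLoop.ext _ _ fun _ => he'
    rwa [h4] at h3
  · have : φ.loop (loopMap (e.symm : C(T.Unitaries, S.Unitaries)) he' g) = g :=
      GenLoop.ext _ _ fun z => (he _).symm.trans (e.apply_symm_apply _)
    rw [this]

/-- Only a tail of an inverse sequence matters for its limit, so bijectivity is needed only from
`k₀` on. This covers the levels at which the subspace `X` is still empty. -/
theorem TowerHom.exists_homeomorph (k₀ : ℕ) : ∀ {S T : Tower.{u}} (φ : TowerHom S T),
    (∀ n, k₀ ≤ n → Function.Bijective (φ.app n)) →
    ∃ e : S.Unitaries ≃ₜ T.Unitaries, ∀ x, e x = φ.unitaries x := by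
  induction k₀ with
  | zero =>
    intro S T φ h
    let ψ : TowerHom T S := ⟨fun n =>
      ((StarAlgEquiv.ofBijective (φ.app n) (h n (Nat.zero_le n))).symm :
        (T.obj n).carrier →⋆ₙₐ[ℂ] (S.obj n).carrier), fun n x => (h n (Nat.zero_le n)).1 (by
        rw [φ.comm]
        have h1 : ∀ n (x : (T.obj n).carrier), φ.app n ((StarAlgEquiv.ofBijective (φ.app n)
            (h n (Nat.zero_le n))).symm x) = x := fun n x =>
          (StarAlgEquiv.ofBijective (φ.app n) (h n (Nat.zero_le n))).apply_symm_apply x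
        exact (h1 n _).trans (congrArg _ (h1 (n + 1) x).symm))⟩
    have h1 : ∀ n (x : (T.obj n).carrier), φ.app n (ψ.app n x) = x := fun n x =>
      (StarAlgEquiv.ofBijective (φ.app n) (h n (Nat.zero_le n))).apply_symm_apply x
    exact ⟨{ toFun := φ.unitaries
             invFun := ψ.unitaries
             left_inv := fun x => Tower.Unitaries.ext fun n => (h n (Nat.zero_le n)).1 (h1 n _)
             right_inv := fun x => Tower.Unitaries.ext fun n => h1 n _
             continuous_toFun := φ.unitaries.continuous
             continuous_invFun := ψ.unitaries.continuous }, fun _ => rfl⟩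
  | succ k ih =>
    intro S T φ h
    obtain ⟨e, he⟩ := ih φ.shift fun n hn => h (n + 1) (by omega)
    refine ⟨S.shiftHomeo.trans (e.trans T.shiftHomeo.symm), fun x => ?_⟩
    refine (T.shiftHomeo.symm_apply_eq).2 ((he _).trans ?_)
    exact Tower.Unitaries.ext fun n => rfl

theorem stabMap_bijective {A B : Type u} [NonUnitalCStarAlgebra A] [NonUnitalCStarAlgebra B]
    {φ : A →⋆ₙₐ[ℂ] B} (h : Function.Bijective φ) : Function.Bijective (stabMap φ) :=
  ⟨stabMap_injective h.1, stabMap_surjective h.2⟩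

theorem TowerHom.stage_bijective {φ : TowerHom S T} {n : ℕ} (h : Function.Bijective (φ.app n)) :
    ∀ k, Function.Bijective ((φ.stage k).app n)
  | 0 => stabMap_bijective h
  | k + 1 => ⟨matAlg_map_injective (TowerHom.stage_bijective h k).1 2,
      matAlg_map_surjective (TowerHom.stage_bijective h k).2 2⟩

theorem TowerHom.kMap_bijective_of_eventually {φ : TowerHom S T} {k₀ : ℕ}
    (h : ∀ n, k₀ ≤ n → Function.Bijective (φ.app n)) (m : ℤ) : Function.Bijective (φ.kMap m) :=
  TowerHom.kMap_bijective (fun k => .of_homeomorph (TowerHom.exists_homeomorph k₀ _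
    fun n hn => TowerHom.stage_bijective (h n hn) k)) m

end Functor

/-! ### The boundary map -/

section BoundaryMap

variable {J A B : Tower.{u}} {ι : TowerHom J A} {π : TowerHom A B} {k₀ : ℕ} {m m' : ℤ}

/-- The index of the loops whose boundaries have index `p`. -/
def KIndex.up (hm : m' = m - 1) (p : KIndex m') : KIndex m :=
  ⟨(p.1.1 + 1, p.1.2), by have := p.2; push_cast; omega⟩

theorem isBoundary_iff (hm : m' = m - 1) {x : B.K m} {y : J.K m'} :
    IsBoundary ι π x y ↔ ∃ (p : KIndex m') (f : B.KLoop (p.up hm)) (g : J.KLoop p),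
      IsLoopBoundary (d := p.1.1 + 2) (ι.stage p.1.2) (π.stage p.1.2) f g ∧
      x = B.kClass (p.up hm) f ∧ y = J.kClass p g := by
  constructor
  · rintro ⟨e, k, hB, hJ, f, g, F, hx, hy, h⟩
    exact ⟨⟨(e, k), hJ⟩, f, g, ⟨F, h⟩, hx, hy⟩
  · rintro ⟨p, f, g, ⟨F, h⟩, hx, hy⟩
    exact ⟨p.1.1, p.1.2, (p.up hm).2, p.2, f, g, F, hx, hy, h⟩

theorem exists_isLoopBoundary_iterate (hm : m' = m - 1) (j : ℕ) : ∀ (p : KIndex m')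
    (f : B.KLoop (p.up hm)) (g : J.KLoop p),
    IsLoopBoundary (d := p.1.1 + 2) (ι.stage p.1.2) (π.stage p.1.2) f g →
    ∃ (f' : B.KLoop ((KIndex.next^[j] p).up hm)) (g' : J.KLoop (KIndex.next^[j] p)),
      IsLoopBoundary (d := (KIndex.next^[j] p).1.1 + 2) (ι.stage (KIndex.next^[j] p).1.2)
        (π.stage (KIndex.next^[j] p).1.2) f' g' ∧
      B.kClass (p.up hm) f = B.kClass ((KIndex.next^[j] p).up hm) f' ∧
      J.kClass p g = J.kClass (KIndex.next^[j] p) g' := by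
  induction j with
  | zero => exact fun p f g h => ⟨f, g, h, rfl, rfl⟩
  | succ j ih =>
    intro p f g h
    obtain ⟨f', g', h1, h2, h3⟩ := ih p.next (bott (B.stage p.1.2) f) (bott (J.stage p.1.2) g)
      h.bott
    exact ⟨f', g', h1, (kClass_bott (p.up hm) f).trans h2, (kClass_bott p g).trans h3⟩

/-- Bott maps carry a loop and its boundary to any later index, so two boundary relations can be
compared and added at a common one. -/
theorem IsBoundary.exists_index (hm : m' = m - 1) {x : B.K m} {y : J.K m'}
    (h : IsBoundary ι π x y) : ∃ N, ∀ p : KIndex m', N ≤ p.1.2 →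
    ∃ (f : B.KLoop (p.up hm)) (g : J.KLoop p),
      IsLoopBoundary (d := p.1.1 + 2) (ι.stage p.1.2) (π.stage p.1.2) f g ∧
      x = B.kClass (p.up hm) f ∧ y = J.kClass p g := by
  obtain ⟨p, f, g, hfg, rfl, rfl⟩ := (isBoundary_iff hm).1 h
  refine ⟨p.1.2, fun q hq => ?_⟩
  rw [KIndex.eq_iterate hq]
  exact exists_isLoopBoundary_iterate hm _ p f g hfg

theorem IsBoundary.add (hm : m' = m - 1) {x x' : B.K m} {y y' : J.K m'}
    (h : IsBoundary ι π x y) (h' : IsBoundary ι π x' y') : IsBoundary ι π (x + x') (y + y') := by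
  obtain ⟨N, hN⟩ := h.exists_index hm
  obtain ⟨N', hN'⟩ := h'.exists_index hm
  obtain ⟨p, hp⟩ := KIndex.exists_le m' (max N N')
  obtain ⟨f, g, h1, rfl, rfl⟩ := hN p (le_trans (le_max_left _ _) hp)
  obtain ⟨f', g', h1', rfl, rfl⟩ := hN' p (le_trans (le_max_right _ _) hp)
  exact (isBoundary_iff hm).2 ⟨p, loopMul f f', loopMul g g', h1.mul h1',
    (kClass_mul _ _ _).symm, (kClass_mul _ _ _).symm⟩

theorem IsBoundary.neg (hm : m' = m - 1) {x : B.K m} {y : J.K m'}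
    (h : IsBoundary ι π x y) : IsBoundary ι π (-x) (-y) := by
  obtain ⟨p, f, g, hfg, rfl, rfl⟩ := (isBoundary_iff hm).1 h
  exact (isBoundary_iff hm).2 ⟨p, loopInv f, loopInv g, hfg.inv,
    (kClass_inv _ _).symm, (kClass_inv _ _).symm⟩

theorem IsExactSeq.exists_isBoundary (h : IsExactSeq ι π k₀) (hm : m' = m - 1) (x : B.K m) :
    ∃ y : J.K m', IsBoundary ι π x y := by
  obtain ⟨N, hN⟩ := exists_kClass x
  obtain ⟨p, hp⟩ := KIndex.exists_le m' N
  obtain ⟨f, rfl⟩ := hN (p.up hm) hp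
  obtain ⟨g, hg⟩ := (h.stage p.1.2).exists_isLoopBoundary (d := p.1.1 + 2) f
  exact ⟨J.kClass p g, (isBoundary_iff hm).2 ⟨p, f, g, hg, rfl, rfl⟩⟩

/-- The Bott maps that kill `f` are applied to `g` as well; afterwards a null homotopy of `f` gives
one of `g`. -/
theorem IsExactSeq.kClass_eq_zero_of_evNull (h : IsExactSeq ι π k₀) (hm : m' = m - 1) (j : ℕ) :
    ∀ (p : KIndex m') (f : B.KLoop (p.up hm)) (g : J.KLoop p),
    IsLoopBoundary (d := p.1.1 + 2) (ι.stage p.1.2) (π.stage p.1.2) f g →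
    EvNull (B.stage p.1.2) j f → J.kClass p g = 0 := by
  induction j with
  | zero =>
    exact fun p f g hfg hf => kClass_eq_zero_of_homotopic ((h.stage p.1.2).isLoopBoundary_null hfg hf)
  | succ j ih =>
    intro p f g hfg hf
    rw [kClass_bott p g]
    exact ih p.next (bott (B.stage p.1.2) f) (bott (J.stage p.1.2) g) hfg.bott hf

theorem IsExactSeq.eq_zero_of_isBoundary (h : IsExactSeq ι π k₀) (hm : m' = m - 1) {y : J.K m'}
    (hy : IsBoundary ι π (0 : B.K m) y) : y = 0 := by
  obtain ⟨p, f, g, hfg, h1, rfl⟩ := (isBoundary_iff hm).1 hy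
  obtain ⟨j, hj⟩ := exists_evNull_of_kClass_eq_zero h1.symm
  exact h.kClass_eq_zero_of_evNull hm j p f g hfg hj

theorem IsExactSeq.isBoundary_unique (h : IsExactSeq ι π k₀) (hm : m' = m - 1) {x : B.K m}
    {y y' : J.K m'} (hy : IsBoundary ι π x y) (hy' : IsBoundary ι π x y') : y = y' := by
  have := hy.add hm (hy'.neg hm)
  rw [add_neg_cancel, ← sub_eq_add_neg] at this
  exact sub_eq_zero.1 (h.eq_zero_of_isBoundary hm this)

/-- The boundary map in K-theory. -/
def IsExactSeq.boundaryHom (h : IsExactSeq ι π k₀) (hm : m' = m - 1) : B.K m →+ J.K m' :=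
  AddMonoidHom.mk' (fun x => (h.exists_isBoundary hm x).choose) fun x y =>
    h.isBoundary_unique hm (h.exists_isBoundary hm (x + y)).choose_spec
      ((h.exists_isBoundary hm x).choose_spec.add hm (h.exists_isBoundary hm y).choose_spec)

theorem IsExactSeq.isBoundary_boundaryHom (h : IsExactSeq ι π k₀) (hm : m' = m - 1) (x : B.K m) :
    IsBoundary ι π x (h.boundaryHom hm x) := (h.exists_isBoundary hm x).choose_spec

theorem IsExactSeq.isBoundary_iff_boundaryHom_eq (h : IsExactSeq ι π k₀) (hm : m' = m - 1)
    {x : B.K m} {y : J.K m'} : IsBoundary ι π x y ↔ h.boundaryHom hm x = y :=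
  ⟨fun hy => h.isBoundary_unique hm (h.isBoundary_boundaryHom hm x) hy,
    fun hy => hy ▸ h.isBoundary_boundaryHom hm x⟩

theorem IsExactSeq.kMap_boundaryHom (h : IsExactSeq ι π k₀) (hm : m' = m - 1) (x : B.K m) :
    ι.kMap m' (h.boundaryHom hm x) = 0 := by
  obtain ⟨p, f, g, hfg, -, h1⟩ := (isBoundary_iff hm).1 (h.isBoundary_boundaryHom hm x)
  rw [h1, TowerHom.kMap_kClass]
  exact kClass_eq_zero_of_homotopic hfg.map_null

/-- Exactness at the ideal. If the image of `y` vanishes, then after finitely many Bott maps the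
representing loop is null homotopic in `A`, and the null homotopy exhibits the loop as a boundary.
-/
theorem IsExactSeq.exists_boundaryHom_eq (h : IsExactSeq ι π k₀) (hm : m' = m - 1) {y : J.K m'}
    (hy : ι.kMap m' y = 0) : ∃ x, h.boundaryHom hm x = y := by
  obtain ⟨N, hN⟩ := exists_kClass y
  obtain ⟨p, hp⟩ := KIndex.exists_le m' N
  obtain ⟨g, rfl⟩ := hN p hp
  rw [TowerHom.kMap_kClass] at hy
  obtain ⟨j, hj⟩ := exists_evNull_of_kClass_eq_zero hy
  clear hy hp hN
  induction j generalizing p with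
  | zero =>
    obtain ⟨f, hf⟩ := (h.stage p.1.2).exists_isLoopBoundary_of_null hj
    exact ⟨B.kClass (p.up hm) f,
      (h.isBoundary_iff_boundaryHom_eq hm).1 ((isBoundary_iff hm).2 ⟨p, f, g, hf, rfl, rfl⟩)⟩
  | succ j ih =>
    change EvNull _ j (bott _ _) at hj
    rw [← loopMap_bott] at hj
    obtain ⟨x, hx⟩ := ih p.next (bott (J.stage p.1.2) g) hj
    exact ⟨x, hx.trans (kClass_bott p g).symm⟩

end BoundaryMap

/-! ### Operations on systems of matrix units -/

namespace MatrixSystem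

variable {P Q R : Type u} [NonUnitalCStarAlgebra P] [NonUnitalCStarAlgebra Q]
  [NonUnitalCStarAlgebra R] (S : MatrixSystem P Q)

theorem norm_toFun_le (i j : ℕ) (a : P) : ‖S.toFun i j a‖ ≤ ‖a‖ := by
  rw [← S.hom_unit (n := max i j + 1) (by omega) (by omega)]
  exact (NonUnitalStarAlgHom.norm_apply_le _ _).trans (MatAlg.norm_unit_le _ _ _ _)

theorem continuous_toFun (i j : ℕ) : Continuous (S.toFun i j) :=
  AddMonoidHomClass.continuous_of_bound (S.toFun i j) 1 fun a => by
    simpa using S.norm_toFun_le i j a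

/-- The composition of two systems of matrix units. -/
def comp (U : MatrixSystem Q R) (e : ℕ ≃ ℕ × ℕ) : MatrixSystem P R where
  toFun i j := (U.toFun (e i).1 (e j).1).comp (S.toFun (e i).2 (e j).2)
  mul_same i j l a b := by simp [U.mul_same, S.mul_same]
  mul_ne i j k l a b h := by
    simp only [LinearMap.comp_apply]
    by_cases h1 : (e j).1 = (e k).1
    · have h2 : (e j).2 ≠ (e k).2 := fun h2 => h (e.injective (Prod.ext h1 h2))
      rw [h1, U.mul_same, S.mul_ne _ _ _ _ _ _ h2, map_zero]
    · exact U.mul_ne _ _ _ _ _ _ h1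
  star_apply i j a := by simp [U.star_apply, S.star_apply]

variable {S}

theorem Faithful.comp (hS : S.Faithful) {U : MatrixSystem Q R} (hU : U.Faithful)
    (e : ℕ ≃ ℕ × ℕ) : (S.comp U e).Faithful :=
  fun _ _ => (hU _ _).comp (hS _ _)

/-- Generation enters only through closed additive subgroups. Such conditions can be pulled back one
index at a time, as composite and crossed systems require. -/
theorem Generates.mem_closed (hS : S.Generates) {C : AddSubgroup Q} (hC : IsClosed (C : Set Q))
    (h : ∀ i j a, S.toFun i j a ∈ C) (x : Q) : x ∈ C := by
  refine closure_minimal (s := (S.finite : Set Q)) (t := (C : Set Q)) ?_ hC (hS x)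
  rintro _ ⟨N, hN⟩
  obtain ⟨M, rfl⟩ := hN N le_rfl
  rw [hom_apply]
  exact sum_mem fun _ _ => sum_mem fun _ _ => h _ _ _

theorem generates_of_mem (h : ∀ C : AddSubgroup Q, IsClosed (C : Set Q) →
    (∀ i j a, S.toFun i j a ∈ C) → ∀ x, x ∈ C) : S.Generates := fun x =>
  h S.finite.toNonUnitalSubalgebra.toNonUnitalSubring.toAddSubgroup.topologicalClosure
    (AddSubgroup.isClosed_topologicalClosure _)
    (fun i j a => AddSubgroup.le_topologicalClosure _ (S.toFun_mem_finite i j a)) x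

theorem Generates.comp (hS : S.Generates) {U : MatrixSystem Q R} (hU : U.Generates)
    (e : ℕ ≃ ℕ × ℕ) : (S.comp U e).Generates := by
  refine generates_of_mem fun C hC h => hU.mem_closed hC fun i j b => ?_
  refine hS.mem_closed (C := C.comap (U.toFun i j).toAddMonoidHom)
    (hC.preimage (U.continuous_toFun i j)) (fun k l a => ?_) b
  have := h (e.symm (i, k)) (e.symm (j, l)) a
  simpa [MatrixSystem.comp] using this

variable (S)

/-- The system of matrix units that is conjugate to `S` by the isometry with columns
`∑ p, c p i • δ (τ p i)`. -/
def rotate (c : Fin 2 → ℕ → ℝ) (τ : Fin 2 → ℕ → ℕ)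
    (h : ∀ j k, (∑ q, ∑ r, if τ q j = τ r k then ((c q j * c r k : ℝ) : ℂ) else 0) =
      if j = k then 1 else 0) : MatrixSystem P Q :=
  -- In the product the inner two indices decouple from the outer two, and their sum is the inner
  -- product of the columns `j` and `k`, supplied by `h`.
  have key : ∀ i j k l a b, (∑ p, ∑ q, ((c p i * c q j : ℝ) : ℂ) • S.toFun (τ p i) (τ q j) a) *
      (∑ r, ∑ s, ((c r k * c s l : ℝ) : ℂ) • S.toFun (τ r k) (τ s l) b) =
      (if j = k then 1 else 0 : ℂ) •
        ∑ p, ∑ s, ((c p i * c s l : ℝ) : ℂ) • S.toFun (τ p i) (τ s l) (a * b) := by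
    intro i j k l a b
    have h1 : ∀ p q r s, (((c p i * c q j : ℝ) : ℂ) • S.toFun (τ p i) (τ q j) a) *
        (((c r k * c s l : ℝ) : ℂ) • S.toFun (τ r k) (τ s l) b) =
        (if τ q j = τ r k then ((c q j * c r k : ℝ) : ℂ) else 0) •
          ((c p i * c s l : ℝ) : ℂ) • S.toFun (τ p i) (τ s l) (a * b) := by
      intro p q r s
      rw [smul_mul_smul_comm]
      split_ifs with hqr
      · rw [hqr, S.mul_same, smul_smul]
        congr 1
        push_cast
        ring
      · rw [S.mul_ne _ _ _ _ _ _ hqr, smul_zero, zero_smul]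
    rw [← h j k]
    simp only [Finset.sum_mul_sum, Finset.sum_smul, Finset.smul_sum, h1]
    simp only [Fin.sum_univ_two]
    abel
  { toFun := fun i j => ∑ p, ∑ q, ((c p i * c q j : ℝ) : ℂ) • S.toFun (τ p i) (τ q j)
    mul_same := fun i j l a b => by simpa using key i j j l a b
    mul_ne := fun i j k l a b hjk => by simpa [hjk] using key i j k l a b
    star_apply := fun i j a => by
      simp only [LinearMap.sum_apply, LinearMap.smul_apply, star_sum, star_smul, S.star_apply]
      rw [Finset.sum_comm]
      simp [mul_comm] }

theorem rotate_apply (c : Fin 2 → ℕ → ℝ) (τ : Fin 2 → ℕ → ℕ) (h) (i j : ℕ) (a : P) :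
    (S.rotate c τ h).toFun i j a =
      ∑ p, ∑ q, ((c p i * c q j : ℝ) : ℂ) • S.toFun (τ p i) (τ q j) a := by
  simp [rotate]

end MatrixSystem

/-! ### Rotations of the stabilisation -/

section Rotation

/-- The angle by which the `i`-th basis vector is rotated at time `t`. -/
def rotAngle (t : ℝ) (i : ℕ) : ℝ :=
  -- The `i`-th angle grows from `0` at `t = 1 / (i + 2)` to `π / 2` at `t = 1 / (i + 1)`. These
  -- intervals have disjoint interiors and later vectors move first, so a vector has left its place
  -- before an earlier one is turned into it.
  Real.pi / 2 * max 0 (min 1 ((i + 1) * ((i + 2) * t - 1)))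

theorem continuous_rotAngle (i : ℕ) : Continuous fun t => rotAngle t i := by
  unfold rotAngle
  fun_prop

theorem rotAngle_zero (i : ℕ) : rotAngle 0 i = 0 := by
  have : min 1 (((i : ℝ) + 1) * ((i + 2) * 0 - 1)) ≤ 0 :=
    (min_le_right _ _).trans (by nlinarith [(Nat.cast_nonneg i : (0 : ℝ) ≤ i)])
  rw [rotAngle, max_eq_left this, mul_zero]

theorem rotAngle_one (i : ℕ) : rotAngle 1 i = Real.pi / 2 := by
  have h : (1 : ℝ) ≤ ((i : ℝ) + 1) * ((i + 2) * 1 - 1) := by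
    nlinarith [(Nat.cast_nonneg i : (0 : ℝ) ≤ i)]
  rw [rotAngle, min_eq_left h, max_eq_right zero_le_one, mul_one]

theorem rotAngle_eq_zero {t : ℝ} {i : ℕ} (h : (i + 2) * t ≤ 1) : rotAngle t i = 0 := by
  have : min 1 (((i : ℝ) + 1) * ((i + 2) * t - 1)) ≤ 0 :=
    (min_le_right _ _).trans (mul_nonpos_of_nonneg_of_nonpos (by positivity) (by linarith))
  rw [rotAngle, max_eq_left this, mul_zero]

theorem rotAngle_eq_pi_div_two {t : ℝ} {i : ℕ} (h : 1 ≤ (i + 1) * t) :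
    rotAngle t i = Real.pi / 2 := by
  have hi : (0 : ℝ) ≤ i := Nat.cast_nonneg i
  have h1 : (1 : ℝ) ≤ ((i : ℝ) + 1) * ((i + 2) * t - 1) := by nlinarith
  rw [rotAngle, min_eq_left h1, max_eq_right zero_le_one, mul_one]

/-- The coefficients of the image of the `i`-th basis vector at time `t`. -/
def rotCoeff (t : ℝ) (p : Fin 2) (i : ℕ) : ℝ :=
  if p = 0 then Real.cos (rotAngle t i) else Real.sin (rotAngle t i)

theorem continuous_rotCoeff (p : Fin 2) (i : ℕ) : Continuous fun t => rotCoeff t p i := by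
  have := continuous_rotAngle i
  unfold rotCoeff
  split_ifs <;> fun_prop

/-- The basis vectors that occur in the image of the `i`-th basis vector. -/
def rotIndex (p : Fin 2) (i : ℕ) : ℕ := if p = 0 then i else Nat.pair i 1

theorem lt_pair_one (i : ℕ) : i < Nat.pair i 1 := by
  unfold Nat.pair
  split_ifs <;> nlinarith

/-- Either the earlier vector `k` is still at rest, or the later vector `j` has completed its
quarter turn. -/
theorem cos_mul_sin_rotAngle {t : ℝ} {j k : ℕ} (h : k < j) :
    Real.cos (rotAngle t j) * Real.sin (rotAngle t k) = 0 := by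
  have hkj : (k : ℝ) + 1 ≤ j := by exact_mod_cast h
  by_cases h1 : (k + 2) * t ≤ 1
  · rw [rotAngle_eq_zero h1, Real.sin_zero, mul_zero]
  · rw [rotAngle_eq_pi_div_two (t := t) (i := j) (by
      have : 0 < t := by
        by_contra ht
        have : (0 : ℝ) ≤ k := Nat.cast_nonneg k
        nlinarith
      nlinarith), Real.cos_pi_div_two, zero_mul]

/-- Distinct columns can overlap only when one of `j` and `k` is the target position of the other.
Targets satisfy `pair i 1 > i`, so the overlap is a product that vanishes by the staggered timing.
-/
theorem rotCoeff_orthonormal (t : ℝ) (j k : ℕ) :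
    (∑ q, ∑ r, if rotIndex q j = rotIndex r k then ((rotCoeff t q j * rotCoeff t r k : ℝ) : ℂ)
      else 0) = if j = k then 1 else 0 := by
  have h1 : Nat.pair j 1 = Nat.pair k 1 ↔ j = k := by simp [Nat.pair_eq_pair]
  have h2 : (if j = Nat.pair k 1 then
      ((Real.cos (rotAngle t j) * Real.sin (rotAngle t k) : ℝ) : ℂ) else 0) = 0 := by
    split_ifs with h
    · rw [cos_mul_sin_rotAngle (h ▸ lt_pair_one k), Complex.ofReal_zero]
    · rfl
  have h3 : (if Nat.pair j 1 = k then
      ((Real.sin (rotAngle t j) * Real.cos (rotAngle t k) : ℝ) : ℂ) else 0) = 0 := by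
    split_ifs with h
    · rw [mul_comm, cos_mul_sin_rotAngle (h ▸ lt_pair_one j), Complex.ofReal_zero]
    · rfl
  simp only [Fin.sum_univ_two, rotIndex, rotCoeff, if_true, one_ne_zero, if_false, h1, h2, h3]
  split_ifs with h
  · subst h
    rw [add_zero, zero_add, ← Complex.ofReal_add, ← sq, ← sq, Real.cos_sq_add_sin_sq,
      Complex.ofReal_one]
  · simp

variable (A : Type u) [NonUnitalCStarAlgebra A] {B : Type u} [NonUnitalCStarAlgebra B]

/-- The rotated system of matrix units of the stabilisation. -/
def rotSystem (t : ℝ) : MatrixSystem A (Stab A) :=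
  (stabSystem A).rotate (rotCoeff t) rotIndex (rotCoeff_orthonormal t)

/-- The endomorphism of the stabilisation given by conjugation with an isometry. -/
def rotHom (t : ℝ) : Stab A →⋆ₙₐ[ℂ] Stab A :=
  MatrixSystem.lift (rotSystem A t) stabSystem_faithful stabSystem_generates

theorem rotSystem_zero (i j : ℕ) (a : A) : (rotSystem A 0).toFun i j a = stabUnit i j a := by
  refine ((stabSystem A).rotate_apply _ _ _ i j a).trans ?_
  simp [rotCoeff, rotIndex, rotAngle_zero, stabSystem_toFun]

theorem rotSystem_one (i j : ℕ) (a : A) :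
    (rotSystem A 1).toFun i j a = stabUnit (Nat.pair i 1) (Nat.pair j 1) a := by
  refine ((stabSystem A).rotate_apply _ _ _ i j a).trans ?_
  simp [rotCoeff, rotIndex, rotAngle_one, Fin.sum_univ_two, stabSystem_toFun]

theorem rotHom_stabHom (t : ℝ) (n : ℕ) (M : MatAlg n A) :
    rotHom A t ((stabSystem A).hom n M) = (rotSystem A t).hom n M :=
  MatrixSystem.lift_hom _ _ _ _ _

theorem rotHom_zero (x : Stab A) : rotHom A 0 x = x :=
  stabSystem_generates.eq_of_eqOn (continuous_starHom _) continuous_id (fun n M => by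
    rw [rotHom_stabHom]
    simp only [MatrixSystem.hom_apply, rotSystem_zero]
    rfl) x

theorem stabMap_rotHom (φ : A →⋆ₙₐ[ℂ] B) (t : ℝ) (x : Stab A) :
    stabMap φ (rotHom A t x) = rotHom B t (stabMap φ x) :=
  stabSystem_generates.eq_of_eqOn (f := fun x => stabMap φ (rotHom A t x))
    (g := fun x => rotHom B t (stabMap φ x))
    ((continuous_starHom _).comp (continuous_starHom _))
    ((continuous_starHom _).comp (continuous_starHom _)) (fun n M => by
    rw [rotHom_stabHom, stabMap_hom, rotHom_stabHom]
    simp only [MatrixSystem.hom_apply, rotSystem, MatrixSystem.rotate_apply, map_sum, map_smul,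
      stabSystem_toFun, stabMap_stabUnit, MatAlg.entry_map]) x

/-- On a finite matrix the rotation is a finite sum with continuous trigonometric coefficients.
Since all `rotHom` are contractive, a uniform approximation extends this to every `x`. -/
theorem continuous_rotHom_apply (x : Stab A) : Continuous fun t => rotHom A t x := by
  refine Metric.continuous_iff'.2 fun t₀ ε hε => ?_
  obtain ⟨n, M, hM⟩ := stabSystem_generates.exists_norm_lt x (show 0 < ε / 3 by positivity)
  have h1 : Continuous fun t => rotHom A t ((stabSystem A).hom n M) := by
    have h (t : ℝ) : rotHom A t ((stabSystem A).hom n M) =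
        ∑ p : Fin n, ∑ q : Fin n, ∑ r, ∑ s, ((rotCoeff t r p * rotCoeff t s q : ℝ) : ℂ) •
          (stabSystem A).toFun (rotIndex r p) (rotIndex s q) (M.entry p q) := by
      rw [rotHom_stabHom, MatrixSystem.hom_apply]
      simp only [rotSystem, MatrixSystem.rotate_apply]
    simp only [h]
    have hc := continuous_rotCoeff
    fun_prop
  have h2 : ∀ t, dist (rotHom A t ((stabSystem A).hom n M)) (rotHom A t x) < ε / 3 := fun t => by
    rw [dist_eq_norm, ← map_sub]
    exact (NonUnitalStarAlgHom.norm_apply_le _ _).trans_lt hM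
  filter_upwards [Metric.continuous_iff'.1 h1 t₀ (ε / 3) (by positivity)] with t ht
  have h3 := h2 t
  have h4 := h2 t₀
  rw [dist_comm] at h3
  linarith [dist_triangle4 (rotHom A t x) (rotHom A t ((stabSystem A).hom n M))
    (rotHom A t₀ ((stabSystem A).hom n M)) (rotHom A t₀ x)]

theorem continuous_rotHom : Continuous fun p : ℝ × Stab A => rotHom A p.1 p.2 := by
  refine continuous_iff_continuousAt.2 fun p => ?_
  have h0 : ∀ q : ℝ × Stab A, dist (rotHom A q.1 q.2) (rotHom A p.1 p.2) ≤
      dist q.2 p.2 + dist (rotHom A q.1 p.2) (rotHom A p.1 p.2) := fun q => by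
    refine (dist_triangle _ (rotHom A q.1 p.2) _).trans (add_le_add ?_ le_rfl)
    rw [dist_eq_norm, dist_eq_norm, ← map_sub]
    exact NonUnitalStarAlgHom.norm_apply_le _ _
  refine tendsto_iff_dist_tendsto_zero.2 (squeeze_zero (fun _ => dist_nonneg) h0 ?_)
  have h : Continuous fun q : ℝ × Stab A =>
      dist q.2 p.2 + dist (rotHom A q.1 p.2) (rotHom A p.1 p.2) := by
    have := (continuous_rotHom_apply A p.2).comp (continuous_fst (X := ℝ) (Y := Stab A))
    exact (continuous_snd.dist continuous_const).add (this.dist continuous_const)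
  simpa using h.tendsto p

/-- The bijection `ℕ ≃ ℕ × ℕ` that maps `pair i 1` to `(i, 0)`. -/
def pairSwap : ℕ ≃ ℕ × ℕ :=
  Nat.pairEquiv.symm.trans ((Equiv.refl ℕ).prodCongr (Equiv.swap 0 1))

theorem pairSwap_pair (i : ℕ) : pairSwap (Nat.pair i 1) = (i, 0) := by
  simp [pairSwap]

/-- The system of matrix units of the iterated stabilisation. -/
def doubleSystem : MatrixSystem A (Stab (Stab A)) :=
  (stabSystem A).comp (stabSystem (Stab A)) pairSwap

/-- The isomorphism between the stabilisation and the iterated stabilisation. -/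
def doubleHom : Stab A →⋆ₙₐ[ℂ] Stab (Stab A) :=
  MatrixSystem.lift (doubleSystem A) stabSystem_faithful stabSystem_generates

/-- Both `K ⊗ A` and `K ⊗ (K ⊗ A)` are generated by faithful matrix units over `A`, the latter
indexed by `ℕ × ℕ`. -/
theorem doubleHom_bijective : Function.Bijective (doubleHom A) :=
  MatrixSystem.lift_bijective _ _ _ (stabSystem_faithful.comp stabSystem_faithful _)
    (stabSystem_generates.comp stabSystem_generates _)

theorem doubleHom_stabUnit (i j : ℕ) (a : A) : doubleHom A (stabUnit i j a) =
    stabUnit (pairSwap i).1 (pairSwap j).1 (stabUnit (pairSwap i).2 (pairSwap j).2 a) :=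
  MatrixSystem.lift_toFun (S := stabSystem A) (doubleSystem A) _ _ i j a

theorem stabHom_ext {D : Type u} [NonUnitalCStarAlgebra D] {φ ψ : Stab A →⋆ₙₐ[ℂ] D}
    (h : ∀ i j a, φ (stabUnit i j a) = ψ (stabUnit i j a)) (x : Stab A) : φ x = ψ x :=
  stabSystem_generates.eq_of_eqOn (continuous_starHom _) (continuous_starHom _) (fun n M => by
    simp only [MatrixSystem.hom_apply, map_sum, stabSystem_toFun, h]) x

theorem stabMap_doubleHom (φ : A →⋆ₙₐ[ℂ] B) (x : Stab A) :
    stabMap (stabMap φ) (doubleHom A x) = doubleHom B (stabMap φ x) :=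
  stabHom_ext A (φ := (stabMap (stabMap φ)).comp (doubleHom A))
    (ψ := (doubleHom B).comp (stabMap φ)) (fun i j a => by
      simp only [NonUnitalStarAlgHom.comp_apply, doubleHom_stabUnit, stabMap_stabUnit]) x

/-- The upper left corner embedding `A → K ⊗ A`. -/
def cornerHom : A →⋆ₙₐ[ℂ] Stab A where
  toFun := stabUnit 0 0
  map_smul' := map_smul ((stabSystem A).toFun 0 0)
  map_zero' := map_zero ((stabSystem A).toFun 0 0)
  map_add' := map_add ((stabSystem A).toFun 0 0)
  map_mul' a b := ((stabSystem A).mul_same 0 0 0 a b).symm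
  map_star' a := ((stabSystem A).star_apply 0 0 a).symm

/-- At time one the rotation puts `e_ij ⊗ a` at the positions `pair i 1`, `pair j 1`, which
`pairSwap` sends to `(i, 0)`, `(j, 0)`, giving `e_ij ⊗ (e_00 ⊗ a)`. So the stabilised corner
embedding is homotopic to the isomorphism `doubleHom`. -/
theorem stabMap_cornerHom (x : Stab A) :
    stabMap (cornerHom A) x = doubleHom A (rotHom A 1 x) :=
  stabHom_ext A (φ := stabMap (cornerHom A)) (ψ := (doubleHom A).comp (rotHom A 1))
    (fun i j a => by
      have h : rotHom A 1 (stabUnit i j a) = (rotSystem A 1).toFun i j a :=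
        MatrixSystem.lift_toFun (S := stabSystem A) (rotSystem A 1) _ _ i j a
      rw [NonUnitalStarAlgHom.comp_apply, h, rotSystem_one, doubleHom_stabUnit, pairSwap_pair,
        pairSwap_pair, stabMap_stabUnit]
      rfl) x

end Rotation

/-! ### Stability of K-theory -/

theorem continuous_entry {A : Type u} [NonUnitalCStarAlgebra A] {n : ℕ} (p q : Fin n) :
    Continuous fun M : MatAlg n A => M.entry p q :=
  letI := CStarAlgebra.spectralOrder A
  haveI := CStarAlgebra.spectralOrderedRing A
  (continuous_apply_apply p q : Continuous fun M : Fin n → Fin n → A => M p q)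

section Stability

variable {S T : Tower.{u}}

/-- A homotopy of endomorphisms of a tower. -/
structure TowerHomotopy (S : Tower.{u}) where
  app : ℝ → ∀ n, (S.obj n).carrier →⋆ₙₐ[ℂ] (S.obj n).carrier
  comm : ∀ t n x, app t n (S.map n x) = S.map n (app t (n + 1) x)
  continuous_app : ∀ n, Continuous fun p : ℝ × (S.obj n).carrier => app p.1 n p.2
  zero : ∀ n x, app 0 n x = x

/-- The homotopy of endomorphisms of the tower of matrix algebras. -/
def TowerHomotopy.mat2 (H : TowerHomotopy S) : TowerHomotopy S.mat2 where
  app t n := MatAlg.map 2 (H.app t n)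
  comm t n _ := MatAlg.ext fun _ _ => H.comm t n _
  continuous_app n := MatAlg.continuous_of (f := fun (z : ℝ × MatAlg 2 (S.obj n).carrier) p q =>
      H.app z.1 n (MatAlg.entry z.2 p q))
    fun p q => (H.continuous_app n).comp (continuous_fst.prodMk
      ((continuous_entry p q).comp continuous_snd))
  zero n _ := MatAlg.ext fun _ _ => H.zero n _

/-- The endomorphism at a given time of a homotopy. -/
def TowerHomotopy.at (H : TowerHomotopy S) (t : ℝ) : TowerHom S S := ⟨H.app t, H.comm t⟩

theorem TowerHomotopy.loop_homotopic (H : TowerHomotopy S) {d : ℕ}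
    (f : GenLoop (Fin d) S.Unitaries S.base) : GenLoop.Homotopic f ((H.at 1).loop f) := by
  have hc : Continuous fun p : unitInterval × (Fin d → unitInterval) =>
      (H.at p.1).unitaries (f p.2) := by
    refine Tower.continuous_unitaries_iff.2 fun n => ?_
    exact (H.continuous_app n).comp ((continuous_subtype_val.comp continuous_fst).prodMk
      ((Tower.continuous_unitaries_iff.1 f.1.continuous n).comp continuous_snd))
  refine homotopic_of_map ⟨_, hc⟩ (fun w => ?_) (fun w => ?_) fun s w hw => ?_
  · exact Tower.Unitaries.ext fun n => H.zero n _
  · exact Tower.Unitaries.ext fun _ => rfl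
  · exact (congrArg _ (f.2 w hw)).trans (H.at s).unitaries_base

/-- A morphism of towers is stable if it is the composition of the endpoint of a homotopy that
starts with the identity and an isomorphism. -/
structure StableHom (φ : TowerHom S T) where
  homotopy : TowerHomotopy S
  iso : TowerHom S T
  bijective : ∀ n, Function.Bijective (iso.app n)
  eq : ∀ n x, φ.app n x = iso.app n (homotopy.app 1 n x)

def StableHom.mat2 {φ : TowerHom S T} (h : StableHom φ) : StableHom φ.mat2 where
  homotopy := h.homotopy.mat2
  iso := h.iso.mat2
  bijective n := ⟨matAlg_map_injective (h.bijective n).1 2, matAlg_map_surjective (h.bijective n).2 2⟩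
  eq n x := MatAlg.ext fun p q => h.eq n (MatAlg.entry x p q)

/-- The endpoint of a homotopy from the identity does not change the classes of loops, and the
remaining factor is an isomorphism. -/
theorem StableHom.loopBijective {φ : TowerHom S T} (h : StableHom φ) : φ.LoopBijective := by
  have hiso : h.iso.LoopBijective :=
    .of_homeomorph (TowerHom.exists_homeomorph 0 _ fun n _ => h.bijective n)
  have h1 : ∀ {d : ℕ} (f : GenLoop (Fin d) S.Unitaries S.base),
      φ.loop f = h.iso.loop ((h.homotopy.at 1).loop f) := fun f =>
    GenLoop.ext _ _ fun _ => Tower.Unitaries.ext fun n => h.eq n _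
  refine ⟨fun f hf => ?_, fun g => ?_⟩
  · rw [h1] at hf
    exact (h.homotopy.loop_homotopic f).trans (hiso.injective _ hf)
  · obtain ⟨f, hf⟩ := hiso.surjective g
    refine ⟨f, ?_⟩
    rw [h1]
    exact (h.iso.loop_homotopic (h.homotopy.loop_homotopic f).symm).trans hf

def StableHom.stage {φ : TowerHom S T} (h : StableHom φ.stab) : ∀ k, StableHom (φ.stage k)
  | 0 => h
  | k + 1 => (StableHom.stage h k).mat2

/-- The corner embedding of a tower into its stabilisation. -/
def Tower.corner (T : Tower.{u}) : TowerHom T T.stab where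
  app n := cornerHom (T.obj n).carrier
  comm n x := (stabMap_stabUnit (T.map n) 0 0 x).symm

def Tower.stableCorner (T : Tower.{u}) : StableHom T.corner.stab where
  homotopy :=
    { app := fun t n => rotHom (T.obj n).carrier t
      comm := fun t n x => (stabMap_rotHom _ (T.map n) t x).symm
      continuous_app := fun _ => continuous_rotHom _
      zero := fun _ x => rotHom_zero _ x }
  iso :=
    { app := fun n => doubleHom (T.obj n).carrier
      comm := fun n x => (stabMap_doubleHom _ (T.map n) x).symm }
  bijective _ := doubleHom_bijective _
  eq _ x := stabMap_cornerHom _ x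

theorem Tower.kMap_corner_bijective (T : Tower.{u}) (m : ℤ) :
    Function.Bijective (T.corner.kMap m) :=
  TowerHom.kMap_bijective (fun k => (T.stableCorner.stage k).loopBijective) m

end Stability

/-! ### Norm estimates in crossed products -/

namespace CrossedProductFunctor

variable {G : Type v} [Group G] (μ : CrossedProductFunctor.{u, v} G) {A A' : GCStarAlg.{u, v} G}

/-- The canonical map from the coefficient algebra to the crossed product. -/
def coeffHom (A : GCStarAlg.{u, v} G) : A.carrier →⋆ₙₐ[ℂ] (μ.obj A).carrier where
  toFun a := μ.incl A (Finsupp.single 1 a)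
  map_smul' c a := by rw [← Finsupp.smul_single, map_smul]; rfl
  map_zero' := by rw [Finsupp.single_zero, map_zero]
  map_add' a b := by rw [Finsupp.single_add, map_add]
  map_mul' a b := by rw [μ.incl_mul, A.act_one, one_mul]
  map_star' a := by rw [μ.incl_star, inv_one, A.act_one]

theorem norm_act (A : GCStarAlg.{u, v} G) (g : G) (a : A.carrier) : ‖A.act g a‖ = ‖a‖ := by
  refine le_antisymm (NonUnitalStarAlgHom.norm_apply_le _ _) ?_
  have h : A.act g⁻¹ (A.act g a) = a := by rw [← A.act_mul, inv_mul_cancel, A.act_one]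
  conv_lhs => rw [← h]
  exact NonUnitalStarAlgHom.norm_apply_le _ _

/-- By the C*-identity the norm is that of an element of the coefficient algebra, on which the
canonical star-homomorphism is contractive. -/
theorem norm_incl_single_le (g : G) (a : A.carrier) :
    ‖μ.incl A (Finsupp.single g a)‖ ≤ ‖a‖ := by
  have h : star (μ.incl A (Finsupp.single g a)) * μ.incl A (Finsupp.single g a) =
      μ.coeffHom A (A.act g⁻¹ (star a * a)) := by
    rw [μ.incl_star, μ.incl_mul, inv_mul_cancel, ← map_mul]
    rfl
  have h1 := (NonUnitalStarAlgHom.norm_apply_le (μ.coeffHom A) (A.act g⁻¹ (star a * a)))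
  rw [← h, norm_act, CStarRing.norm_star_mul_self, CStarRing.norm_star_mul_self] at h1
  exact (mul_self_le_mul_self_iff (norm_nonneg _) (norm_nonneg _)).2 h1

theorem sq_norm_le_l2NormSq {B : Type u} [NonUnitalCStarAlgebra B] (ζ : G →₀ B) (g : G) :
    ‖ζ g‖ ^ 2 ≤ l2NormSq ζ := by
  let := CStarAlgebra.spectralOrder B
  have := CStarAlgebra.spectralOrderedRing B
  by_cases hg : ζ g = 0
  · have : 0 ≤ l2NormSq ζ := norm_nonneg _
    simpa [hg] using this
  · rw [sq, ← CStarRing.norm_star_mul_self]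
    exact CStarAlgebra.norm_le_norm_of_nonneg_of_le (star_mul_self_nonneg _)
      (Finset.single_le_sum (f := fun g => star (ζ g) * ζ g) (fun _ _ => star_mul_self_nonneg _)
        (Finsupp.mem_support_iff.2 hg))

theorem regularRep_single (f : G →₀ A.carrier) (b : A.carrier) (g : G) :
    regularRep A f (Finsupp.single 1 b) g = A.act g⁻¹ (f g) * b := by
  classical
  have h : regularRep A f (Finsupp.single 1 b) =
      f.sum fun g a => Finsupp.single g (A.act g⁻¹ a * b) := by
    refine Finsupp.sum_congr fun g _ => ?_
    rw [Finsupp.sum_single_index (by simp), mul_one]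
  rw [h, Finsupp.sum_apply, Finsupp.sum, Finset.sum_eq_single g]
  · rw [Finsupp.single_eq_same]
  · intro k _ hk
    rw [Finsupp.single_eq_of_ne (by simpa [eq_comm] using hk)]
  · intro hg
    rw [Finsupp.notMem_support_iff.1 hg, map_zero, zero_mul, Finsupp.single_zero]
    rfl

/-- Applying the regular representation of `f` to a vector concentrated at `1` displays the
coefficient at `g`, up to the action. Thus even the reduced norm dominates every coefficient. -/
theorem norm_coeff_le (f : G →₀ A.carrier) (g : G) : ‖f g‖ ≤ ‖μ.incl A f‖ := by
  set c := A.act g⁻¹ (f g) with hc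
  have h1 : ‖c‖ = ‖f g‖ := norm_act A _ _
  -- With the test vector `star c` the estimate reads `‖c‖⁴ ≤ ‖f‖² ‖c‖²` in the crossed product norm
  -- of `f`, and `‖c‖²` cancels.
  have h2 := (sq_norm_le_l2NormSq _ g).trans (μ.reduced_le A f (Finsupp.single 1 (star c)))
  rw [regularRep_single, ← hc, CStarRing.norm_self_mul_star, l2NormSq,
    Finsupp.sum_single_index (by simp), CStarRing.norm_star_mul_self, norm_star, h1] at h2
  by_cases h0 : ‖f g‖ = 0
  · rw [h0]
    exact norm_nonneg _
  · have h3 : 0 < ‖f g‖ := lt_of_le_of_ne (norm_nonneg _) (Ne.symm h0)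
    have h4 : ‖f g‖ ^ 2 ≤ ‖μ.incl A f‖ ^ 2 := by
      have : 0 < ‖f g‖ * ‖f g‖ := by positivity
      nlinarith
    exact (sq_le_sq₀ h3.le (norm_nonneg _)).1 h4

theorem ext_single {D : Type*} [AddGroup D] [TopologicalSpace D] [T2Space D]
    {f g : (μ.obj A).carrier → D} (hf : Continuous f) (hg : Continuous g)
    (hfa : ∀ x y, f (x + y) = f x + f y) (hga : ∀ x y, g (x + y) = g x + g y)
    (h : ∀ k a, f (μ.incl A (Finsupp.single k a)) = g (μ.incl A (Finsupp.single k a)))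
    (x : (μ.obj A).carrier) : f x = g x := by
  refine congrFun ((μ.dense A).equalizer hf hg (funext fun ξ => ?_)) x
  have hf0 : f 0 = 0 := by simpa using hfa 0 0
  have hg0 : g 0 = 0 := by simpa using hga 0 0
  simp only [Function.comp_apply]
  induction ξ using Finsupp.induction_linear with
  | zero => rw [map_zero, hf0, hg0]
  | add ξ η h1 h2 => rw [map_add, hfa, hga, h1, h2]
  | single k a => exact h k a

theorem mem_of_single {C : AddSubgroup (μ.obj A).carrier} (hC : IsClosed (C : Set (μ.obj A).carrier))
    (h : ∀ g a, μ.incl A (Finsupp.single g a) ∈ C) (x : (μ.obj A).carrier) : x ∈ C := by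
  refine (μ.dense A).induction_on (p := fun x => x ∈ C) x hC fun ξ => ?_
  induction ξ using Finsupp.induction_linear with
  | zero => rw [map_zero]; exact C.zero_mem
  | add ξ η h1 h2 => rw [map_add]; exact C.add_mem h1 h2
  | single k a => exact h k a

theorem norm_incl_le {S : Finset G} {f : G →₀ A.carrier} (h : ∀ g, g ∉ S → f g = 0) {r : ℝ}
    (hr : ∀ g, ‖f g‖ ≤ r) : ‖μ.incl A f‖ ≤ S.card * r := by
  have h1 : f = ∑ g ∈ S, Finsupp.single g (f g) := by
    classical
    ext k
    rw [Finsupp.finsetSum_apply, Finset.sum_eq_single k]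
    · rw [Finsupp.single_eq_same]
    · intro g _ hg
      exact Finsupp.single_eq_of_ne (by simpa [eq_comm] using hg)
    · intro hk
      rw [h k hk, Finsupp.single_zero]
      rfl
  rw [h1, map_sum]
  refine (norm_sum_le_of_le S fun g _ => (μ.norm_incl_single_le g (f g)).trans (hr g)).trans ?_
  rw [Finset.sum_const, nsmul_eq_mul]

/-- The element `b x c` has coefficients only in `S`. On such elements every admissible norm lies
between the largest coefficient and `card S` times it, and `φ` preserves norms of coefficients. -/
theorem norm_compress_le (φ : GHom A A') (hφ : Function.Injective φ.hom) {b c : A.carrier}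
    {S : Finset G} (hS : ∀ g, g ∉ S → ∀ a, b * a * A.act g c = 0) (x : (μ.obj A).carrier) :
    ‖μ.coeffHom A b * x * μ.coeffHom A c‖ ≤
      S.card * ‖μ.map φ (μ.coeffHom A b * x * μ.coeffHom A c)‖ := by
  have hc := continuous_starHom (μ.map φ)
  refine (μ.dense A).induction_on x (isClosed_le (by fun_prop) (by fun_prop)) fun f => ?_
  have h1 : ∃ f' : G →₀ A.carrier, μ.incl A f' = μ.coeffHom A b * μ.incl A f * μ.coeffHom A c ∧
      ∀ g, g ∉ S → f' g = 0 := by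
    induction f using Finsupp.induction_linear with
    | zero => exact ⟨0, by simp, fun _ _ => rfl⟩
    | add f₁ f₂ h₁ h₂ =>
      obtain ⟨f₁', h1, h2⟩ := h₁
      obtain ⟨f₂', h3, h4⟩ := h₂
      refine ⟨f₁' + f₂', by rw [map_add, map_add, mul_add, add_mul, h1, h3], fun g hg => ?_⟩
      rw [Finsupp.add_apply, h2 g hg, h4 g hg, add_zero]
    | single k a =>
      refine ⟨Finsupp.single k (b * a * A.act k c), ?_, fun g hg => ?_⟩
      · change _ = μ.incl A _ * μ.incl A _ * μ.incl A _
        rw [μ.incl_mul, μ.incl_mul, A.act_one, one_mul, mul_one]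
      · classical
        rw [Finsupp.single_apply]
        split_ifs with hk
        · subst hk
          exact hS _ hg a
        · rfl
  obtain ⟨f', h2, h3⟩ := h1
  rw [← h2]
  refine μ.norm_incl_le h3 fun g => ?_
  rw [μ.map_incl, ← NonUnitalStarAlgHom.norm_map φ.hom hφ]
  exact μ.norm_coeff_le (f'.mapRange φ.hom (map_zero φ.hom)) g

/-- An element `x` of the kernel satisfies `b x c = 0` for all cut-offs `b` and `c`, by the norm
comparison on finitely supported compressions. Cut-offs approximate a unit on both sides, so they
can be removed one after the other. -/
theorem map_injective_of_proper (φ : GHom A A') (hφ : Function.Injective φ.hom)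
    (D : Set A.carrier)
    (hfin : ∀ b ∈ D, ∀ c ∈ D, ∃ S : Finset G, ∀ g, g ∉ S → ∀ a, b * a * A.act g c = 0)
    (hl : ∀ a, ∀ ε > 0, ∃ c ∈ D, ‖c * a - a‖ ≤ ε) (hr : ∀ a, ∀ ε > 0, ∃ c ∈ D, ‖a * c - a‖ ≤ ε) :
    Function.Injective (μ.map φ) := by
  rw [injective_iff_map_eq_zero]
  intro x hx
  have h1 : ∀ b ∈ D, ∀ c ∈ D, μ.coeffHom A b * x * μ.coeffHom A c = 0 := by
    intro b hb c hc
    obtain ⟨S, hS⟩ := hfin b hb c hc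
    have := μ.norm_compress_le φ hφ hS x
    rw [map_mul, map_mul, hx, mul_zero, zero_mul, norm_zero, mul_zero] at this
    exact norm_le_zero_iff.1 this
  have h2 : ∀ b ∈ D, μ.coeffHom A b * x = 0 := by
    intro b hb
    -- An element that annihilates every generator by right multiplication annihilates its own
    -- adjoint, hence is zero; the same device removes `b` afterwards.
    have h3 := μ.ext_single (f := fun z => μ.coeffHom A b * x * z) (g := fun _ => 0) (by fun_prop)
      continuous_const (fun _ _ => mul_add _ _ _) (fun _ _ => (add_zero _).symm) (fun k a => ?_)
      (star (μ.coeffHom A b * x))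
    · exact (CStarRing.mul_star_self_eq_zero_iff _).1 h3
    · refine norm_le_zero_iff.1 (le_of_forall_pos_le_add fun ε hε => ?_)
      obtain ⟨c, hc, hca⟩ := hl a (ε / (‖μ.coeffHom A b * x‖ + 1)) (by positivity)
      have h4 : μ.coeffHom A c * μ.incl A (Finsupp.single k a) =
          μ.incl A (Finsupp.single k (c * a)) := by
        change μ.incl A _ * _ = _
        rw [μ.incl_mul, A.act_one, one_mul]
      have h5 : μ.coeffHom A b * x * μ.incl A (Finsupp.single k a) =
          -(μ.coeffHom A b * x * μ.incl A (Finsupp.single k (c * a - a))) := by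
        rw [Finsupp.single_sub, map_sub, mul_sub, ← h4, ← mul_assoc, h1 b hb c hc, zero_mul,
          zero_sub, neg_neg]
      rw [h5, norm_neg, zero_add]
      calc _ ≤ ‖μ.coeffHom A b * x‖ * (ε / (‖μ.coeffHom A b * x‖ + 1)) :=
            (norm_mul_le _ _).trans (by
              gcongr
              exact (μ.norm_incl_single_le _ _).trans hca)
        _ ≤ (‖μ.coeffHom A b * x‖ + 1) * (ε / (‖μ.coeffHom A b * x‖ + 1)) := by
            gcongr
            linarith
        _ = ε := by field_simp
  have h3 := μ.ext_single (f := fun z => z * x) (g := fun _ => 0) (by fun_prop)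
    continuous_const (fun _ _ => add_mul _ _ _) (fun _ _ => (add_zero _).symm) (fun k a => ?_)
    (star x)
  · exact (CStarRing.star_mul_self_eq_zero_iff _).1 h3
  · refine norm_le_zero_iff.1 (le_of_forall_pos_le_add fun ε hε => ?_)
    obtain ⟨c, hc, hca⟩ := hr (A.act k⁻¹ a) (ε / (‖x‖ + 1)) (by positivity)
    have h4 : μ.incl A (Finsupp.single k a) * μ.coeffHom A c =
        μ.incl A (Finsupp.single k (a * A.act k c)) := by
      change _ * μ.incl A _ = _
      rw [μ.incl_mul, mul_one]
    have h5 : μ.incl A (Finsupp.single k a) * x =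
        -(μ.incl A (Finsupp.single k (a * A.act k c - a)) * x) := by
      rw [Finsupp.single_sub, map_sub, sub_mul, ← h4, mul_assoc, h2 c hc, mul_zero,
        zero_sub, neg_neg]
    have h6 : ‖a * A.act k c - a‖ ≤ ε / (‖x‖ + 1) := by
      rw [← norm_act A k⁻¹, map_sub, map_mul, ← A.act_mul, inv_mul_cancel, A.act_one]
      exact hca
    rw [h5, norm_neg, zero_add]
    calc _ ≤ (ε / (‖x‖ + 1)) * ‖x‖ :=
          (norm_mul_le _ _).trans (by
            gcongr
            exact (μ.norm_incl_single_le _ _).trans h6)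
      _ ≤ (ε / (‖x‖ + 1)) * (‖x‖ + 1) := by
          gcongr
          linarith
      _ = ε := by field_simp

end CrossedProductFunctor

/-! ### Systems of matrix units in crossed products -/

namespace MatrixSystem

variable {G : Type v} [Group G] (μ : CrossedProductFunctor.{u, v} G) {A A' : GCStarAlg.{u, v} G}
  (S : MatrixSystem A.carrier A'.carrier)

/-- A system of equivariant matrix units. -/
def Equivariant : Prop := ∀ g i j a, A'.act g (S.toFun i j a) = S.toFun i j (A.act g a)

variable {S}

/-- The equivariant star-homomorphism given by a diagonal matrix unit. -/
def Equivariant.diag (hS : S.Equivariant) (j : ℕ) : GHom A A' where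
  hom :=
    { toFun := S.toFun j j
      map_smul' := map_smul _
      map_zero' := map_zero _
      map_add' := map_add _
      map_mul' := fun a b => (S.mul_same j j j a b).symm
      map_star' := fun a => (S.star_apply j j a).symm }
  equivariant g a := (hS g j j a).symm

variable (S) in
/-- The entrywise application of a matrix unit to the convolution algebra. -/
def convMap (i j : ℕ) : (G →₀ A.carrier) →ₗ[ℂ] (μ.obj A').carrier :=
  (μ.incl A').comp (Finsupp.mapRange.linearMap (S.toFun i j))

theorem convMap_single (i j : ℕ) (g : G) (a : A.carrier) :
    S.convMap μ i j (Finsupp.single g a) = μ.incl A' (Finsupp.single g (S.toFun i j a)) := by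
  simp [convMap]

/-- Off-diagonal units are not homomorphisms, so functoriality does not bound them directly. The
relation `e_ij(f)^* e_ij(f') = e_jj(f^* f')` reduces their norm to a diagonal unit, which is induced
by an equivariant homomorphism. -/
theorem Equivariant.star_convMap_mul (hS : S.Equivariant) (i j : ℕ) (f f' : G →₀ A.carrier) :
    star (S.convMap μ i j f) * S.convMap μ i j f' =
      μ.map (hS.diag j) (star (μ.incl A f) * μ.incl A f') := by
  induction f using Finsupp.induction_linear with
  | zero => simp
  | add f₁ f₂ h₁ h₂ => simp only [map_add, star_add, add_mul, h₁, h₂]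
  | single g a =>
    induction f' using Finsupp.induction_linear with
    | zero => simp
    | add f₁ f₂ h₁ h₂ => simp only [map_add, mul_add, h₁, h₂]
    | single h b =>
      rw [convMap_single, convMap_single, μ.incl_star, μ.incl_mul, μ.incl_star, μ.incl_mul,
        μ.map_incl, Finsupp.mapRange_single, ← map_mul, ← map_mul, S.star_apply, S.mul_same, hS]
      rfl

theorem Equivariant.norm_convMap_le (hS : S.Equivariant) (i j : ℕ) (f : G →₀ A.carrier) :
    ‖S.convMap μ i j f‖ ≤ 1 * ‖μ.incl A f‖ := by
  have h := NonUnitalStarAlgHom.norm_apply_le (μ.map (hS.diag j)) (star (μ.incl A f) * μ.incl A f)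
  rw [← hS.star_convMap_mul μ i j, CStarRing.norm_star_mul_self, CStarRing.norm_star_mul_self] at h
  rw [one_mul]
  exact (mul_self_le_mul_self_iff (norm_nonneg _) (norm_nonneg _)).2 h

theorem Equivariant.extend_incl (hS : S.Equivariant) (i j : ℕ) (f : G →₀ A.carrier) :
    (S.convMap μ i j).extendOfNorm (μ.incl A) (μ.incl A f) = S.convMap μ i j f :=
  LinearMap.extendOfNorm_eq (μ.dense A) ⟨1, hS.norm_convMap_le μ i j⟩ f

theorem Equivariant.extend_single (hS : S.Equivariant) (i j : ℕ) (g : G) (a : A.carrier) :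
    (S.convMap μ i j).extendOfNorm (μ.incl A) (μ.incl A (Finsupp.single g a)) =
      μ.incl A' (Finsupp.single g (S.toFun i j a)) := by
  rw [hS.extend_incl, convMap_single]

/-- The system of matrix units induced on crossed products. -/
def Equivariant.crossed (hS : S.Equivariant) :
    MatrixSystem (μ.obj A).carrier (μ.obj A').carrier where
  toFun i j := ((S.convMap μ i j).extendOfNorm (μ.incl A)).toLinearMap
  mul_same i j l x y := by
    simp only [ContinuousLinearMap.coe_coe]
    refine μ.ext_single (f := fun x => (S.convMap μ i j).extendOfNorm (μ.incl A) x *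
      (S.convMap μ j l).extendOfNorm (μ.incl A) y)
      (g := fun x => (S.convMap μ i l).extendOfNorm (μ.incl A) (x * y)) (by fun_prop) (by fun_prop)
      (fun _ _ => by rw [map_add, add_mul]) (fun _ _ => by rw [add_mul, map_add]) (fun g a => ?_) x
    refine μ.ext_single (f := fun y => (S.convMap μ i j).extendOfNorm (μ.incl A) _ *
      (S.convMap μ j l).extendOfNorm (μ.incl A) y)
      (g := fun y => (S.convMap μ i l).extendOfNorm (μ.incl A) (_ * y)) (by fun_prop) (by fun_prop)
      (fun _ _ => by rw [map_add, mul_add]) (fun _ _ => by rw [mul_add, map_add]) (fun h b => ?_) y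
    rw [hS.extend_single, hS.extend_single, μ.incl_mul, μ.incl_mul, hS.extend_single, hS,
      S.mul_same]
  mul_ne i j k l x y hjk := by
    simp only [ContinuousLinearMap.coe_coe]
    refine μ.ext_single (f := fun x => (S.convMap μ i j).extendOfNorm (μ.incl A) x *
      (S.convMap μ k l).extendOfNorm (μ.incl A) y)
      (g := fun x => 0) (by fun_prop) (by fun_prop)
      (fun _ _ => by rw [map_add, add_mul]) (fun _ _ => (add_zero _).symm) (fun g a => ?_) x
    refine μ.ext_single (f := fun y => (S.convMap μ i j).extendOfNorm (μ.incl A) _ *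
      (S.convMap μ k l).extendOfNorm (μ.incl A) y)
      (g := fun y => 0) (by fun_prop) (by fun_prop)
      (fun _ _ => by rw [map_add, mul_add]) (fun _ _ => (add_zero _).symm) (fun h b => ?_) y
    rw [hS.extend_single, hS.extend_single, μ.incl_mul, hS, S.mul_ne _ _ _ _ _ _ hjk,
      Finsupp.single_zero, map_zero]
  star_apply i j x := by
    simp only [ContinuousLinearMap.coe_coe]
    refine μ.ext_single (f := fun x => star ((S.convMap μ i j).extendOfNorm (μ.incl A) x))
      (g := fun x => (S.convMap μ j i).extendOfNorm (μ.incl A) (star x)) (by fun_prop)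
      (by fun_prop) (fun _ _ => by rw [map_add, star_add]) (fun _ _ => by rw [star_add, map_add])
      (fun g a => ?_) x
    rw [hS.extend_single, μ.incl_star, μ.incl_star, hS.extend_single, S.star_apply, hS]

theorem Equivariant.crossed_single (hS : S.Equivariant) (i j : ℕ) (g : G) (a : A.carrier) :
    (hS.crossed μ).toFun i j (μ.incl A (Finsupp.single g a)) =
      μ.incl A' (Finsupp.single g (S.toFun i j a)) := hS.extend_single μ i j g a

/-- A closed subgroup containing the crossed units contains the elements `e_ij(a)` placed at each
`g`, hence all elements of `A'` placed at `g`, and these span a dense subgroup. -/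
theorem Equivariant.crossed_generates (hS : S.Equivariant) (hS' : S.Generates) :
    (hS.crossed μ).Generates := by
  refine generates_of_mem fun C hC h => μ.mem_of_single hC fun g a => ?_
  have hc : Continuous fun a : A'.carrier => μ.incl A' (Finsupp.single g a) :=
    AddMonoidHomClass.continuous_of_bound
      ((μ.incl A').toAddMonoidHom.comp (Finsupp.singleAddHom g)) 1 fun a => by
        simpa using μ.norm_incl_single_le g a
  refine hS'.mem_closed (C := C.comap ((μ.incl A').toAddMonoidHom.comp (Finsupp.singleAddHom g)))
    (hC.preimage hc) (fun i j a => ?_) a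
  change μ.incl A' (Finsupp.single g (S.toFun i j a)) ∈ C
  rw [← hS.crossed_single μ]
  exact h i j _

theorem Equivariant.crossed_diag (hS : S.Equivariant) (j : ℕ) (x : (μ.obj A).carrier) :
    (hS.crossed μ).toFun j j x = μ.map (hS.diag j) x :=
  μ.ext_single ((hS.crossed μ).continuous_toFun j j) (continuous_starHom _) (map_add _) (map_add _)
    (fun g a => by
      rw [hS.crossed_single, μ.map_incl, Finsupp.mapRange_single]
      rfl) x

end MatrixSystem

/-! ### Approximation of compact operators -/

/-- Equibounded maps that tend to zero pointwise do so uniformly on totally bounded sets, by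
checking a finite net. It is used for vectors in the image of a ball under a compact operator, and
for operators in the image of a compact set of points. -/
theorem eventually_norm_le_of_totallyBounded {V W : Type*} [SeminormedAddCommGroup V]
    [SeminormedAddCommGroup W] {T : ℕ → V →+ W} {C : ℝ} (hC : 0 ≤ C)
    (hT : ∀ n v, ‖T n v‖ ≤ C * ‖v‖) {s : Set V} (hs : TotallyBounded s)
    (h : ∀ v ∈ s, Tendsto (fun n => T n v) atTop (𝓝 0)) {ε : ℝ} (hε : 0 < ε) :
    ∀ᶠ n in atTop, ∀ v ∈ s, ‖T n v‖ ≤ ε := by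
  obtain ⟨t, hts, htf, ht⟩ := Metric.finite_approx_of_totallyBounded hs (ε / 2 / (C + 1))
    (by positivity)
  have h1 : ∀ᶠ n in atTop, ∀ v ∈ t, ‖T n v‖ < ε / 2 := by
    refine (htf.eventually_all).2 fun v hv => ?_
    have := (h v (hts hv)).norm
    rw [norm_zero] at this
    exact this.eventually_lt_const (by positivity)
  filter_upwards [h1] with n hn v hv
  obtain ⟨w, hw, hvw⟩ := Set.mem_iUnion₂.1 (ht hv)
  rw [Metric.mem_ball, dist_eq_norm] at hvw
  calc ‖T n v‖ = ‖T n (v - w) + T n w‖ := by rw [← map_add, sub_add_cancel]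
    _ ≤ C * ‖v - w‖ + ε / 2 := (norm_add_le _ _).trans (add_le_add (hT _ _) (hn w hw).le)
    _ ≤ (C + 1) * (ε / 2 / (C + 1)) + ε / 2 := by gcongr; linarith
    _ = ε := by field_simp; ring

/-- The standard basis of `ℓ²`. -/
def basisVec (i : ℕ) : L2 := lp.single 2 i 1

theorem inner_basisVec (i j : ℕ) : inner ℂ (basisVec i) (basisVec j) = if i = j then 1 else 0 := by
  rw [basisVec, basisVec, lp.inner_single_left, lp.single_apply]
  by_cases h : i = j
  · subst h
    simp
  · simp [h]

/-- The matrix units in `B(ℓ²)`. -/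
def opUnit (i j : ℕ) : Bd := InnerProductSpace.rankOne ℂ (basisVec i) (basisVec j)

theorem opUnit_apply (i j : ℕ) (v : L2) : opUnit i j v = inner ℂ (basisVec j) v • basisVec i := rfl

theorem opUnit_mul_same (i j l : ℕ) : opUnit i j * opUnit j l = opUnit i l := by
  ext1 v
  change inner ℂ (basisVec j) (inner ℂ (basisVec l) v • basisVec j) • basisVec i = _
  rw [inner_smul_right, inner_basisVec, if_pos rfl, mul_one, opUnit_apply]

theorem opUnit_mul_ne {j k : ℕ} (h : j ≠ k) (i l : ℕ) : opUnit i j * opUnit k l = 0 := by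
  ext1 v
  change inner ℂ (basisVec j) (inner ℂ (basisVec l) v • basisVec k) • basisVec i = 0
  rw [inner_smul_right, inner_basisVec, if_neg h, mul_zero, zero_smul]

theorem star_opUnit (i j : ℕ) : star (opUnit i j) = opUnit j i := by
  rw [ContinuousLinearMap.star_eq_adjoint, opUnit, InnerProductSpace.adjoint_rankOne]
  rfl

theorem opUnit_compact (i j : ℕ) : (opUnit i j).Compact := by
  unfold opUnit Bd.Compact
  rw [InnerProductSpace.rankOne_def']
  exact IsCompactOperator.clm_comp (isCompactOperator_of_locallyCompactSpace_dom
    (innerSL ℂ (basisVec j))) (ContinuousLinearMap.toSpanSingleton ℂ (basisVec i))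

theorem opUnit_mul_mul_opUnit (i j : ℕ) (T : Bd) :
    opUnit i i * T * opUnit j j = (inner ℂ (basisVec i) (T (basisVec j)) : ℂ) • opUnit i j := by
  ext1 v
  change inner ℂ (basisVec i) (T (inner ℂ (basisVec j) v • basisVec j)) • basisVec i =
    inner ℂ (basisVec i) (T (basisVec j)) • inner ℂ (basisVec j) v • basisVec i
  rw [map_smul, inner_smul_right, smul_smul, mul_comm]

/-- The projection onto the span of the first `n` basis vectors. -/
def finProj (n : ℕ) : Bd := ∑ i ∈ Finset.range n, opUnit i i

theorem finProj_mul_self (n : ℕ) : finProj n * finProj n = finProj n := by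
  rw [finProj, Finset.sum_mul_sum]
  refine Finset.sum_congr rfl fun i hi => ?_
  rw [Finset.sum_eq_single i, opUnit_mul_same]
  · exact fun j _ hj => opUnit_mul_ne (Ne.symm hj) _ _
  · exact fun h => absurd hi h

theorem star_finProj (n : ℕ) : star (finProj n) = finProj n := by
  simp only [finProj, star_sum, star_opUnit]

theorem norm_finProj_le (n : ℕ) : ‖finProj n‖ ≤ 1 := by
  have h := CStarRing.norm_star_mul_self (x := finProj n)
  rw [star_finProj, finProj_mul_self] at h
  nlinarith [norm_nonneg (finProj n)]

theorem tendsto_finProj_apply (v : L2) : Tendsto (fun n => finProj n v) atTop (𝓝 v) := by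
  have h := (lp.hasSum_single (p := 2) (by simp) v).tendsto_sum_nat
  refine h.congr fun n => ?_
  rw [finProj, _root_.sum_apply]
  refine Finset.sum_congr rfl fun i _ => ?_
  rw [opUnit_apply, basisVec, lp.inner_single_left, ← lp.single_smul]
  simp

theorem tendsto_finProj_mul {T : Bd} (hT : T.Compact) :
    Tendsto (fun n => finProj n * T) atTop (𝓝 T) := by
  have h1 : TotallyBounded (T '' Metric.closedBall 0 1) :=
    ((hT.isCompact_closure_image_closedBall (f := T.toLinearMap) 1).totallyBounded).subset
      subset_closure
  have h2 : ∀ n (v : L2), ‖(finProj n - 1 : Bd) v‖ ≤ 2 * ‖v‖ := fun n v => by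
    have h3 : ‖finProj n v‖ ≤ 1 * ‖v‖ :=
      ((finProj n).le_opNorm v).trans (by gcongr; exact norm_finProj_le n)
    have h4 : (finProj n - 1 : Bd) v = finProj n v - v := rfl
    rw [h4]
    linarith [norm_sub_le (finProj n v) v]
  rw [tendsto_iff_norm_sub_tendsto_zero, Metric.tendsto_nhds]
  intro ε hε
  filter_upwards [eventually_norm_le_of_totallyBounded
    (T := fun n => (finProj n - 1 : Bd).toLinearMap.toAddMonoidHom) zero_le_two h2 h1
    (fun v _ => by
      have := (tendsto_finProj_apply v).sub_const v
      rw [sub_self] at this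
      exact this) (half_pos hε)] with n hn
  rw [Real.dist_eq, sub_zero, abs_norm]
  refine lt_of_le_of_lt (ContinuousLinearMap.opNorm_le_of_unit_norm (by positivity)
    fun v hv => ?_) (half_lt_self hε)
  exact hn _ ⟨v, by simp [hv], rfl⟩

/-- Compression from the left converges on compact operators; the adjoint, again compact, gives
compression from the right. -/
theorem tendsto_compress {T : Bd} (hT : T.Compact) :
    Tendsto (fun n => finProj n * T * finProj n - T) atTop (𝓝 0) := by
  have h1 := tendsto_finProj_mul hT
  have h2 := (tendsto_finProj_mul hT.star).star
  simp only [star_mul, star_star, star_finProj] at h2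
  rw [tendsto_iff_norm_sub_tendsto_zero] at h1 h2
  refine squeeze_zero_norm (fun n => ?_) (by simpa using h2.add h1)
  calc ‖finProj n * T * finProj n - T‖
      = ‖finProj n * (T * finProj n - T) + (finProj n * T - T)‖ := by
        rw [mul_sub, mul_assoc]; congr 1; abel
    _ ≤ ‖T * finProj n - T‖ + ‖finProj n * T - T‖ := by
        refine (norm_add_le _ _).trans (add_le_add ((norm_mul_le _ _).trans ?_) le_rfl)
        exact mul_le_of_le_one_left (norm_nonneg _) (norm_finProj_le n)

theorem eventually_compress {s : Set Bd} (hs : TotallyBounded s) (hc : ∀ T ∈ s, T.Compact) {ε : ℝ}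
    (hε : 0 < ε) : ∀ᶠ n in atTop, ∀ T ∈ s, ‖finProj n * T * finProj n - T‖ ≤ ε := by
  refine eventually_norm_le_of_totallyBounded
    (T := fun n => ((AddMonoidHom.mulRight (finProj n)).comp (AddMonoidHom.mulLeft (finProj n)) -
      AddMonoidHom.id Bd : Bd →+ Bd)) (C := 2) zero_le_two (fun n T => ?_) hs
    (fun T hT => tendsto_compress (hc T hT)) hε
  change ‖finProj n * T * finProj n - T‖ ≤ _
  refine (norm_sub_le _ _).trans ?_
  have h1 : ‖finProj n * T * finProj n‖ ≤ ‖finProj n‖ * ‖T‖ * ‖finProj n‖ :=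
    (norm_mul_le _ _).trans (by gcongr; exact norm_mul_le _ _)
  have h2 : ‖finProj n‖ * ‖T‖ * ‖finProj n‖ ≤ 1 * ‖T‖ * 1 := by
    gcongr <;> exact norm_finProj_le n
  linarith

/-! ### The stabilisation map -/

section FunctionUnits

variable (G : Type v) [Group G] (Y : Type u) [MetricSpace Y] [ProperSpace Y] [MulAction G Y]
  [IsIsometricSMul G Y] (B : Set Y) (hB : ∀ (g : G), ∀ y ∈ B, g • y ∈ B)

/-- Multiplication of scalar functions by an operator. -/
def tensorOp (Y : Type u) [TopologicalSpace Y] (T : Bd) : (Y →ᵇ ℂ) →L[ℂ] (Y →ᵇ Bd) :=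
  (ContinuousLinearMap.toSpanSingleton ℂ T).compLeftContinuousBounded Y

theorem tensorOp_apply (T : Bd) (f : Y →ᵇ ℂ) (y : Y) : tensorOp Y T f y = f y • T := rfl

theorem tensorOp_mem {T : Bd} (hT : T.Compact) {f : Y →ᵇ ℂ} (hf : f ∈ (c0Alg G Y B hB).sub) :
    tensorOp Y T f ∈ (c0KAlg G Y B hB).sub := by
  refine ⟨fun y => hT.smul (f y), ?_, fun y hy => ?_⟩
  · have : Tendsto (fun y => f y • T) (cocompact Y) (𝓝 ((0 : ℂ) • T)) := hf.1.smul_const T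
    rwa [zero_smul] at this
  · rw [tensorOp_apply, hf.2 y hy, zero_smul]

/-- The matrix units `f ↦ f ⊗ e_{ij}`. -/
def funSystem : MatrixSystem (c0Alg G Y B hB).alg.carrier (c0KAlg G Y B hB).alg.carrier where
  toFun i j :=
    { toFun := fun f => ⟨tensorOp Y (opUnit i j) f.1, tensorOp_mem G Y B hB (opUnit_compact i j) f.2⟩
      map_add' := fun f g => Subtype.ext (map_add (tensorOp Y (opUnit i j)) f.1 g.1)
      map_smul' := fun c f => Subtype.ext (map_smul (tensorOp Y (opUnit i j)) c f.1) }
  mul_same i j l f g := Subtype.ext (BoundedContinuousFunction.ext fun y => by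
    change (f.1 y • opUnit i j) * (g.1 y • opUnit j l) = (f.1 y * g.1 y) • opUnit i l
    rw [smul_mul_smul_comm, opUnit_mul_same])
  mul_ne i j k l f g h := Subtype.ext (BoundedContinuousFunction.ext fun y => by
    change (f.1 y • opUnit i j) * (g.1 y • opUnit k l) = 0
    rw [smul_mul_smul_comm, opUnit_mul_ne h, smul_zero])
  star_apply i j f := Subtype.ext (BoundedContinuousFunction.ext fun y => by
    change star (f.1 y • opUnit i j) = star (f.1 y) • opUnit j i
    rw [star_smul, star_opUnit])

theorem funSystem_equivariant : (funSystem G Y B hB).Equivariant := fun _ _ _ _ => rfl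

/-- Compression to the first `n` basis vectors turns `f` into a finite combination of units whose
coefficients are its scalar matrix entries. Outside a compact set `f` is small, and on it the values
form a totally bounded set of compact operators, so one `n` serves for all points. -/
theorem funSystem_generates : (funSystem G Y B hB).Generates := by
  refine MatrixSystem.generates_of_mem fun C hC h f => ?_
  rw [← SetLike.mem_coe, ← hC.closure_eq, Metric.mem_closure_iff]
  intro ε hε
  obtain ⟨L, hL, hLf⟩ := mem_cocompact.1 (Metric.tendsto_nhds.1 f.2.2.1 (ε / 4) (by positivity))
  have hL' : TotallyBounded (f.1 '' L) := (hL.image f.1.continuous).totallyBounded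
  obtain ⟨n, hn⟩ := (eventually_compress hL' (by rintro _ ⟨y, -, rfl⟩; exact f.2.1 y)
    (half_pos hε)).exists
  have h1 : ∀ i j, ∃ g : (c0Alg G Y B hB).sub, ∀ y, g.1 y =
      inner ℂ (basisVec i) (f.1 y (basisVec j)) := by
    intro i j
    let φ : Bd →L[ℂ] ℂ := (innerSL ℂ (basisVec i)).comp
      (ContinuousLinearMap.apply ℂ L2 (basisVec j))
    refine ⟨⟨φ.compLeftContinuousBounded Y f.1, ?_, fun y hy => ?_⟩, fun y => rfl⟩
    · have := (φ.continuous.tendsto 0).comp f.2.2.1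
      rwa [map_zero] at this
    · exact (congrArg φ (f.2.2.2 y hy)).trans (map_zero φ)
  choose g hg using h1
  refine ⟨∑ i ∈ Finset.range n, ∑ j ∈ Finset.range n, (funSystem G Y B hB).toFun i j (g i j),
    sum_mem fun i _ => sum_mem fun j _ => h i j _, ?_⟩
  have h2 : ∀ y, (∑ i ∈ Finset.range n, ∑ j ∈ Finset.range n,
      (funSystem G Y B hB).toFun i j (g i j) : (c0KAlg G Y B hB).sub).1 y =
      finProj n * f.1 y * finProj n := by
    intro y
    have h3 : finProj n * f.1 y * finProj n = ∑ i ∈ Finset.range n, ∑ j ∈ Finset.range n,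
        (g i j).1 y • opUnit i j := by
      rw [finProj, Finset.sum_mul, Finset.sum_mul_sum]
      simp only [opUnit_mul_mul_opUnit, hg]
    let ev : (c0KAlg G Y B hB).alg.carrier →+ Bd :=
      { toFun := fun f : (c0KAlg G Y B hB).sub => f.1 y
        map_zero' := rfl
        map_add' := fun _ _ => rfl }
    refine (map_sum ev _ _).trans (Eq.trans ?_ h3.symm)
    exact Finset.sum_congr rfl fun i _ => map_sum ev _ _
  refine lt_of_le_of_lt ?_ (half_lt_self hε)
  rw [dist_comm, dist_eq_norm]
  change ‖(_ - f).1‖ ≤ _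
  refine (BoundedContinuousFunction.norm_le (by positivity)).2 fun y => ?_
  refine (congrArg (fun T => ‖T - f.1 y‖) (h2 y)).trans_le ?_
  by_cases hy : y ∈ L
  · exact hn _ ⟨y, hy, rfl⟩
  · have h4 : ‖f.1 y‖ < ε / 4 := by simpa using hLf hy
    have h5 : ‖finProj n * f.1 y * finProj n‖ ≤ ‖finProj n‖ * ‖f.1 y‖ * ‖finProj n‖ :=
      (norm_mul_le _ _).trans (by gcongr; exact norm_mul_le _ _)
    have h6 : ‖finProj n‖ * ‖f.1 y‖ * ‖finProj n‖ ≤ 1 * ‖f.1 y‖ * 1 := by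
      gcongr <;> exact norm_finProj_le n
    linarith [norm_sub_le (finProj n * f.1 y * finProj n) (f.1 y)]

theorem funSystem_injective : Function.Injective ((funSystem_equivariant G Y B hB).diag 0).hom := by
  rw [injective_iff_map_eq_zero]
  intro f hf
  refine Subtype.ext (BoundedContinuousFunction.ext fun y => ?_)
  have h1 : f.1 y • opUnit 0 0 = 0 := congrArg (fun f => f.1 y) hf
  have h2 : opUnit 0 0 ≠ 0 := fun h => by
    have := congrArg (fun T : Bd => inner ℂ (basisVec 0) (T (basisVec 0))) h
    change inner ℂ (basisVec 0) (inner ℂ (basisVec 0) (basisVec 0) • basisVec 0) =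
      inner ℂ (basisVec 0) (0 : L2) at this
    simp only [inner_smul_right, inner_basisVec, inner_zero_right, if_true, mul_one] at this
    exact one_ne_zero this
  exact (smul_eq_zero.1 h1).resolve_right h2

/-- The scalar functions of compact support. -/
def compactlySupported : Set (c0Alg G Y B hB).alg.carrier :=
  {f : (c0Alg G Y B hB).sub | ∃ K : Set Y, IsCompact K ∧ ∀ y, y ∉ K → f.1 y = 0}

theorem exists_compactlySupported (a : (c0Alg G Y B hB).sub) {ε : ℝ} (hε : 0 < ε) :
    ∃ c : (c0Alg G Y B hB).sub, c ∈ compactlySupported G Y B hB ∧ ‖c * a - a‖ ≤ ε := by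
  -- The cut-off is `φ(|a|)` with `φ = 0` up to `ε / 2` and `φ = 1` from `ε` on. It is zero outside
  -- a compact set because `a` vanishes at infinity, zero on `B` because `a` is, and equal to one
  -- wherever `a` is not small.
  let φ : ℝ → ℝ := fun t => max 0 (min 1 (2 * t / ε - 1))
  have hφ : Continuous φ := by fun_prop
  have hφ0 : ∀ t, 0 ≤ φ t := fun t => le_max_left _ _
  have hφ1 : ∀ t, φ t ≤ 1 := fun t => max_le zero_le_one (min_le_left _ _)
  have hφs : ∀ t, t ≤ ε / 2 → φ t = 0 := fun t ht => by
    refine max_eq_left ((min_le_right _ _).trans ?_)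
    rw [sub_nonpos, div_le_one hε]
    linarith
  have hφl : ∀ t, ε ≤ t → φ t = 1 := fun t ht => by
    have : 1 ≤ 2 * t / ε - 1 := by
      rw [le_sub_iff_add_le, le_div_iff₀ hε]
      linarith
    change max 0 (min 1 _) = 1
    rw [min_eq_left this, max_eq_right zero_le_one]
  obtain ⟨L, hL, hLa⟩ := mem_cocompact.1 (Metric.tendsto_nhds.1 a.2.1 (ε / 2) (by positivity))
  have hLa' : ∀ y, y ∉ L → φ ‖a.1 y‖ = 0 := fun y hy => hφs _ (by
    have := hLa hy
    simp only [dist_zero_right] at this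
    exact le_of_lt this)
  let c : Y →ᵇ ℂ := BoundedContinuousFunction.ofNormedAddCommGroup (fun y => (φ ‖a.1 y‖ : ℂ))
    (by fun_prop) 1 fun y => by
      rw [Complex.norm_real, Real.norm_of_nonneg (hφ0 _)]
      exact hφ1 _
  have hc : ∀ y, c y = (φ ‖a.1 y‖ : ℂ) := fun y => rfl
  refine ⟨⟨c, ?_, fun y hy => ?_⟩, ⟨L, hL, fun y hy => ?_⟩, ?_⟩
  · refine tendsto_const_nhds.congr' (Filter.mem_of_superset hL.compl_mem_cocompact fun y hy => ?_)
    change 0 = c y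
    rw [hc, hLa' y hy, Complex.ofReal_zero]
  · rw [hc, a.2.2 y hy, norm_zero, hφs 0 (by positivity), Complex.ofReal_zero]
  · change c y = 0
    rw [hc, hLa' y hy, Complex.ofReal_zero]
  · change ‖c * a.1 - a.1‖ ≤ ε
    refine (BoundedContinuousFunction.norm_le hε.le).2 fun y => ?_
    change ‖c y * a.1 y - a.1 y‖ ≤ ε
    by_cases h : ε ≤ ‖a.1 y‖
    · rw [hc, hφl _ h, Complex.ofReal_one, one_mul, sub_self, norm_zero]
      exact hε.le
    · rw [← sub_one_mul, hc, ← Complex.ofReal_one, ← Complex.ofReal_sub, norm_mul,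
        Complex.norm_real, Real.norm_of_nonpos (by linarith [hφ1 ‖a.1 y‖])]
      have h1 := hφ0 ‖a.1 y‖
      have h2 := hφ1 ‖a.1 y‖
      nlinarith [norm_nonneg (a.1 y)]

/-- The cut-offs are functions of compact support. The product `b · a · g(c)` can be nonzero only if
`g` moves the support of `c` to meet that of `b`, which proper discontinuity allows for finitely
many `g` only. -/
theorem crossed_funSystem_injective [ProperlyDiscontinuousSMul G Y]
    (μ : CrossedProductFunctor.{u, v} G) :
    Function.Injective (μ.map ((funSystem_equivariant G Y B hB).diag 0)) := by
  refine μ.map_injective_of_proper _ (funSystem_injective G Y B hB) (compactlySupported G Y B hB)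
    ?_ (fun a ε hε => exists_compactlySupported G Y B hB a hε) fun a ε hε => ?_
  · rintro (b : (c0Alg G Y B hB).sub) ⟨K, hK, hbK⟩ (c : (c0Alg G Y B hB).sub) ⟨L, hL, hcL⟩
    refine ⟨(ProperlyDiscontinuousSMul.finite_disjoint_inter_image (Γ := G) hL hK).toFinset,
      fun g hg (a : (c0Alg G Y B hB).sub) => Subtype.ext (BoundedContinuousFunction.ext fun y => ?_)⟩
    change b.1 y * a.1 y * c.1 (g⁻¹ • y) = 0
    by_cases h1 : y ∈ K
    · by_cases h2 : g⁻¹ • y ∈ L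
      · have : ((fun x => g • x) '' L ∩ K).Nonempty := ⟨y, ⟨_, h2, smul_inv_smul g y⟩, h1⟩
        exact (hg ((Set.Finite.mem_toFinset _).2 this)).elim
      · rw [hcL _ h2, mul_zero]
    · rw [hbK _ h1, zero_mul, zero_mul]
  · obtain ⟨c, hc, hca⟩ := exists_compactlySupported G Y B hB a hε
    refine ⟨c, hc, ?_⟩
    have : ∀ a c : (c0Alg G Y B hB).sub, a * c = c * a := fun a c => Subtype.ext (mul_comm a.1 c.1)
    exact (congrArg (fun x => ‖x - a‖) (this a c)).trans_le hca

end FunctionUnits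

namespace SigmaGMetricSpace

variable {G : Type v} [Group G] (μ : CrossedProductFunctor.{u, v} G)
  (E : SigmaGMetricSpace.{u, v} G) (B : E.SubFamily)

/-- The matrix units in the crossed product of `C_0(E_n ∖ B_n, K)`. -/
def crossedSystem (n : ℕ) : MatrixSystem ((μ.tower (E.c0 B)).obj n).carrier
    ((μ.tower (E.c0K B)).obj n).carrier :=
  (funSystem_equivariant G (E.X n) (B.set n) (B.smul_mem n)).crossed μ

theorem crossedSystem_faithful (n : ℕ) : (E.crossedSystem μ B n).Faithful := by
  refine MatrixSystem.faithful_of_injective (i := 0) (j := 0) fun x y hxy => ?_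
  refine crossed_funSystem_injective G (E.X n) (B.set n) (B.smul_mem n) μ ?_
  exact (MatrixSystem.Equivariant.crossed_diag μ _ 0 x).symm.trans
    (hxy.trans (MatrixSystem.Equivariant.crossed_diag μ _ 0 y))

theorem crossedSystem_generates (n : ℕ) : (E.crossedSystem μ B n).Generates :=
  (funSystem_equivariant G (E.X n) (B.set n) (B.smul_mem n)).crossed_generates μ
    (funSystem_generates G (E.X n) (B.set n) (B.smul_mem n))

/-- The isomorphism `K ⊗ (C_0(E ∖ B) ⋊ G) ≅ C_0(E ∖ B, K) ⋊ G`. -/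
def stabIso : TowerHom (μ.tower (E.c0 B)).stab (μ.tower (E.c0K B)) where
  app n := MatrixSystem.lift (E.crossedSystem μ B n) stabSystem_faithful stabSystem_generates
  comm n x := by
    refine stabHom_ext _ (φ := (MatrixSystem.lift (E.crossedSystem μ B n) stabSystem_faithful
      stabSystem_generates).comp (stabMap ((μ.tower (E.c0 B)).map n)))
      (ψ := ((μ.tower (E.c0K B)).map n).comp (MatrixSystem.lift (E.crossedSystem μ B (n + 1))
        stabSystem_faithful stabSystem_generates)) (fun i j z => ?_) x
    simp only [NonUnitalStarAlgHom.comp_apply, stabMap_stabUnit]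
    rw [← stabSystem_toFun, ← stabSystem_toFun, MatrixSystem.lift_toFun, MatrixSystem.lift_toFun]
    refine μ.ext_single
      (f := fun z => (E.crossedSystem μ B n).toFun i j ((μ.tower (E.c0 B)).map n z))
      (g := fun z => (μ.tower (E.c0K B)).map n ((E.crossedSystem μ B (n + 1)).toFun i j z))
      (((E.crossedSystem μ B n).continuous_toFun i j).comp (continuous_starHom _))
      ((continuous_starHom _).comp ((E.crossedSystem μ B (n + 1)).continuous_toFun i j))
      (fun a b => (congrArg _ (map_add ((μ.tower (E.c0 B)).map n) a b)).trans
        (map_add ((E.crossedSystem μ B n).toFun i j) _ _))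
      (fun a b => (congrArg _ (map_add ((E.crossedSystem μ B (n + 1)).toFun i j) a b)).trans
        (map_add ((μ.tower (E.c0K B)).map n) _ _))
      (fun g a => ?_) z
    refine (congrArg _ ((μ.map_incl _ _).trans
      (congrArg _ (Finsupp.mapRange_single)))).trans ?_
    refine (MatrixSystem.Equivariant.crossed_single μ _ i j g _).trans (Eq.symm ?_)
    refine (congrArg _ (MatrixSystem.Equivariant.crossed_single μ _ i j g a)).trans ?_
    refine ((μ.map_incl _ _).trans (congrArg _ (Finsupp.mapRange_single))).trans ?_
    rfl

theorem stabIso_corner (n : ℕ) (x : ((μ.tower (E.c0 B)).obj n).carrier) :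
    (E.stabIso μ B).app n ((μ.tower (E.c0 B)).corner.app n x) =
      (μ.towerHom (E.c0Stab B)).app n x := by
  refine (MatrixSystem.lift_toFun (S := stabSystem _) (E.crossedSystem μ B n)
    stabSystem_faithful stabSystem_generates 0 0 x).trans ?_
  refine (MatrixSystem.Equivariant.crossed_diag μ _ 0 x).trans ?_
  refine μ.hom_ext _ _ (μ.map ((E.c0Stab B).app n)) (fun f => ?_) x
  -- The unit at `(0, 0)` is given by the rank one projection of `scalarHom`, so the coefficient
  -- maps agree definitionally.
  exact (μ.map_incl _ f).trans (μ.map_incl ((E.c0Stab B).app n) f).symm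

/-- The stabilisation map is the corner embedding followed by the isomorphism of matrix unit
systems, and each is bijective on K-theory. -/
theorem stabilisationMap_bijective (m : ℤ) :
    Function.Bijective (E.stabilisationMap μ B m) := by
  have h1 : Function.Bijective ((E.stabIso μ B).kMap (-m)) :=
    TowerHom.kMap_bijective_of_eventually (k₀ := 0) (fun n _ =>
      MatrixSystem.lift_bijective _ stabSystem_faithful stabSystem_generates
        (E.crossedSystem_faithful μ B n) (E.crossedSystem_generates μ B n)) _
  have h2 : ⇑(E.stabilisationMap μ B m) =
      (E.stabIso μ B).kMap (-m) ∘ (μ.tower (E.c0 B)).corner.kMap (-m) :=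
    funext fun x => (TowerHom.kMap_triangle (E.stabIso_corner μ B) x).symm
  rw [h2]
  exact h1.comp (Tower.kMap_corner_bijective _ _)

end SigmaGMetricSpace

/-! ### Crossed products of surjections and bijections -/

namespace CrossedProductFunctor

variable {G : Type v} [Group G] (μ : CrossedProductFunctor.{u, v} G) {A A' : GCStarAlg.{u, v} G}

theorem map_surjective (φ : GHom A A') (hφ : Function.Surjective φ.hom) :
    Function.Surjective (μ.map φ) := fun x => by
  refine μ.mem_of_single (C := (μ.map φ : (μ.obj A).carrier →+ (μ.obj A').carrier).range)
    (isClosed_range_starHom (μ.map φ)) (fun g b => ?_) x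
  obtain ⟨a, rfl⟩ := hφ b
  exact ⟨μ.incl A (Finsupp.single g a), (μ.map_incl φ _).trans
    (congrArg _ Finsupp.mapRange_single)⟩

/-- Compatibility with composition and identities follows from the values on the dense convolution
algebra, so an equivariant inverse induces an inverse. -/
theorem map_bijective (φ : GHom A A') (hφ : Function.Bijective φ.hom) :
    Function.Bijective (μ.map φ) := by
  let e := StarAlgEquiv.ofBijective φ.hom hφ
  have he : ∀ x, φ.hom (e.symm x) = x := e.apply_symm_apply
  have he' : ∀ x, e.symm (φ.hom x) = x := e.symm_apply_apply
  let ψ : GHom A' A :=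
    { hom := (e.symm : A'.carrier →⋆ₙₐ[ℂ] A.carrier)
      equivariant := fun g x => hφ.1 ((he _).trans
        ((congrArg _ (he x).symm).trans (φ.equivariant g _).symm)) }
  refine ⟨Function.LeftInverse.injective (g := μ.map ψ) fun x => ?_, μ.map_surjective φ hφ.2⟩
  refine μ.hom_ext A ((μ.map ψ).comp (μ.map φ)) (NonUnitalStarAlgHom.id ℂ _) (fun f => ?_) x
  refine (congrArg (μ.map ψ) (μ.map_incl φ f)).trans ((μ.map_incl ψ _).trans (congrArg _ ?_))
  ext g
  exact he' (f g)

theorem map_map_eq {B B' C : GCStarAlg.{u, v} G} (φ : GHom A B) (ψ : GHom B C) (φ' : GHom A B')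
    (ψ' : GHom B' C) (h : ∀ a, ψ.hom (φ.hom a) = ψ'.hom (φ'.hom a)) (x : (μ.obj A).carrier) :
    μ.map ψ (μ.map φ x) = μ.map ψ' (μ.map φ' x) := by
  refine μ.hom_ext A ((μ.map ψ).comp (μ.map φ)) ((μ.map ψ').comp (μ.map φ')) (fun f => ?_) x
  refine (congrArg (μ.map ψ) (μ.map_incl φ f)).trans ((μ.map_incl ψ _).trans ?_)
  refine Eq.trans ?_ ((congrArg (μ.map ψ') (μ.map_incl φ' f)).trans (μ.map_incl ψ' _)).symm
  congr 1
  ext g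
  exact h (f g)

end CrossedProductFunctor

/-! ### Extension of operator valued functions -/

theorem Bd.convex_compact : Convex ℝ {T : Bd | T.Compact} := by
  intro S hS T hT a b _ _ _
  have h : a • S + b • T = (a : ℂ) • S + (b : ℂ) • T := rfl
  rw [Set.mem_ofPred_eq, h]
  exact (hS.smul (a : ℂ)).add (hT.smul (b : ℂ))

section Extension

variable {Y Z : Type*} [MetricSpace Y] [MetricSpace Z]

theorem eventually_norm_sub_le_of_isInducing {D : Type*} [SeminormedAddCommGroup D] {h : Z → Y}
    (hh : IsInducing h) {f : Z → D} (hf : Continuous f) {v : D} {z : Z} {ε : ℝ}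
    (hv : ‖v - f z‖ < ε) : ∀ᶠ y in 𝓝 (h z), ∀ x, h x = y → ‖v - f x‖ ≤ ε := by
  have h1 : ∀ᶠ x in 𝓝 z, ‖v - f x‖ < ε :=
    (continuous_const.sub hf).norm.continuousAt.eventually_lt continuousAt_const hv
  rw [hh.nhds_eq_comap, eventually_comap] at h1
  exact h1.mono fun y hy x hx => (hy x hx).le

theorem eventually_ne_of_isClosed_range {h : Z → Y} (hc : IsClosed (Set.range h)) {y : Y}
    (hy : y ∉ Set.range h) : ∀ᶠ y' in 𝓝 y, ∀ x, h x ≠ y' :=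
  Filter.mem_of_superset (hc.isOpen_compl.mem_nhds hy) fun _ hy' x hx => hy' ⟨x, hx⟩

theorem exists_approx_c0K [ProperSpace Y] {h : Z → Y} (hh : IsClosedEmbedding h)
    {B : Set Y} (hB : IsClosed B) {f : Z →ᵇ Bd} (hfc : ∀ z, (f z).Compact)
    (hf : Tendsto f (cocompact Z) (𝓝 0)) (hfB : ∀ z, h z ∈ B → f z = 0) {ε : ℝ} (hε : 0 < ε) :
    ∃ g : Y →ᵇ Bd, (∀ y, (g y).Compact) ∧ Tendsto g (cocompact Y) (𝓝 0) ∧ (∀ y ∈ B, g y = 0) ∧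
      ∀ z, ‖g (h z) - f z‖ ≤ ε := by
  rcases isEmpty_or_nonempty Z with hZ | ⟨⟨z₀⟩⟩
  · exact ⟨0, fun _ => isCompactOperator_zero, tendsto_const_nhds, fun _ _ => rfl,
      fun z => (hZ.false z).elim⟩
  obtain ⟨L, hL, hLf⟩ := mem_cocompact.1 (Metric.tendsto_nhds.1 hf ε hε)
  obtain ⟨r, hr⟩ := (hL.image hh.continuous).isBounded.subset_ball (h z₀)
  -- Every requirement on the value at `y` is convex: compactness, the bound giving boundedness,
  -- vanishing on `B` and outside a ball, and closeness to `f` on the image. Where `f` is small the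
  -- constant `0` is admissible; elsewhere the point is inside the ball and off `B`, so the value of
  -- `f` is.
  let t : Y → Set Bd := fun y => {v | v.Compact ∧ ‖v‖ ≤ ‖f‖ ∧ (y ∈ B → v = 0) ∧
    (y ∉ Metric.ball (h z₀) r → v = 0) ∧ ∀ x, h x = y → ‖v - f x‖ ≤ ε}
  have ht : ∀ y, Convex ℝ (t y) := by
    intro y v hv w hw a b ha hb hab
    refine ⟨Bd.convex_compact hv.1 hw.1 ha hb hab, ?_, fun hy => ?_, fun hy => ?_, fun x hx => ?_⟩
    · simpa using convex_closedBall (0 : Bd) ‖f‖ (by simpa using hv.2.1) (by simpa using hw.2.1)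
        ha hb hab
    · rw [hv.2.2.1 hy, hw.2.2.1 hy, smul_zero, smul_zero, add_zero]
    · rw [hv.2.2.2.1 hy, hw.2.2.2.1 hy, smul_zero, smul_zero, add_zero]
    · simpa [dist_eq_norm] using convex_closedBall (f x) ε
        (by simpa [dist_eq_norm] using hv.2.2.2.2 x hx)
        (by simpa [dist_eq_norm] using hw.2.2.2.2 x hx) ha hb hab
  have h0 : ∀ y, (∀ x, h x = y → ‖(0 : Bd) - f x‖ ≤ ε) → (0 : Bd) ∈ t y := fun y hy =>
    ⟨isCompactOperator_zero, norm_zero.trans_le (norm_nonneg f), fun _ => rfl, fun _ => rfl, hy⟩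
  obtain ⟨g, hg⟩ := exists_continuous_forall_mem_convex_of_local_const ht fun y => by
    by_cases hy : y ∈ Set.range h
    · obtain ⟨z, rfl⟩ := hy
      by_cases hz : ‖f z‖ < ε
      · refine ⟨0, (eventually_norm_sub_le_of_isInducing hh.isInducing f.continuous
          (v := 0) (z := z) (by simpa using hz)).mono fun y => h0 y⟩
      · refine ⟨f z, ?_⟩
        have h1 : h z ∈ Metric.ball (h z₀) r := hr ⟨z, by
          by_contra hzL
          exact hz (by simpa using hLf hzL), rfl⟩
        have h2 : h z ∉ B := fun hzB => hz (by rw [hfB z hzB, norm_zero]; exact hε)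
        filter_upwards [eventually_norm_sub_le_of_isInducing hh.isInducing f.continuous
          (v := f z) (z := z) (by simpa using hε), Metric.isOpen_ball.mem_nhds h1,
          hB.isOpen_compl.mem_nhds h2] with y hy1 hy2 hy3
        exact ⟨hfc z, f.norm_coe_le_norm z, fun hy => (hy3 hy).elim, fun hy => (hy hy2).elim, hy1⟩
    · exact ⟨0, (eventually_ne_of_isClosed_range hh.isClosed_range hy).mono fun y' hy' =>
        h0 y' fun x hx => (hy' x hx).elim⟩
  refine ⟨BoundedContinuousFunction.ofNormedAddCommGroup g g.continuous ‖f‖ fun y => (hg y).2.1,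
    fun y => (hg y).1, ?_, fun y => (hg y).2.2.1, fun z => (hg (h z)).2.2.2.2 z rfl⟩
  refine tendsto_const_nhds.congr' (Filter.mem_of_superset
    (isCompact_closedBall (h z₀) r).compl_mem_cocompact fun y hy => ?_)
  exact ((hg y).2.2.2.1 fun hy' => hy (Metric.ball_subset_closedBall hy')).symm

/-- The value at `y` is taken in the convex hull of the values of `f` at points within distance `R`,
a nonempty set by coarse density. Convex properties of nearby values of `f` pass to `g`: norm
bounds, compactness of differences, and small variation. A partition of unity provides continuity.
-/
theorem exists_approx_higson [ProperSpace Y] {h : Z → Y} (hh : Isometry h)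
    (hc : IsClosed (Set.range h)) {R : ℝ} (hR : ∀ y, ∃ x, dist (h x) y < R) {f : Z →ᵇ Bd}
    (hf : VanishingVariation f) (hfc : ∀ x y, (f x - f y).Compact) {ε : ℝ} (hε : 0 < ε) :
    ∃ g : Y →ᵇ Bd, VanishingVariation g ∧ (∀ x y, (g x - g y).Compact) ∧
      ∀ z, ‖g (h z) - f z‖ ≤ ε := by
  let t : Y → Set Bd := fun y => {v | v ∈ convexHull ℝ (f '' {x | dist (h x) y < R}) ∧
    ∀ x, h x = y → ‖v - f x‖ ≤ ε}
  have ht : ∀ y, Convex ℝ (t y) := by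
    intro y v hv w hw a b ha hb hab
    refine ⟨convex_convexHull ℝ _ hv.1 hw.1 ha hb hab, fun x hx => ?_⟩
    simpa [dist_eq_norm] using convex_closedBall (f x) ε
      (by simpa [dist_eq_norm] using hv.2 x hx)
      (by simpa [dist_eq_norm] using hw.2 x hx) ha hb hab
  have hd : ∀ x y, dist (h x) y < R → ∀ᶠ y' in 𝓝 y,
      f x ∈ convexHull ℝ (f '' {x | dist (h x) y' < R}) := fun x y hxy =>
    ((continuous_const.dist continuous_id).continuousAt.eventually_lt continuousAt_const
      hxy).mono fun y' hy' => subset_convexHull ℝ _ ⟨x, hy', rfl⟩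
  obtain ⟨g, hg⟩ := exists_continuous_forall_mem_convex_of_local_const ht fun y => by
    obtain ⟨x, hx⟩ := hR y
    by_cases hy : y ∈ Set.range h
    · obtain ⟨z, rfl⟩ := hy
      exact ⟨f z, (hd z (h z) (by rw [dist_self]; exact dist_nonneg.trans_lt hx)).and
        (eventually_norm_sub_le_of_isInducing hh.isEmbedding.isInducing f.continuous
          (by simpa using hε))⟩
    · exact ⟨f x, (hd x y hx).and ((eventually_ne_of_isClosed_range hc hy).mono
        fun y' hy' x hx => (hy' x hx).elim)⟩
  have hull : ∀ (s : Set Bd) y, Convex ℝ s → (∀ x, dist (h x) y < R → f x ∈ s) → g y ∈ s :=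
    fun s y hs hx => convexHull_min (by rintro _ ⟨x, hx', rfl⟩; exact hx x hx') hs (hg y).1
  have hgn : ∀ y, ‖g y‖ ≤ ‖f‖ := fun y => by
    simpa using hull _ y (convex_closedBall 0 ‖f‖) fun x _ => by simpa using f.norm_coe_le_norm x
  have hgc : ∀ x y, (g y - f x).Compact := fun x y => by
    refine hull {v | (v - f x).Compact} y ?_ fun x' _ => hfc x' x
    have := Bd.convex_compact.translate_preimage_left (-f x)
    simp only [← sub_eq_add_neg] at this
    exact this
  refine ⟨BoundedContinuousFunction.ofNormedAddCommGroup g g.continuous ‖f‖ hgn, ?_,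
    fun y y' => ?_, fun z => (hg (h z)).2 z rfl⟩
  · refine vanishingVariation_iff.2 fun r hr δ hδ => ?_
    rcases isEmpty_or_nonempty Y with hY | ⟨⟨y₀⟩⟩
    · exact Eventually.of_forall fun y => (hY.false y).elim
    have hR0 : 0 < R := dist_nonneg.trans_lt (hR y₀).choose_spec
    -- If `w` and `y` are less than `r` apart, points of `Z` within `R` of each are less than `r +
    -- 2R` apart.
    obtain ⟨L, hL, hLf⟩ := mem_cocompact.1 (vanishingVariation_iff.1 hf (r + 2 * R)
      (by positivity) (δ / 2) (half_pos hδ))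
    have hL' : IsCompact (Metric.cthickening R (h '' L)) := (hL.image hh.continuous).cthickening
    filter_upwards [hL'.compl_mem_cocompact] with y hy y' hy'
    obtain ⟨x, hx⟩ := hR y
    have hxL : x ∉ L := fun hxL => hy (Metric.mem_cthickening_of_dist_le y (h x) R _ ⟨x, hxL, rfl⟩
      (by rw [dist_comm]; exact hx.le))
    have key : ∀ w, dist w y < r → g w ∈ Metric.closedBall (f x) (δ / 2) := fun w hw => by
      refine hull _ w (convex_closedBall _ _) fun x' hx' => ?_
      rw [Metric.mem_closedBall, dist_comm]
      refine hLf hxL x' ?_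
      rw [Metric.mem_ball, ← hh.dist_eq]
      have h1 := dist_triangle4 (h x') w y (h x)
      rw [dist_comm y] at h1
      linarith
    have h1 := key y (by rw [dist_self]; exact hr)
    have h2 := key y' hy'
    rw [Metric.mem_closedBall] at h1 h2
    change dist (g y) (g y') ≤ δ
    linarith [dist_triangle_right (g y) (g y') (f x)]
  · obtain ⟨x, -⟩ := hR y
    have h1 : g y - g y' = (g y - f x) - (g y' - f x) := by abel
    change (g y - g y').Compact
    rw [h1]
    exact (hgc x y).sub (hgc x y')

end Extension

/-! ### The extensions of function algebras -/

theorem existsUnique_factor {P Q R : Type*} [AddCommGroup P] [AddCommGroup Q] [AddCommGroup R]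
    {c : Q →+ R} (hc : Function.Bijective c) (b : P →+ R) :
    ∃! δ : P →+ Q, ∀ ξ η, b ξ = η ↔ c (δ ξ) = η := by
  let e := AddEquiv.ofBijective c hc
  have he : ∀ x, c (e.symm x) = x := e.apply_symm_apply
  refine ⟨(e.symm : R →+ Q).comp b, fun ξ η => iff_of_eq (congrArg (· = η) (he (b ξ)).symm),
    fun δ h => AddMonoidHom.ext fun ξ => hc.1 ?_⟩
  exact ((h ξ _).1 rfl).trans (he (b ξ)).symm

/-- Exactness at the ideal, read through the injective comparison map `c`. Applied to both
extensions it turns the lifting criterion into a comparison of two kernels. -/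
theorem IsExactSeq.mem_range_iff {J A B : Tower.{u}} {ι : TowerHom J A} {π : TowerHom A B}
    {k₀ : ℕ} {m m' : ℤ} (h : IsExactSeq ι π k₀) (hm : m' = m - 1) {Q : Type*} [AddCommGroup Q]
    {c : Q →+ J.K m'} (hc : Function.Injective c) {δ : B.K m →+ Q}
    (hδ : ∀ ξ, h.boundaryHom hm ξ = c (δ ξ)) {θ : Q} :
    θ ∈ Set.range δ ↔ ι.kMap m' (c θ) = 0 := by
  constructor
  · rintro ⟨ξ, rfl⟩
    rw [← hδ, h.kMap_boundaryHom]
  · intro hθ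
    obtain ⟨ξ, hξ⟩ := h.exists_boundaryHom_eq hm hθ
    exact ⟨ξ, hc ((hδ ξ).symm.trans hξ)⟩

namespace SigmaGMetricSpace

variable {G : Type v} [Group G] (μ : CrossedProductFunctor.{u, v} G)
  {E X : SigmaGMetricSpace.{u, v} G}

/-- A continuous coarse embedding of a proper space is a proper map, hence closed. -/
theorem isClosedEmbedding_incl (E : SigmaGMetricSpace.{u, v} G) (n : ℕ) :
    IsClosedEmbedding (E.incl n) :=
  .of_continuous_injective_isClosedMap (E.incl_continuous n) (E.incl_injective n)
    (isProperMap_iff_tendsto_cocompact.2 ⟨E.incl_continuous n,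
      (E.incl_coarse n).tendsto_cocompact (E.incl_continuous n)⟩).isClosedMap

theorem c0K_map_surjective {B : E.SubFamily} (hB : ∀ n, IsClosed (B.set n))
    (hi : ∀ n y, E.incl n y ∈ B.set (n + 1) → y ∈ B.set n) (n : ℕ) :
    Function.Surjective ((E.c0K B).map n).hom := by
  refine surjective_of_approx _ fun (f : (c0KAlg G (E.X n) (B.set n) (B.smul_mem n)).sub) ε hε => ?_
  obtain ⟨g, h1, h2, h3, h4⟩ := exists_approx_c0K (E.isClosedEmbedding_incl n) (hB (n + 1)) f.2.1
    f.2.2.1 (fun z hz => f.2.2.2 z (hi n z hz)) hε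
  refine ⟨(⟨g, h1, h2, h3⟩ : (c0KAlg G (E.X (n + 1)) (B.set (n + 1)) (B.smul_mem (n + 1))).sub), ?_⟩
  exact (BoundedContinuousFunction.norm_le hε.le).2 h4

theorem c0KToHigson_injective (B : E.SubFamily) (n : ℕ) :
    Function.Injective ((E.c0KToHigson B).app n).hom := fun _ _ h =>
  Subtype.ext (BoundedContinuousFunction.ext fun y => congrArg (fun f => f.1 y) h)

theorem higsonForget_injective (B : E.SubFamily) (n : ℕ) :
    Function.Injective ((E.higsonForget B).app n).hom := fun _ _ h =>
  Subtype.ext (BoundedContinuousFunction.ext fun y => congrArg (fun f => f.1 y) h)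

theorem isShortExact_corona (B : E.SubFamily) (n : ℕ) :
    IsShortExact ((E.c0KToHigson B).app n).hom ((E.higsonToCorona B).app n).hom := by
  refine ⟨c0KToHigson_injective B n, ClosedIdeal.proj_surjective _,
    fun f : (higsonAlg G (E.X n) (B.set n) (B.smul_mem n)).alg.carrier => ?_⟩
  refine (ClosedIdeal.proj_eq_iff (c0Ideal G (E.X n) (B.set n) (B.smul_mem n))
    (a := f) (b := 0)).trans ((iff_of_eq (congrArg (· ∈ _) (sub_zero f))).trans ?_)
  constructor
  · intro hf
    exact ⟨(⟨f.1, hf⟩ : (c0KAlg G (E.X n) (B.set n) (B.smul_mem n)).sub), rfl⟩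
  · rintro ⟨g, rfl⟩
    exact g.2

theorem isExactSeq_corona (hμ : μ.IsExact) (E : SigmaGMetricSpace.{u, v} G) :
    IsExactSeq (μ.towerHom (E.c0KToHigson E.noSub)) (μ.towerHom (E.higsonToCorona E.noSub)) 0 where
  exact n := hμ _ _ (isShortExact_corona E.noSub n)
  surjective n _ := μ.map_surjective _
    (c0K_map_surjective (B := E.noSub) (fun _ => isClosed_empty) (fun _ _ h => h.elim) n)

variable (j : Embedding X E)

theorem Embedding.isClosed_range (n : ℕ) : IsClosed (Set.range (j.emb n)) :=
  (j.isometry n).isClosedEmbedding.isClosed_range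

/-- Coarse density: a compact set whose translates cover lies in a ball about a point of `X`, and
the embedding is equivariant and the action isometric. -/
theorem Embedding.exists_dist_lt (hE : E.IsGCompact) (n : ℕ) [Nonempty (X.X n)] :
    ∃ R : ℝ, ∀ y, ∃ x, dist (j.emb n x) y < R := by
  obtain ⟨K, hK, hKE⟩ := hE n
  let x₀ : X.X n := Classical.arbitrary _
  obtain ⟨R, hR⟩ := hK.isBounded.subset_ball (j.emb n x₀)
  refine ⟨R, fun y => ?_⟩
  obtain ⟨g, k, hk, rfl⟩ := Set.mem_iUnion.1 (hKE.ge (Set.mem_univ y))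
  refine ⟨g • x₀, ?_⟩
  rw [j.emb_smul]
  change dist _ (g • k) < R
  rw [dist_smul, dist_comm]
  exact hR hk

theorem isShortExact_restrict (hE : E.IsGCompact) (n : ℕ) :
    IsShortExact ((E.higsonForget j.image).app n).hom ((higsonRestrict j).app n).hom := by
  refine ⟨higsonForget_injective _ n, ?_, fun f => ⟨fun hf => ?_, ?_⟩⟩
  -- Over an empty space the target algebra is zero.
  · rcases isEmpty_or_nonempty (X.X n) with hX | hX
    · exact fun f => ⟨0, Subtype.ext (BoundedContinuousFunction.ext fun x => (hX.false x).elim)⟩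
    · obtain ⟨R, hR⟩ := j.exists_dist_lt hE n
      refine surjective_of_approx _
        fun (f : (higsonAlg G (X.X n) (X.noSub.set n) (X.noSub.smul_mem n)).sub) ε hε => ?_
      obtain ⟨g, h1, h2, h3⟩ := exists_approx_higson (j.isometry n) (j.isClosed_range n) hR
        f.2.1 f.2.2.1 hε
      refine ⟨(⟨g, h1, h2, fun _ hy => hy.elim⟩ :
        (higsonAlg G (E.X n) (E.noSub.set n) (E.noSub.smul_mem n)).sub), ?_⟩
      exact (BoundedContinuousFunction.norm_le hε.le).2 h3
  · refine ⟨(⟨f.1, f.2.1, f.2.2.1, ?_⟩ :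
      (higsonAlg G (E.X n) (j.image.set n) (j.image.smul_mem n)).sub), rfl⟩
    rintro _ ⟨x, rfl⟩
    exact congrArg (fun f => f.1 x) hf
  · rintro ⟨g, rfl⟩
    exact Subtype.ext (BoundedContinuousFunction.ext fun x => g.2.2.2 _ ⟨x, rfl⟩)

/-- A function in the compactification of the pair vanishes on `X`, which comes within `R` of every
point, so its value at `y` is bounded by its variation at scale `R` and tends to zero. Its values
are compact, being differences from a value on `X`, which is zero. -/
theorem c0KToHigson_bijective (hE : E.IsGCompact) {n : ℕ} (hX : Nonempty (X.X n)) :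
    Function.Bijective ((E.c0KToHigson j.image).app n).hom := by
  refine ⟨c0KToHigson_injective _ n,
    fun (f : (higsonAlg G (E.X n) (j.image.set n) (j.image.smul_mem n)).sub) => ?_⟩
  obtain ⟨R, hR⟩ := j.exists_dist_lt hE n
  obtain ⟨x₀⟩ := hX
  have hR0 : 0 < R := dist_nonneg.trans_lt (hR (j.emb n x₀)).choose_spec
  have h0 : ∀ x, f.1 (j.emb n x) = 0 := fun x => f.2.2.2 _ ⟨x, rfl⟩
  refine ⟨(⟨f.1, fun y => ?_, Metric.tendsto_nhds.2 fun ε hε => ?_, f.2.2.2⟩ :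
    (c0KAlg G (E.X n) (j.image.set n) (j.image.smul_mem n)).sub), rfl⟩
  · have := f.2.2.1 y (j.emb n x₀)
    rwa [h0, sub_zero] at this
  · filter_upwards [vanishingVariation_iff.1 f.2.1 R hR0 (ε / 2) (half_pos hε)] with y hy
    obtain ⟨x, hx⟩ := hR y
    have := hy (j.emb n x) hx
    rw [h0] at this
    exact this.trans_lt (half_lt_self hε)

theorem nonempty_of_le (X : SigmaGMetricSpace.{u, v} G) {k n : ℕ} (h : Nonempty (X.X k))
    (hn : k ≤ n) : Nonempty (X.X n) :=
  Nat.le_induction h (fun _ _ ⟨x⟩ => ⟨X.incl _ x⟩) n hn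

theorem isExactSeq_restrict (hμ : μ.IsExact) (hE : E.IsGCompact) {k : ℕ}
    (hX : Nonempty (X.X k)) :
    IsExactSeq (μ.towerHom (E.higsonForget j.image)) (μ.towerHom (higsonRestrict j)) k where
  exact n := hμ _ _ (isShortExact_restrict j hE n)
  surjective _ hn := by
    refine μ.map_surjective _ fun f => ?_
    -- Functions in the compactification of the pair extend to the next level as `C_0` functions;
    -- for general functions of vanishing variation this is not clear, since the inclusions of
    -- levels are only coarse embeddings.
    obtain ⟨f, rfl⟩ := (c0KToHigson_bijective j hE (nonempty_of_le X hX hn)).2 f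
    obtain ⟨f, rfl⟩ := c0K_map_surjective (B := j.image) (fun n => j.isClosed_range n) j.inter _ f
    exact ⟨((E.c0KToHigson j.image).app (_ + 1)).hom f, rfl⟩

theorem canonicalMap_bijective (hE : E.IsGCompact) {k : ℕ} (hX : Nonempty (X.X k)) (m : ℤ) :
    Function.Bijective (E.canonicalMap μ j.image m) :=
  (TowerHom.kMap_bijective_of_eventually (k₀ := k) (fun _ hn => μ.map_bijective _
    (c0KToHigson_bijective j hE (nonempty_of_le X hX hn))) _).comp
    (stabilisationMap_bijective μ E j.image m)

/-- The natural map `C_0(E ∖ B, K) → C_0(E, K)`. -/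
def c0KForget (E : SigmaGMetricSpace.{u, v} G) (B : E.SubFamily) :
    GTowerHom (E.c0K B) (E.c0K E.noSub) where
  app _ := FunAlg.pull _ _ (ContinuousMap.id _) (fun _ _ => rfl) fun _ hf =>
    ⟨hf.1, hf.2.1, fun _ hy => hy.elim⟩
  comm _ _ := rfl

/-- Naturality: both composites are induced by viewing a scalar function that vanishes on `B`, times
the rank one projection, as an element of the compactification of `E`. -/
theorem kMap_canonicalMap (B : E.SubFamily) (m : ℤ) (θ : E.EquivariantK μ B m) :
    (μ.towerHom (E.higsonForget B)).kMap (-m) (E.canonicalMap μ B m θ) =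
      (μ.towerHom (E.c0KToHigson E.noSub)).kMap (-m)
        (E.stabilisationMap μ E.noSub m (E.forgetMap μ B m θ)) := by
  have h1 : (μ.towerHom (E.higsonForget B)).kMap (-m) ((μ.towerHom (E.c0KToHigson B)).kMap (-m)
      (E.stabilisationMap μ B m θ)) = (μ.towerHom (E.c0KToHigson E.noSub)).kMap (-m)
      ((μ.towerHom (E.c0KForget B)).kMap (-m) (E.stabilisationMap μ B m θ)) :=
    TowerHom.kMap_comp (fun n => μ.map_map_eq ((E.c0KToHigson B).app n) ((E.higsonForget B).app n)
      ((E.c0KForget B).app n) ((E.c0KToHigson E.noSub).app n) fun _ => rfl) _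
  exact h1.trans (congrArg _
    (TowerHom.kMap_comp (fun n => μ.map_map_eq ((E.c0Stab B).app n) ((E.c0KForget B).app n)
      ((E.c0Forget B).app n) ((E.c0Stab E.noSub).app n) fun _ => rfl) θ))

end SigmaGMetricSpace

end HigsonRoe

end

theorem mainTheorem9 {G : Type v} [Group G] [Countable G]
    (μ : HigsonRoe.CrossedProductFunctor.{u, v} G) (hμ : μ.IsExact)
    (E X : HigsonRoe.SigmaGMetricSpace.{u, v} G)
    (hE : E.IsProperClassifyingSpace) (hX : X.IsGCompact) (hXne : ∃ k, Nonempty (X.X k))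
    (j : HigsonRoe.SigmaGMetricSpace.Embedding X E) (n : ℤ) :
    -- the maps defining `δ` and the co-assembly map are isomorphisms
    Function.Bijective (E.canonicalMap μ j.image (n + 1)) ∧
    Function.Bijective (E.stabilisationMap μ E.noSub (n + 1)) ∧
    -- hence `δ` and the co-assembly map are well defined
    (∃! δ, HigsonRoe.SigmaGMetricSpace.IsDelta μ j n δ) ∧
    (∃! α, HigsonRoe.SigmaGMetricSpace.IsCoassembly μ E n α) ∧
    -- the lifting criterion
    ∀ δ α, HigsonRoe.SigmaGMetricSpace.IsDelta μ j n δ →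
      HigsonRoe.SigmaGMetricSpace.IsCoassembly μ E n α →
      ∀ θ : E.EquivariantK μ j.image (n + 1),
        θ ∈ Set.range δ ↔ E.forgetMap μ j.image (n + 1) θ ∈ Set.range α := by
  obtain ⟨k, hk⟩ := hXne
  have hm : -(n + 1) = -n - 1 := neg_add' n 1
  have hδ := HigsonRoe.SigmaGMetricSpace.isExactSeq_restrict μ j hμ hE.1 hk
  have hα := HigsonRoe.SigmaGMetricSpace.isExactSeq_corona μ hμ E
  have hc := HigsonRoe.SigmaGMetricSpace.canonicalMap_bijective μ j hE.1 hk (n + 1)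
  have hs := HigsonRoe.SigmaGMetricSpace.stabilisationMap_bijective μ E E.noSub (n + 1)
  refine ⟨hc, hs, ?_, ?_, fun δ α hδ' hα' θ => ?_⟩
  · simp only [HigsonRoe.SigmaGMetricSpace.IsDelta, hδ.isBoundary_iff_boundaryHom_eq hm]
    exact HigsonRoe.existsUnique_factor hc _
  · simp only [HigsonRoe.SigmaGMetricSpace.IsCoassembly, hα.isBoundary_iff_boundaryHom_eq hm]
    exact HigsonRoe.existsUnique_factor hs _
  · have h1 : ∀ ξ, hδ.boundaryHom hm ξ = E.canonicalMap μ j.image (n + 1) (δ ξ) := fun ξ =>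
      (hδ.isBoundary_iff_boundaryHom_eq hm).1 ((hδ' ξ _).2 rfl)
    have h2 : ∀ ξ, hα.boundaryHom hm ξ = E.stabilisationMap μ E.noSub (n + 1) (α ξ) := fun ξ =>
      (hα.isBoundary_iff_boundaryHom_eq hm).1 ((hα' ξ _).2 rfl)
    -- Both memberships become vanishing in the K-theory of the compactification of `E`, and
    -- naturality identifies the two elements.
    rw [hδ.mem_range_iff hm hc.1 h1, hα.mem_range_iff hm hs.1 h2,
      HigsonRoe.SigmaGMetricSpace.kMap_canonicalMap]
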